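/- **Setting.** Let $\mathbb{X}$ be a compact, connected, $C^\infty$ Riemannian manifold (without boundary) with geodesic distance $\rho$, let $\mu$ be a Borel probability measure on $\mathbb{X}$, and let $B(x,t)=\{y:\rho(x,y)\le t\}$. Let $\{\phi_j\}_{j\ge 0}$ be real continuous functions on $\mathbb{X}$, orthonormal in $L^2(\mu)$, with $\phi_0\equiv 1$, and let $0=\ell_0\le\ell_1\le\cdots$ be real numbers with $\ell_j\to\infty$. Write $\langle f,g\rangle=\int fg\,d\mu$, $\|\cdot\|_p$ for the norm of $L^p(\mu)$, $\Pi_L=\mathrm{span}\{\phi_j:\ell_j\le L\}$, $X^p$ for the closure of $\bigcup_{L\ge0}\Pi_L$ in $L^p(\mu)$, $1/p'=1-1/p$, and $K_t(x,y)=\sum_{j}e^{-\ell_j^2t}\phi_j(x)\phi_j(y)$. Assume that there are $\alpha>0$ and positive constants $c,c_1,\dots$ (whose values may differ from line to line) such that the series for $K_t(x,y)$ converges and, for all $x,y\in\mathbb{X}$ and $t\in(0,1]$: 1. $\mu(B(x,s))\le c\,s^\alpha$ for all $s>0$; 2. $\int_{\mathbb{X}} K_t(x,y)\,d\mu(y)=1$;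 3. $|K_t(x,y)|\le c_1t^{-\alpha/2}\exp(-c\rho(x,y)^2/t)$; 4. $K_t(x,\cdot)$ is differentiable and $|\partial_yK_t(x,y)|\le c_1t^{-\alpha/2-1}\exp(-c\rho(x,y)^2/t)$ for the derivative $\partial_y$ in any unit tangent direction at $y$; 5. $K_t(x,x)\ge c\,t^{-\alpha/2}$; 6. (product assumption) for some $A\ge2$, the numbers $\epsilon_L=\sup_{\ell_j,\ell_k\le L}\inf_{P\in\Pi_{AL}}\|\phi_j\phi_k-P\|_\infty$ satisfy $L^s\epsilon_L\to0$ as $L\to\infty$ for every $s>0$. Fix an integer $S>\alpha$ and $\beta\in\mathbb{R}$. Let $b:\mathbb{R}\to\mathbb{R}$ be a mask of type $\beta$: $b$ is even and $S$ times continuously differentiable, and $b(t)=(1+t)^{-\beta}F_b(\log t)$ for $t>0$, where $F_b^{(k)}$ is bounded on $\mathbb{R}$ for $k=0,\dots,S$ and $F_b$ is bounded below by a positive constant. Let $G:\mathbb{X}\times\mathbb{X}\to\mathbb{R}$ have the formal expansion $G(x,y)=\sum_jb(\ell_j)\phi_j(x)\phi_j(y)$; that is, for every $y$, $G(\cdot,y)\in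 L^1(\mu)$ and $\langle G(\cdot,y),\phi_k\rangle=b(\ell_k)\phi_k(y)$ for all $k$. For $f\in L^1(\mu)$, $(\Delta^*)^rf$ is the function $g\in L^1(\mu)$, if it exists, with $\langle g,\phi_k\rangle=(1+\ell_k)^r\langle f,\phi_k\rangle$ for all $k$. **Theorem.** Let $1\le p\le\infty$ and $0<r<\beta-\alpha/p'$. There is a constant $c>0$ such that for every finite set $\mathcal{C}\subset\mathbb{X}$ with at least two points, with minimal separation $q=\min_{x,y\in\mathcal{C},\,x\ne y}\rho(x,y)$, and all real numbers $a_y$, $y\in\mathcal{C}$, the eignet $\Psi=\sum_{y\in\mathcal{C}}a_yG(\cdot,y)$ satisfies: $\Psi\in X^p$, $(\Delta^*)^r\Psi$ exists and belongs to $X^p$, and $$\|(\Delta^*)^r\Psi\|_p\le c\,q^{-r}\|\Psi\|_p.$$ -/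

import Mathlib

open MeasureTheory Filter Set Bundle
open scoped ENNReal Topology Manifold ContDiff

namespace Eignet

/-- A mask of type `β` (of smoothness order `S`): an even, `S` times continuously differentiable
function `b` with `b t = (1 + t) ^ (-β) * F (log t)` for `t > 0`, where `F` has bounded derivatives
of orders `0, …, S` and is bounded below by a positive constant. -/
def IsMask (S : ℕ) (β : ℝ) (b : ℝ → ℝ) : Prop :=
  (∀ t, b (-t) = b t) ∧ ContDiff ℝ S b ∧
    ∃ F : ℝ → ℝ, ContDiff ℝ S F ∧
      (∀ t, 0 < t → b t = (1 + t) ^ (-β) * F (Real.log t)) ∧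
      (∃ B : ℝ, ∀ k, k ≤ S → ∀ t, |iteratedDeriv k F t| ≤ B) ∧
      ∃ m : ℝ, 0 < m ∧ ∀ t, m ≤ F t

section Systems

variable {M : Type*} [MeasurableSpace M]

/-- The system `φ₀ ≡ 1, φ₁, φ₂, …` of continuous functions, orthonormal in `L²(μ)`, together with
the nondecreasing sequence `0 = ℓ₀ ≤ ℓ₁ ≤ …` tending to infinity. -/
structure IsOrthonormalSystem [TopologicalSpace M] (μ : Measure M) (φ : ℕ → M → ℝ) (ℓ : ℕ → ℝ) :
    Prop where
  continuous : ∀ j, Continuous (φ j)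
  orthonormal : ∀ j k, ∫ x, φ j x * φ k x ∂μ = if j = k then 1 else 0
  phi_zero : ∀ x, φ 0 x = 1
  ell_zero : ℓ 0 = 0
  ell_mono : Monotone ℓ
  ell_tendsto : Tendsto ℓ atTop atTop

/-- `Π_L = span {φ_j : ℓ_j ≤ L}`. -/
def diffusionPoly (φ : ℕ → M → ℝ) (ℓ : ℕ → ℝ) (L : ℝ) : Submodule ℝ (M → ℝ) :=
  Submodule.span ℝ (φ '' {j | ℓ j ≤ L})

/-- `Π_∞`, the union of all `Π_L`, `L ≥ 0`. -/
def allDiffusionPoly (φ : ℕ → M → ℝ) (ℓ : ℕ → ℝ) : Set (M → ℝ) :=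
  {P | ∃ L : ℝ, 0 ≤ L ∧ P ∈ diffusionPoly φ ℓ L}

/-- `dist(p; f, W) = inf {‖f - P‖_p : P ∈ W}`, in `[0, ∞]`. -/
noncomputable def distLp (μ : Measure M) (p : ℝ≥0∞) (f : M → ℝ) (W : Set (M → ℝ)) : ℝ≥0∞ :=
  ⨅ P ∈ W, eLpNorm (f - P) p μ

/-- `f ∈ X^p`, the closure of `Π_∞` in `L^p(μ)`. -/
def MemX (μ : Measure M) (φ : ℕ → M → ℝ) (ℓ : ℕ → ℝ) (p : ℝ≥0∞) (f : M → ℝ) : Prop :=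
  MemLp f p μ ∧ distLp μ p f (allDiffusionPoly φ ℓ) = 0

/-- `g = (Δ^*)^r f`: the integrable functions `f`, `g` satisfy
`⟨g, φ_k⟩ = (1 + ℓ_k)^r ⟨f, φ_k⟩` for all `k`. -/
def IsPseudoDeriv (μ : Measure M) (φ : ℕ → M → ℝ) (ℓ : ℕ → ℝ) (r : ℝ) (f g : M → ℝ) : Prop :=
  Integrable f μ ∧ Integrable g μ ∧
    ∀ k, ∫ x, g x * φ k x ∂μ = (1 + ℓ k) ^ r * ∫ x, f x * φ k x ∂μ

/-- `f ∈ W^p_r`: both `f` and `(Δ^*)^r f` belong to `X^p`. -/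
def MemW (μ : Measure M) (φ : ℕ → M → ℝ) (ℓ : ℕ → ℝ) (p : ℝ≥0∞) (r : ℝ) (f : M → ℝ) : Prop :=
  MemX μ φ ℓ p f ∧ ∃ g, MemX μ φ ℓ p g ∧ IsPseudoDeriv μ φ ℓ r f g

/-- `G` has the formal expansion `G(x, y) = ∑_j b(ℓ_j) φ_j(x) φ_j(y)`: for every `y` the function
`G(·, y)` is integrable and `⟨G(·, y), φ_k⟩ = b(ℓ_k) φ_k(y)` for all `k`. -/
def HasFormalExpansion (μ : Measure M) (φ : ℕ → M → ℝ) (ℓ : ℕ → ℝ) (b : ℝ → ℝ)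
    (G : M → M → ℝ) : Prop :=
  ∀ y, Integrable (fun x => G x y) μ ∧ ∀ k, ∫ x, G x y * φ k x ∂μ = b (ℓ k) * φ k y

/-- The eignet `∑_{y ∈ C} a_y G(·, y)`. -/
def eignet (G : M → M → ℝ) (C : Finset M) (a : M → ℝ) : M → ℝ :=
  fun x => ∑ y ∈ C, a y * G x y

/-- The heat kernel `K_t(x, y) = ∑_j exp(-ℓ_j² t) φ_j(x) φ_j(y)`. -/
noncomputable def heatKernel (φ : ℕ → M → ℝ) (ℓ : ℕ → ℝ) (t : ℝ) (x y : M) : ℝ :=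
  ∑' j, Real.exp (-(ℓ j) ^ 2 * t) * φ j x * φ j y

/-- `ε_L = sup {dist(∞; φ_j φ_k, Π_{AL}) : ℓ_j, ℓ_k ≤ L}`. -/
noncomputable def productError (μ : Measure M) (φ : ℕ → M → ℝ) (ℓ : ℕ → ℝ) (A L : ℝ) : ℝ≥0∞ :=
  ⨆ (j : ℕ) (k : ℕ) (_ : ℓ j ≤ L ∧ ℓ k ≤ L),
    distLp μ ⊤ (φ j * φ k) (diffusionPoly φ ℓ (A * L) : Set (M → ℝ))

/-- Product assumption: `L^s ε_L → 0` as `L → ∞`, for every `s > 0`. -/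
def ProductAssumption (μ : Measure M) (φ : ℕ → M → ℝ) (ℓ : ℕ → ℝ) (A : ℝ) : Prop :=
  ∀ s : ℝ, 0 < s →
    Tendsto (fun L : ℝ => ENNReal.ofReal (L ^ s) * productError μ φ ℓ A L) atTop (𝓝 0)

/-- `∫ K_t(x, y) dμ(y) = 1` for all `x`. -/
def HeatKernelIntegral (μ : Measure M) (φ : ℕ → M → ℝ) (ℓ : ℕ → ℝ) : Prop :=
  ∀ t ∈ Ioc (0 : ℝ) 1, ∀ x, Integrable (heatKernel φ ℓ t x) μ ∧ ∫ y, heatKernel φ ℓ t x y ∂μ = 1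

/-- `K_t(x, x) ≥ c t^(-α/2)` for all `x` and `t ∈ (0, 1]`. -/
def HeatKernelLowerBound (φ : ℕ → M → ℝ) (ℓ : ℕ → ℝ) (α : ℝ) : Prop :=
  ∃ c : ℝ, 0 < c ∧ ∀ t ∈ Ioc (0 : ℝ) 1, ∀ x, c * t ^ (-α / 2) ≤ heatKernel φ ℓ t x x

end Systems

section Metric

variable {M : Type*} [MetricSpace M]

/-- `μ(B(x, r)) ≤ c r^α` for all closed balls. -/
def BallMeasureBound [MeasurableSpace M] (μ : Measure M) (α : ℝ) : Prop :=
  ∃ c : ℝ, 0 < c ∧ ∀ x, ∀ r : ℝ, 0 < r → μ (Metric.closedBall x r) ≤ ENNReal.ofReal (c * r ^ α)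

/-- The series of `K_t(x, y)` converges and
`|K_t(x, y)| ≤ c₁ t^(-α/2) exp(-c ρ(x, y)² / t)` for all `x`, `y` and `t ∈ (0, 1]`. -/
def HeatKernelGaussianBound (φ : ℕ → M → ℝ) (ℓ : ℕ → ℝ) (α : ℝ) : Prop :=
  ∃ c₁ c : ℝ, 0 < c₁ ∧ 0 < c ∧ ∀ t ∈ Ioc (0 : ℝ) 1, ∀ x y,
    Summable (fun j => Real.exp (-(ℓ j) ^ 2 * t) * φ j x * φ j y) ∧
      |heatKernel φ ℓ t x y| ≤ c₁ * t ^ (-α / 2) * Real.exp (-c * dist x y ^ 2 / t)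

/-- `|∂_y K_t(x, y)| ≤ c₁ t^(-α/2-1) exp(-c ρ(x, y)² / t)` for the derivative `∂_y` in the direction
of any unit tangent vector at `y` (a unit direction in normal coordinates at `y`). -/
def HeatKernelGradientBound {n : ℕ} [ChartedSpace (EuclideanSpace ℝ (Fin n)) M]
    [RiemannianBundle (fun x : M => TangentSpace (𝓡 n) x)]
    (φ : ℕ → M → ℝ) (ℓ : ℕ → ℝ) (α : ℝ) : Prop :=
  ∃ c₁ c : ℝ, 0 < c₁ ∧ 0 < c ∧ ∀ t ∈ Ioc (0 : ℝ) 1, ∀ x y : M,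
    MDifferentiableAt (𝓡 n) 𝓘(ℝ, ℝ) (heatKernel φ ℓ t x) y ∧
      ∀ v : TangentSpace (𝓡 n) y, ‖v‖ = 1 →
        let d : TangentSpace (𝓡 n) y →L[ℝ] ℝ := mfderiv (𝓡 n) 𝓘(ℝ, ℝ) (heatKernel φ ℓ t x) y
        |d v| ≤
          c₁ * t ^ (-α / 2 - 1) * Real.exp (-c * dist x y ^ 2 / t)

end Metric

end Eignet

/-!
All estimates rest on the Gaussian upper bound of the heat kernel, its on-diagonal lower bound, its
conservativeness and the volume bound; `IsHeatSystem` bundles all of them but the lower bound.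

*Multipliers.* A mask cut off smoothly to frequencies `ℓ` comparable to `N` has a kernel whose rows
are bounded in `L¹` by the size of the mask (`lintegral_ker_multiplier_le`). Since only the heat
kernel is under control, the cut-off mask is written as a function of `w = exp (-ℓ² / N²)`, and
with `w = (1 + cos θ) / 2` as `w` times a cosine series in `θ`
(`multiplier_expansion`). The kernel of `w cos (k θ)` is estimated in `L²` near the
diagonal by orthonormality. Far from the diagonal `cos (k θ)` is a polynomial of degree `k` in `w`
with coefficients at most exponential in `k`, so the Gaussian bounds beat them outside of a ball of
radius proportional to `k / N` (`lintegral_ker_heatMul_mul_cos_le`). The resulting growth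
`(1 + k) ^ (α / 2)` is summable against the cosine coefficients because `S > α` derivatives of the
mask are bounded and `α / 2 + 1 / 2 < S`. Schur's test (`eLpNorm_integral_mul_le`) turns bounds for
rows into bounds on `L^p`.

*Stability.* Heat kernels at a time that is a small multiple of the squared separation of the nodes
form a diagonally dominant matrix, so that their coefficients are controlled by the `L^p` norm of
their linear combination (`exists_eLpNorm_nodeMeasure_le`). The multiplier `exp (-ℓ² t) / b(ℓ)`
turns an eignet into such a combination, so the coefficients are controlled by the norm of
the eignet (`exists_eLpNorm_nodeMeasure_le_of_coeff`).

*Conclusion.* The derivative of an eignet is the sum of its dyadic frequency pieces. With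
`2 ^ (-n₀)` comparable to the separation, the pieces up to the frequency `2 ^ n₀` are bounded by
the eignet itself through the multiplier theorem; the pieces above it are bounded by the coefficients
(`eLpNorm_kerSum_piece_mask_le`), hence by the eignet again. Both bounds decay geometrically away
from `n₀` (`exists_bernstein`). The pieces of the derivative are summable in `L^p`, which gives
membership in `X^p` (`exists_memX_mask`), because coefficients determine integrable functions
(`ae_eq_of_coeff_eq`).
-/

namespace Eignet

-- the lemmas on a system share one list of variables, not all of which occur in each statement
set_option linter.unusedSectionVars false

/-! ### Families of functions with uniformly bounded derivatives -/

/-- A family of real functions is `S` times continuously differentiable on the open set `U`, with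
derivatives of orders `0, …, S` bounded on `U` uniformly in the family. The recursion on the
order is set up for proving the product and chain rules by induction. -/
def UniformCk {ι : Type*} (U : Set ℝ) : ℕ → (ι → ℝ → ℝ) → Prop
  | 0, f => (∀ i, ContinuousOn (f i) U) ∧ ∃ C, ∀ i, ∀ x ∈ U, |f i x| ≤ C
  | S + 1, f => (∀ i, DifferentiableOn ℝ (f i) U) ∧ (∃ C, ∀ i, ∀ x ∈ U, |f i x| ≤ C) ∧
      UniformCk U S (fun i => deriv (f i))

namespace UniformCk

variable {ι κ : Type*} {U V : Set ℝ} {S : ℕ} {f g : ι → ℝ → ℝ}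

lemma bdd (h : UniformCk U S f) : ∃ C, ∀ i, ∀ x ∈ U, |f i x| ≤ C := by
  cases S with
  | zero => exact h.2
  | succ S => exact h.2.1

lemma continuousOn (h : UniformCk U S f) (i : ι) : ContinuousOn (f i) U := by
  cases S with
  | zero => exact h.1 i
  | succ S => exact (h.1 i).continuousOn

lemma pred (h : UniformCk U (S + 1) f) : UniformCk U S f := by
  induction S generalizing f with
  | zero => exact ⟨fun i => (h.1 i).continuousOn, h.2.1⟩
  | succ S ih => exact ⟨h.1, h.2.1, ih h.2.2⟩

lemma congr (hU : IsOpen U) (h : UniformCk U S f) (hfg : ∀ i, EqOn (f i) (g i) U) :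
    UniformCk U S g := by
  induction S generalizing f g with
  | zero =>
    refine ⟨fun i => (h.1 i).congr (hfg i).symm, ?_⟩
    obtain ⟨C, hC⟩ := h.2
    exact ⟨C, fun i x hx => hfg i hx ▸ hC i x hx⟩
  | succ S ih =>
    refine ⟨fun i => (h.1 i).congr (hfg i).symm, ?_, ih h.2.2 fun i => (hfg i).deriv hU⟩
    obtain ⟨C, hC⟩ := h.2.1
    exact ⟨C, fun i x hx => hfg i hx ▸ hC i x hx⟩

lemma mono (h : UniformCk V S f) (hUV : U ⊆ V) : UniformCk U S f := by
  induction S generalizing f with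
  | zero => exact ⟨fun i => (h.1 i).mono hUV, h.2.imp fun C hC i x hx => hC i x (hUV hx)⟩
  | succ S ih =>
    exact ⟨fun i => (h.1 i).mono hUV, h.2.1.imp fun C hC i x hx => hC i x (hUV hx), ih h.2.2⟩

lemma reindex (h : UniformCk U S f) (e : κ → ι) : UniformCk U S (fun k => f (e k)) := by
  induction S generalizing f with
  | zero => exact ⟨fun i => h.1 _, h.2.imp fun C hC i x hx => hC _ x hx⟩
  | succ S ih =>
    exact ⟨fun i => h.1 _, h.2.1.imp fun C hC i x hx => hC _ x hx, ih h.2.2⟩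

lemma add (hU : IsOpen U) (hf : UniformCk U S f) (hg : UniformCk U S g) :
    UniformCk U S (fun i x => f i x + g i x) := by
  have hb : ∃ C, ∀ i, ∀ x ∈ U, |f i x + g i x| ≤ C := by
    obtain ⟨C, hC⟩ := hf.bdd
    obtain ⟨D, hD⟩ := hg.bdd
    exact ⟨C + D, fun i x hx => (abs_add_le _ _).trans (add_le_add (hC i x hx) (hD i x hx))⟩
  induction S generalizing f g with
  | zero => exact ⟨fun i => (hf.1 i).add (hg.1 i), hb⟩
  | succ S ih =>
    refine ⟨fun i => (hf.1 i).add (hg.1 i), hb, ?_⟩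
    have hb' : ∃ C, ∀ i, ∀ x ∈ U, |deriv (f i) x + deriv (g i) x| ≤ C := by
      obtain ⟨C, hC⟩ := hf.2.2.bdd
      obtain ⟨D, hD⟩ := hg.2.2.bdd
      exact ⟨C + D, fun i x hx => (abs_add_le _ _).trans (add_le_add (hC i x hx) (hD i x hx))⟩
    refine (ih hf.2.2 hg.2.2 hb').congr hU fun i x hx => ?_
    exact (deriv_fun_add ((hf.1 i).differentiableAt (hU.mem_nhds hx))
      ((hg.1 i).differentiableAt (hU.mem_nhds hx))).symm

lemma mul (hU : IsOpen U) (hf : UniformCk U S f) (hg : UniformCk U S g) :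
    UniformCk U S (fun i x => f i x * g i x) := by
  have hb : ∃ C, ∀ i, ∀ x ∈ U, |f i x * g i x| ≤ C := by
    obtain ⟨C, hC⟩ := hf.bdd
    obtain ⟨D, hD⟩ := hg.bdd
    refine ⟨C * D, fun i x hx => ?_⟩
    rw [abs_mul]
    exact mul_le_mul (hC i x hx) (hD i x hx) (abs_nonneg _) ((abs_nonneg _).trans (hC i x hx))
  induction S generalizing f g with
  | zero => exact ⟨fun i => (hf.1 i).mul (hg.1 i), hb⟩
  | succ S ih =>
    refine ⟨fun i => (hf.1 i).mul (hg.1 i), hb, ?_⟩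
    have bd : ∀ {u v : ι → ℝ → ℝ}, UniformCk U S u → UniformCk U S v →
        UniformCk U S (fun i x => u i x * v i x) := by
      intro u v hu hv
      refine ih hu hv ?_
      obtain ⟨C, hC⟩ := hu.bdd
      obtain ⟨D, hD⟩ := hv.bdd
      refine ⟨C * D, fun i x hx => ?_⟩
      rw [abs_mul]
      exact mul_le_mul (hC i x hx) (hD i x hx) (abs_nonneg _) ((abs_nonneg _).trans (hC i x hx))
    refine ((bd hf.2.2 hg.pred).add hU (bd hf.pred hg.2.2)).congr hU fun i x hx => ?_
    exact (deriv_fun_mul ((hf.1 i).differentiableAt (hU.mem_nhds hx))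
      ((hg.1 i).differentiableAt (hU.mem_nhds hx))).symm

lemma comp (hU : IsOpen U) (hV : IsOpen V) (hf : UniformCk V S f) (hg : UniformCk U S g)
    (hm : ∀ i, MapsTo (g i) U V) : UniformCk U S (fun i x => f i (g i x)) := by
  induction S generalizing f with
  | zero =>
    exact ⟨fun i => (hf.1 i).comp (hg.1 i) (hm i), hf.2.imp fun C hC i x hx => hC i _ (hm i hx)⟩
  | succ S ih =>
    refine ⟨fun i => (hf.1 i).comp (hg.1 i) (hm i),
      hf.2.1.imp fun C hC i x hx => hC i _ (hm i hx), ?_⟩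
    refine ((ih hf.2.2 hg.pred).mul hU hg.2.2).congr hU fun i x hx => ?_
    have h1 : HasDerivAt (f i) (deriv (f i) (g i x)) (g i x) :=
      ((hf.1 i).differentiableAt (hV.mem_nhds (hm i hx))).hasDerivAt
    have h2 : HasDerivAt (g i) (deriv (g i) x) x :=
      ((hg.1 i).differentiableAt (hU.mem_nhds hx)).hasDerivAt
    exact (h1.comp x h2).deriv.symm

/-- Translates of a uniformly smooth family on the line are uniformly smooth. -/
lemma shift (h : UniformCk univ S f) (a : κ → ℝ) :
    UniformCk univ S (fun (k : ι × κ) x => f k.1 (a k.2 + x)) := by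
  induction S generalizing f with
  | zero =>
    exact ⟨fun i => (h.1 i.1).comp (by fun_prop) (mapsTo_univ _ _),
      h.2.imp fun C hC i x _ => hC _ _ (mem_univ _)⟩
  | succ S ih =>
    refine ⟨fun i => (h.1 i.1).comp (by fun_prop) (mapsTo_univ _ _),
      h.2.1.imp fun C hC i x _ => hC _ _ (mem_univ _), ?_⟩
    refine (ih h.2.2).congr isOpen_univ fun i x _ => ?_
    exact (deriv_comp_const_add (f i.1) (a i.2) x).symm

/-- A single function, smooth on an open neighbourhood `V` of a compact set containing `U`. -/
lemma of_contDiffOn {h : ℝ → ℝ} {K : Set ℝ} (hV : IsOpen V) (hh : ContDiffOn ℝ ∞ h V)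
    (hK : IsCompact K) (hUK : U ⊆ K) (hKV : K ⊆ V) : UniformCk U S (fun _ : ι => h) := by
  have hb : ∀ h : ℝ → ℝ, ContDiffOn ℝ ∞ h V → ∃ C, ∀ _ : ι, ∀ x ∈ U, |h x| ≤ C := by
    intro h hh
    obtain ⟨C, hC⟩ := hK.exists_bound_of_continuousOn (hh.continuousOn.mono hKV)
    exact ⟨C, fun _ x hx => hC x (hUK hx)⟩
  induction S generalizing h with
  | zero => exact ⟨fun _ => hh.continuousOn.mono (hUK.trans hKV), hb h hh⟩
  | succ S ih =>
    refine ⟨fun _ => (hh.differentiableOn (by simp)).mono (hUK.trans hKV), hb h hh, ih ?_⟩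
    exact ((contDiffOn_infty_iff_deriv_of_isOpen hV).1 hh).2

lemma const (c : ι → ℝ) {C : ℝ} (hc : ∀ i, |c i| ≤ C) : UniformCk U S (fun i _ => c i) := by
  induction S generalizing c C with
  | zero => exact ⟨fun _ => continuousOn_const, C, fun i _ _ => hc i⟩
  | succ S ih =>
    refine ⟨fun _ => differentiableOn_const _, ⟨C, fun i _ _ => hc i⟩, ?_⟩
    have := ih (fun _ => 0) (C := 0) (by simp)
    simpa using this

lemma const_mul (hU : IsOpen U) (hf : UniformCk U S f) (c : ℝ) :
    UniformCk U S (fun i x => c * f i x) :=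
  (const (fun _ => c) (fun _ => le_rfl)).mul hU hf

lemma inv (hU : IsOpen U) (hf : UniformCk U S f) {m : ℝ} (hm : 0 < m)
    (hmf : ∀ i, ∀ x ∈ U, m ≤ f i x) : UniformCk U S (fun i x => (f i x)⁻¹) := by
  have hb : ∃ C, ∀ i, ∀ x ∈ U, |(f i x)⁻¹| ≤ C := by
    refine ⟨m⁻¹, fun i x hx => ?_⟩
    rw [abs_of_pos (inv_pos.2 (hm.trans_le (hmf i x hx)))]
    exact inv_anti₀ hm (hmf i x hx)
  have h0 : ∀ i, ∀ x ∈ U, f i x ≠ 0 := fun i x hx => (hm.trans_le (hmf i x hx)).ne'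
  induction S with
  | zero => exact ⟨fun i => (hf.1 i).inv₀ (h0 i), hb⟩
  | succ S ih =>
    refine ⟨fun i => (hf.1 i).inv (h0 i), hb, ?_⟩
    have h1 := ih hf.pred
    refine (((h1.mul hU h1).mul hU hf.2.2).const_mul hU (-1)).congr hU fun i x hx => ?_
    have h2 := ((hf.1 i).differentiableAt (hU.mem_nhds hx)).hasDerivAt.inv (h0 i x hx)
    have h3 : deriv (fun x => (f i x)⁻¹) x = _ := h2.deriv
    simp only [h3]
    have := h0 i x hx
    field_simp

/-- A family on `U` that vanishes off a closed subset `K` of `U` is uniformly smooth on the line. -/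
lemma of_support {K : Set ℝ} (hU : IsOpen U) (hK : IsClosed K) (hKU : K ⊆ U)
    (hf : UniformCk U S f) (hf0 : ∀ i, ∀ x ∉ K, f i x = 0) : UniformCk univ S f := by
  have hb : ∃ C, ∀ i, ∀ x ∈ (univ : Set ℝ), |f i x| ≤ C := by
    obtain ⟨C, hC⟩ := hf.bdd
    refine ⟨max C 0, fun i x _ => ?_⟩
    by_cases hx : x ∈ K
    · exact le_max_of_le_left (hC i x (hKU hx))
    · simp [hf0 i x hx]
  have hz : ∀ i, ∀ x ∉ K, f i =ᶠ[𝓝 x] fun _ => 0 := by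
    intro i x hx
    filter_upwards [hK.isOpen_compl.mem_nhds hx] with y hy using hf0 i y hy
  induction S generalizing f with
  | zero =>
    refine ⟨fun i => ?_, hb⟩
    rw [continuousOn_univ, continuous_iff_continuousAt]
    intro x
    by_cases hx : x ∈ K
    · exact (hf.1 i).continuousAt (hU.mem_nhds (hKU hx))
    · exact continuousAt_const.congr (hz i x hx).symm
  | succ S ih =>
    have hdf : ∀ i, ∀ x ∉ K, deriv (f i) x = 0 := fun i x hx => by
      rw [(hz i x hx).deriv_eq, deriv_const]
    refine ⟨fun i => ?_, hb, ih hf.2.2 hdf ?_ fun i x hx => ?_⟩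
    · rw [differentiableOn_univ]
      intro x
      by_cases hx : x ∈ K
      · exact (hf.1 i).differentiableAt (hU.mem_nhds (hKU hx))
      · exact (differentiableAt_const _).congr_of_eventuallyEq (hz i x hx)
    · obtain ⟨C, hC⟩ := hf.2.2.bdd
      refine ⟨max C 0, fun i x _ => ?_⟩
      by_cases hx : x ∈ K
      · exact le_max_of_le_left (hC i x (hKU hx))
      · simp [hdf i x hx]
    · filter_upwards [hK.isOpen_compl.mem_nhds hx] with y hy using hdf i y hy

lemma of_iteratedDeriv {F : ℝ → ℝ} (hF : ContDiff ℝ S F) {B : ℝ}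
    (hB : ∀ k, k ≤ S → ∀ t, |iteratedDeriv k F t| ≤ B) : UniformCk univ S (fun _ : ι => F) := by
  induction S generalizing F with
  | zero =>
    refine ⟨fun _ => hF.continuous.continuousOn, B, fun _ x _ => ?_⟩
    simpa using hB 0 le_rfl x
  | succ S ih =>
    refine ⟨fun _ => (hF.differentiable (by simp)).differentiableOn,
      ⟨B, fun _ x _ => by simpa using hB 0 (Nat.zero_le _) x⟩, ih ?_ fun k hk t => ?_⟩
    · have h := hF
      push_cast at h
      exact (contDiff_succ_iff_deriv.1 h).2.2
    · rw [← iteratedDeriv_succ']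
      exact hB (k + 1) (by omega) t

end UniformCk

/-! ### Cosine expansions of smooth even periodic functions -/

section Cosine

open Real

lemma zero_lt_zero_add_two_pi : (0 : ℝ) < 0 + 2 * π := by positivity

/-- The Fourier coefficients, on a period of length `2π`, of a real function. -/
noncomputable def circleCoeff (f : ℝ → ℝ) (n : ℤ) : ℂ :=
  fourierCoeffOn zero_lt_zero_add_two_pi (fun x => (f x : ℂ)) n

lemma abs_mul_norm_circleCoeff_le {f : ℝ → ℝ} (hf : Differentiable ℝ f)
    (hf' : Continuous (deriv f)) (hper : Function.Periodic f (2 * π)) (n : ℤ) :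
    |(n : ℝ)| * ‖circleCoeff f n‖ ≤ ‖circleCoeff (deriv f) n‖ := by
  rcases eq_or_ne n 0 with rfl | hn
  · simp
  have h := fourierCoeffOn_of_hasDerivAt zero_lt_zero_add_two_pi (n := n) hn
    (f := fun x => (f x : ℂ)) (f' := fun x => ((deriv f x : ℝ) : ℂ))
    (fun x _ => HasDerivAt.ofReal_comp (hf x).hasDerivAt)
    ((Complex.continuous_ofReal.comp hf').intervalIntegrable _ _)
  have hn' : (0 : ℝ) < |(n : ℝ)| := abs_pos.2 (by exact_mod_cast hn)
  rw [circleCoeff, circleCoeff, h, hper 0]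
  simp only [sub_self, mul_zero, zero_sub, norm_mul, norm_neg, norm_div]
  have e : ‖(((0 + 2 * π : ℝ) : ℂ) - ((0 : ℝ) : ℂ))‖ = 2 * π := by
    rw [← Complex.ofReal_sub, Complex.norm_real]
    simp [abs_of_pos pi_pos]
  rw [e]
  simp only [Complex.norm_I, norm_one, Complex.norm_intCast, Complex.norm_real, Real.norm_eq_abs,
    abs_of_pos pi_pos, Complex.norm_two]
  apply le_of_eq
  field_simp

/-- Parseval's identity for the `S`-th derivative. -/
lemma summable_sq_circleCoeff {ι : Type*} {S : ℕ} {ψ : ι → ℝ → ℝ} (h : UniformCk univ S ψ)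
    (hper : ∀ i, Function.Periodic (ψ i) (2 * π)) :
    ∃ C, ∀ i, Summable (fun n : ℤ => (|(n : ℝ)| ^ S * ‖circleCoeff (ψ i) n‖) ^ 2) ∧
      ∑' n : ℤ, (|(n : ℝ)| ^ S * ‖circleCoeff (ψ i) n‖) ^ 2 ≤ C := by
  induction S generalizing ψ with
  | zero =>
    obtain ⟨C, hC⟩ := h.2
    refine ⟨C ^ 2, fun i => ?_⟩
    have hc : Continuous (ψ i) := by simpa [continuousOn_univ] using h.1 i
    have hm : MemLp (fun x => (ψ i x : ℂ)) 2 (volume.restrict (Ioc 0 (0 + 2 * π))) := by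
      refine MemLp.of_bound (Complex.continuous_ofReal.comp hc).aestronglyMeasurable C ?_
      exact Eventually.of_forall fun x => by simpa using hC i x trivial
    have hs := hasSum_sq_fourierCoeffOn zero_lt_zero_add_two_pi hm
    simp only [pow_zero, one_mul]
    refine ⟨hs.summable, hs.tsum_eq.trans_le ?_⟩
    have hle : ∫ x in (0 : ℝ)..(0 + 2 * π), ‖(ψ i x : ℂ)‖ ^ 2 ≤
        ∫ x in (0 : ℝ)..(0 + 2 * π), C ^ 2 := by
      refine intervalIntegral.integral_mono_on zero_lt_zero_add_two_pi.le ?_ (by simp) ?_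
      · exact Continuous.intervalIntegrable (by fun_prop) _ _
      · intro x _
        have := hC i x trivial
        rw [Complex.norm_real, Real.norm_eq_abs]
        gcongr
    simp only [intervalIntegral.integral_const, smul_eq_mul, sub_zero] at hle ⊢
    have hpi := zero_lt_zero_add_two_pi
    calc (0 + 2 * π)⁻¹ * _ ≤ (0 + 2 * π)⁻¹ * ((0 + 2 * π) * C ^ 2) := by gcongr
      _ = C ^ 2 := by field_simp
  | succ S ih =>
    have hd : ∀ i, Differentiable ℝ (ψ i) := fun i => by simpa [differentiableOn_univ] using h.1 i
    have hc : ∀ i, Continuous (deriv (ψ i)) := fun i => by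
      simpa [continuousOn_univ] using h.2.2.continuousOn i
    have hp : ∀ i, Function.Periodic (deriv (ψ i)) (2 * π) := fun i x => by
      rw [← deriv_comp_add_const]
      congr 1
      exact funext (hper i)
    obtain ⟨C, hC⟩ := ih h.2.2 hp
    refine ⟨C, fun i => ?_⟩
    have hle : ∀ n : ℤ, (|(n : ℝ)| ^ (S + 1) * ‖circleCoeff (ψ i) n‖) ^ 2 ≤
        (|(n : ℝ)| ^ S * ‖circleCoeff (deriv (ψ i)) n‖) ^ 2 := by
      intro n
      have := abs_mul_norm_circleCoeff_le (hd i) (hc i) (hper i) n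
      rw [pow_succ |(n : ℝ)|, mul_assoc]
      gcongr
    have hs := Summable.of_nonneg_of_le (fun n => sq_nonneg _) hle (hC i).1
    exact ⟨hs, (hs.tsum_le_tsum hle (hC i).1).trans (hC i).2⟩

lemma summable_one_add_abs_rpow {s : ℝ} (hs : s < -1) :
    Summable (fun n : ℤ => (1 + |(n : ℝ)|) ^ s) := by
  have h : Summable (fun n : ℕ => (1 + (n : ℝ)) ^ s) := by
    have := (summable_nat_add_iff 1).2 (Real.summable_nat_rpow.2 hs)
    refine this.congr fun n => ?_
    push_cast
    rw [add_comm]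
  refine Summable.of_nat_of_neg ?_ ?_ <;> simpa using h

/-- Even `2π`-periodic functions with `S` bounded derivatives have cosine series that converge
absolutely even against the weight `(1 + |n|) ^ s`, `s < S - 1/2`: the coefficients of the
`S`-th derivative are square summable by Parseval's identity. -/
lemma cosine_expansion {ι : Type*} {S : ℕ} {s : ℝ} (hs0 : 0 ≤ s) (hs : s + 1 / 2 < S)
    {ψ : ι → ℝ → ℝ}
    (h : UniformCk univ S ψ) (hper : ∀ i, Function.Periodic (ψ i) (2 * π))
    (heven : ∀ i θ, ψ i (-θ) = ψ i θ) :
    ∃ C, ∀ i, ∃ c : ℤ → ℝ, Summable (fun n : ℤ => |c n| * (1 + |(n : ℝ)|) ^ s) ∧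
      ∑' n : ℤ, |c n| * (1 + |(n : ℝ)|) ^ s ≤ C ∧
      ∀ θ, HasSum (fun n : ℤ => c n * cos (n * θ)) (ψ i θ) := by
  have h0 : UniformCk univ 0 ψ := ⟨fun i => h.continuousOn i, h.bdd⟩
  obtain ⟨C0, hC0⟩ := summable_sq_circleCoeff h0 hper
  obtain ⟨C1, hC1⟩ := summable_sq_circleCoeff h hper
  have hsum : Summable (fun n : ℤ => (1 + |(n : ℝ)|) ^ (2 * s - 2 * S)) :=
    summable_one_add_abs_rpow (by linarith)
  have key : ∀ i, ∀ n : ℤ,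
      ‖circleCoeff (ψ i) n‖ * (1 + |(n : ℝ)|) ^ s ≤
      4 ^ S * ((|(n : ℝ)| ^ 0 * ‖circleCoeff (ψ i) n‖) ^ 2 +
        (|(n : ℝ)| ^ S * ‖circleCoeff (ψ i) n‖) ^ 2) + (1 + |(n : ℝ)|) ^ (2 * s - 2 * S) := by
    intro i n
    set a := ‖circleCoeff (ψ i) n‖
    have ha : 0 ≤ a := norm_nonneg _
    have hn0 : 0 ≤ |(n : ℝ)| := abs_nonneg _
    set m := 1 + |(n : ℝ)| with hm
    have hmpos : 0 < m := by linarith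
    have e1 : a * m ^ s = (a * m ^ S) * m ^ (s - S) := by
      rw [mul_assoc, ← rpow_natCast m S, ← rpow_add hmpos]
      congr 2
      ring
    have e2 : m ^ (2 * s - 2 * S) = (m ^ (s - S)) ^ 2 := by
      rw [← rpow_natCast (m ^ (s - S)) 2, ← rpow_mul hmpos.le]
      congr 1
      push_cast
      ring
    have e3 : (a * m ^ S) ^ 2 ≤ 4 ^ S * ((|(n : ℝ)| ^ 0 * a) ^ 2 + (|(n : ℝ)| ^ S * a) ^ 2) := by
      have e4 : (m ^ S) ^ 2 ≤ 4 ^ S * (1 + (|(n : ℝ)| ^ S) ^ 2) := by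
        rw [← pow_mul, ← pow_mul, mul_comm S 2, pow_mul, pow_mul]
        have e5 : m ^ 2 ≤ 4 * max 1 (|(n : ℝ)| ^ 2) := by
          rcases le_total 1 |(n : ℝ)| with h1 | h1
          · have := le_max_right 1 (|(n : ℝ)| ^ 2)
            nlinarith
          · have := le_max_left 1 (|(n : ℝ)| ^ 2)
            nlinarith
        calc (m ^ 2) ^ S ≤ (4 * max 1 (|(n : ℝ)| ^ 2)) ^ S := by gcongr
          _ = 4 ^ S * (max 1 (|(n : ℝ)| ^ 2)) ^ S := mul_pow _ _ _
          _ ≤ 4 ^ S * (1 + (|(n : ℝ)| ^ 2) ^ S) := by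
            gcongr
            rcases max_cases 1 (|(n : ℝ)| ^ 2) with ⟨h1, _⟩ | ⟨h1, _⟩ <;> rw [h1]
            · rw [one_pow]
              have : 0 ≤ (|(n : ℝ)| ^ 2) ^ S := by positivity
              linarith
            · linarith
      calc (a * m ^ S) ^ 2 = a ^ 2 * (m ^ S) ^ 2 := mul_pow _ _ _
        _ ≤ a ^ 2 * (4 ^ S * (1 + (|(n : ℝ)| ^ S) ^ 2)) := by gcongr
        _ = _ := by ring
    rw [e1, e2]
    nlinarith [sq_nonneg (a * m ^ S - m ^ (s - S)), sq_nonneg (a * m ^ S),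
      sq_nonneg (m ^ (s - S))]
  refine ⟨4 ^ S * (C0 + C1) + ∑' n : ℤ, (1 + |(n : ℝ)|) ^ (2 * s - 2 * S), fun i => ?_⟩
  have hmaj := (((hC0 i).1.add (hC1 i).1).mul_left (4 ^ S)).add hsum
  have hsw : Summable fun n : ℤ => ‖circleCoeff (ψ i) n‖ * (1 + |(n : ℝ)|) ^ s :=
    Summable.of_nonneg_of_le (fun n => by positivity) (key i) hmaj
  have hle : ∀ n : ℤ, |(circleCoeff (ψ i) n).re| * (1 + |(n : ℝ)|) ^ s ≤
      ‖circleCoeff (ψ i) n‖ * (1 + |(n : ℝ)|) ^ s := fun n => by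
    gcongr
    exact Complex.abs_re_le_norm _
  have hsre := Summable.of_nonneg_of_le (fun n => by positivity) hle hsw
  refine ⟨fun n => (circleCoeff (ψ i) n).re, hsre, ?_, fun θ => ?_⟩
  · refine (hsre.tsum_le_tsum hle hsw).trans ((hsw.tsum_le_tsum (key i) hmaj).trans ?_)
    rw [((((hC0 i).1.add (hC1 i).1).mul_left (4 ^ S))).tsum_add hsum, tsum_mul_left,
      (hC0 i).1.tsum_add (hC1 i).1]
    gcongr
    exacts [(hC0 i).2, (hC1 i).2]
  · have hpi : Fact (0 < 2 * π) := ⟨by positivity⟩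
    have hc : Continuous (ψ i) := by simpa [continuousOn_univ] using h.continuousOn i
    have hcont : Continuous (AddCircle.liftIco (2 * π) 0 (fun x => (ψ i x : ℂ))) := by
      refine AddCircle.liftIco_continuous ?_ (by fun_prop)
      rw [hper i 0]
    set f : C(AddCircle (2 * π), ℂ) := ⟨_, hcont⟩ with hf
    have hcoef : ∀ n, fourierCoeff f n = circleCoeff (ψ i) n := fun n =>
      fourierCoeff_liftIco_eq (T := 2 * π) (a := 0) _ n
    have hnorm : Summable (fourierCoeff f) := by
      refine Summable.of_norm (Summable.of_nonneg_of_le (fun n => norm_nonneg _) (fun n => ?_) hsw)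
      rw [hcoef]
      refine le_mul_of_one_le_right (norm_nonneg _) (one_le_rpow ?_ hs0)
      linarith [abs_nonneg (n : ℝ)]
    have hval : ∀ x : ℝ, f (x : AddCircle (2 * π)) = (ψ i x : ℂ) := by
      intro x
      obtain ⟨y, hy, hxy⟩ : ∃ y ∈ Ico (0 : ℝ) (0 + 2 * π), ∃ k : ℤ, y = x + k * (2 * π) := by
        refine ⟨toIcoMod hpi.out 0 x, toIcoMod_mem_Ico _ _ _, -toIcoDiv hpi.out 0 x, ?_⟩
        rw [toIcoMod]
        simp only [zsmul_eq_mul]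
        push_cast
        ring
      obtain ⟨k, rfl⟩ := hxy
      have e1 : (((x + k * (2 * π) : ℝ)) : AddCircle (2 * π)) = (x : AddCircle (2 * π)) := by
        rw [← zsmul_eq_mul, AddCircle.coe_add, AddCircle.coe_zsmul, AddCircle.coe_period,
          zsmul_zero,
          add_zero]
      rw [← e1]
      change AddCircle.liftIco (2 * π) 0 (fun x => (ψ i x : ℂ)) _ = _
      rw [AddCircle.liftIco_coe_apply hy, (hper i).int_mul k x]
    have hp := has_pointwise_sum_fourier_series_of_summable hnorm (θ : AddCircle (2 * π))
    have hm := has_pointwise_sum_fourier_series_of_summable hnorm ((-θ : ℝ) : AddCircle (2 * π))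
    rw [hval] at hp hm
    rw [heven] at hm
    have hre := Complex.hasSum_re ((hp.add hm).mul_left (1 / 2))
    have e2 : ((1 / 2 : ℂ) * ((ψ i θ : ℂ) + (ψ i θ : ℂ))).re = ψ i θ := by
      rw [show (1 / 2 : ℂ) * ((ψ i θ : ℂ) + (ψ i θ : ℂ)) = (ψ i θ : ℂ) by ring, Complex.ofReal_re]
    rw [e2] at hre
    convert hre using 1
    funext n
    have e3 : ∀ x : ℝ, 2 * (π : ℂ) * Complex.I * (n : ℂ) * (x : ℂ) / ((2 * π : ℝ) : ℂ) =
        ((n * x : ℝ) : ℂ) * Complex.I := fun x => by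
      have : (π : ℂ) ≠ 0 := by exact_mod_cast pi_ne_zero
      push_cast
      field_simp
    rw [fourier_coe_apply, fourier_coe_apply, e3, e3, hcoef, smul_eq_mul, smul_eq_mul]
    simp only [Complex.mul_re, Complex.add_re, Complex.exp_ofReal_mul_I_re,
      Complex.exp_ofReal_mul_I_im, Complex.add_im, mul_neg, cos_neg, sin_neg]
    norm_num
    ring

/-- `cos (k θ)` as a polynomial of degree `k` in `w = (1 + cos θ) / 2`, with an exponential bound
for its coefficients. -/
lemma exists_cos_nat_mul_eq_sum (k : ℕ) : ∃ d : ℕ → ℝ, (∀ i, k < i → d i = 0) ∧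
    ∑ i ∈ Finset.range (k + 1), |d i| ≤ 7 ^ k ∧
    ∀ θ, cos (k * θ) = ∑ i ∈ Finset.range (k + 1), d i * ((1 + cos θ) / 2) ^ i := by
  induction k using Nat.twoStepInduction with
  | zero =>
    refine ⟨fun i => if i = 0 then 1 else 0, fun i hi => if_neg (by omega), by simp, by simp⟩
  | one =>
    refine ⟨fun i => if i = 0 then -1 else if i = 1 then 2 else 0,
      fun i hi => by simp [show i ≠ 0 by omega, show i ≠ 1 by omega], ?_, fun θ => ?_⟩
    · norm_num [Finset.sum_range_succ]
    · simp [Finset.sum_range_succ]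
      ring
  | more k ih1 ih2 =>
    obtain ⟨d, hd0, hd1, hd2⟩ := ih1
    obtain ⟨e, he0, he1, he2⟩ := ih2
    -- the recursion `cos ((k + 2) θ) = 2 cos θ cos ((k + 1) θ) - cos (k θ)`, `2 cos θ = 4 w - 2`
    let f : ℕ → ℝ := fun i => (if i = 0 then 0 else 4 * e (i - 1)) - 2 * e i - d i
    have ext : ∀ {d : ℕ → ℝ} {k m : ℕ}, (∀ i, k < i → d i = 0) → k ≤ m → ∀ φ : ℕ → ℝ → ℝ,
        (∀ i, φ i 0 = 0) →
        ∑ i ∈ Finset.range (m + 1), φ i (d i) = ∑ i ∈ Finset.range (k + 1), φ i (d i) := by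
      intro d k m h0 hkm φ hφ
      symm
      refine Finset.sum_subset (Finset.range_mono (by omega)) fun i _ hi => ?_
      rw [h0 i (by simpa using hi), hφ]
    have hshift : ∀ φ : ℕ → ℝ → ℝ, (∀ i, φ i 0 = 0) →
        ∑ i ∈ Finset.range (k + 2 + 1), φ i (if i = 0 then 0 else 4 * e (i - 1)) =
        ∑ i ∈ Finset.range (k + 1 + 1), φ (i + 1) (4 * e i) := by
      intro φ hφ
      rw [Finset.sum_range_succ']
      simp [hφ]
    refine ⟨f, fun i hi => ?_, ?_, fun θ => ?_⟩
    · simp only [f]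
      rw [if_neg (by omega), he0 _ (by omega), he0 _ (by omega), hd0 _ (by omega)]
      ring
    · have hle : ∀ i, |f i| ≤ |if i = 0 then 0 else 4 * e (i - 1)| + 2 * |e i| + |d i| := by
        intro i
        refine (abs_sub _ _).trans (add_le_add ((abs_sub _ _).trans (add_le_add le_rfl ?_)) le_rfl)
        rw [abs_mul, abs_two]
      refine (Finset.sum_le_sum fun i _ => hle i).trans ?_
      rw [Finset.sum_add_distrib, Finset.sum_add_distrib, hshift (fun _ x => |x|) (by simp),
        ext (m := k + 2) he0 (by omega) (fun _ x => 2 * |x|) (by simp),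
        ext (m := k + 2) hd0 (by omega) (fun _ x => |x|) (by simp)]
      simp only [abs_mul, ← Finset.mul_sum]
      have h7 : (0 : ℝ) ≤ 7 ^ k := by positivity
      rw [pow_succ] at he1
      rw [pow_add, abs_of_pos (by norm_num : (0 : ℝ) < 4)]
      linarith
    · set w := (1 + cos θ) / 2 with hw
      have hcos : cos ((k + 2 : ℕ) * θ) = (4 * w - 2) * cos ((k + 1 : ℕ) * θ) - cos (k * θ) := by
        have h1 := cos_add ((k + 1 : ℕ) * θ) θ
        have h2 := cos_sub ((k + 1 : ℕ) * θ) θ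
        have e1 : ((k + 1 : ℕ) : ℝ) * θ + θ = (k + 2 : ℕ) * θ := by push_cast; ring
        have e2 : ((k + 1 : ℕ) : ℝ) * θ - θ = k * θ := by push_cast; ring
        rw [e1] at h1
        rw [e2] at h2
        rw [hw]
        linarith
      rw [hcos, he2, hd2]
      simp only [f, sub_mul, Finset.sum_sub_distrib]
      rw [hshift (fun i x => x * w ^ i) (by simp),
        ext (m := k + 2) he0 (by omega) (fun i x => 2 * x * w ^ i) (by simp),
        ext (m := k + 2) hd0 (by omega) (fun i x => x * w ^ i) (by simp)]
      rw [Finset.mul_sum, Finset.mul_sum]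
      congr 2
      · refine Finset.sum_congr rfl fun i _ => ?_
        ring
      · refine Finset.sum_congr rfl fun i _ => ?_
        ring

end Cosine

/-! ### Spectral multipliers as cosine series -/

section Multipliers

open Real

variable {ι : Type*}

lemma uniformCk_cos_sin (S : ℕ) : UniformCk univ S (fun _ : ι => cos) ∧
    UniformCk univ S (fun _ : ι => sin) := by
  induction S with
  | zero =>
    exact ⟨⟨fun _ => continuous_cos.continuousOn, 1, fun _ x _ => abs_cos_le_one x⟩,
      ⟨fun _ => continuous_sin.continuousOn, 1, fun _ x _ => abs_sin_le_one x⟩⟩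
  | succ S ih =>
    refine ⟨⟨fun _ => differentiable_cos.differentiableOn, ⟨1, fun _ x _ => abs_cos_le_one x⟩, ?_⟩,
      ⟨fun _ => differentiable_sin.differentiableOn, ⟨1, fun _ x _ => abs_sin_le_one x⟩, ?_⟩⟩
    · refine (ih.2.const_mul isOpen_univ (-1)).congr isOpen_univ fun i x _ => ?_
      simp
    · refine ih.1.congr isOpen_univ fun i x _ => ?_
      simp

/-- `exp (a s) (ε + exp s) ^ γ` is smooth on bounded intervals, uniformly in `ε ∈ [0, 1]`. -/
lemma uniformCk_exp_mul_rpow (S : ℕ) (a γ R : ℝ) {ε : ι → ℝ} (h0 : ∀ i, 0 ≤ ε i)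
    (h1 : ∀ i, ε i ≤ 1) :
    UniformCk (Ioo (-R) R) S (fun i s => exp (a * s) * (ε i + exp s) ^ γ) := by
  have hpos : ∀ i s, 0 < ε i + exp s := fun i s => add_pos_of_nonneg_of_pos (h0 i) (exp_pos s)
  have hd : ∀ (a γ : ℝ) i s, HasDerivAt (fun s => exp (a * s) * (ε i + exp s) ^ γ)
      (a * (exp (a * s) * (ε i + exp s) ^ γ) +
        γ * (exp ((a + 1) * s) * (ε i + exp s) ^ (γ - 1))) s := by
    intro a γ i s
    have e1 : HasDerivAt (fun s => exp (a * s)) (exp (a * s) * a) s := by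
      simpa using ((hasDerivAt_id s).const_mul a).exp
    have e2 : HasDerivAt (fun s => (ε i + exp s) ^ γ)
        (exp s * γ * (ε i + exp s) ^ (γ - 1)) s :=
      ((hasDerivAt_exp s).const_add (ε i)).rpow_const (Or.inl (hpos i s).ne')
    convert! e1.mul e2 using 1
    rw [add_mul a 1 s, one_mul, exp_add]
    ring
  have hb : ∀ a γ : ℝ, ∃ C, ∀ i, ∀ s ∈ Ioo (-R) R, |exp (a * s) * (ε i + exp s) ^ γ| ≤ C := by
    intro a γ
    have hcont : ContinuousOn (fun z : ℝ × ℝ => exp (a * z.2) * (z.1 + exp z.2) ^ γ)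
        (Icc 0 1 ×ˢ Icc (-R) R) := by
      intro z hz
      refine ContinuousAt.continuousWithinAt ?_
      refine ContinuousAt.mul (by fun_prop) (ContinuousAt.rpow_const (by fun_prop) (Or.inl ?_))
      exact (add_pos_of_nonneg_of_pos hz.1.1 (exp_pos _)).ne'
    obtain ⟨C, hC⟩ := (isCompact_Icc.prod isCompact_Icc).exists_bound_of_continuousOn hcont
    exact ⟨C, fun i s hs => hC (ε i, s) ⟨⟨h0 i, h1 i⟩, hs.1.le, hs.2.le⟩⟩
  induction S generalizing a γ with
  | zero => exact ⟨fun i s _ => (hd a γ i s).continuousAt.continuousWithinAt, hb a γ⟩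
  | succ S ih =>
    refine ⟨fun i s _ => (hd a γ i s).differentiableAt.differentiableWithinAt, hb a γ, ?_⟩
    refine (((ih a γ).const_mul isOpen_Ioo a).add isOpen_Ioo
      ((ih (a + 1) (γ - 1)).const_mul isOpen_Ioo γ)).congr isOpen_Ioo fun i s _ => ?_
    exact (hd a γ i s).deriv.symm

/-- The Gaussian `exp (-ℓ²) ℓ ^ (2 k)` in the logarithmic variable `σ = log ℓ`. -/
noncomputable def logGaussian (k : ℕ) (σ : ℝ) : ℝ := exp (2 * k * σ) * exp (-exp (2 * σ))

lemma hasDerivAt_logGaussian (k : ℕ) (σ : ℝ) :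
    HasDerivAt (logGaussian k) (2 * k * logGaussian k σ + (-2) * logGaussian (k + 1) σ) σ := by
  have e1 : HasDerivAt (fun σ => exp (2 * k * σ)) (exp (2 * k * σ) * (2 * k)) σ := by
    simpa using ((hasDerivAt_id σ).const_mul (2 * k : ℝ)).exp
  have e2 : HasDerivAt (fun σ => exp (-exp (2 * σ)))
      (exp (-exp (2 * σ)) * (-(exp (2 * σ) * 2))) σ := by
    simpa using (((hasDerivAt_id σ).const_mul (2 : ℝ)).exp.neg).exp
  convert! e1.mul e2 using 1
  simp only [logGaussian]
  push_cast
  rw [mul_add 2 (k : ℝ) 1, add_mul, exp_add, mul_one]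
  ring

lemma uniformCk_logGaussian (S k : ℕ) : UniformCk univ S (fun _ : ι => logGaussian k) := by
  have hb : ∀ k, ∃ C, ∀ _ : ι, ∀ σ ∈ (univ : Set ℝ), |logGaussian k σ| ≤ C := by
    intro k
    refine ⟨k.factorial, fun _ σ _ => ?_⟩
    have e : exp (2 * k * σ) = exp (2 * σ) ^ k := by
      rw [← exp_nat_mul]
      congr 1
      ring
    have h := pow_div_factorial_le_exp (exp (2 * σ)) (exp_pos _).le k
    have hk : (0 : ℝ) < k.factorial := by positivity
    rw [div_le_iff₀ hk] at h
    rw [logGaussian, abs_of_pos (by positivity), e, exp_neg, ← div_eq_mul_inv,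
      div_le_iff₀ (exp_pos _), mul_comm (k.factorial : ℝ)]
    exact h
  induction S generalizing k with
  | zero =>
    exact ⟨fun _ σ _ => (hasDerivAt_logGaussian k σ).continuousAt.continuousWithinAt, hb k⟩
  | succ S ih =>
    refine ⟨fun _ σ _ => (hasDerivAt_logGaussian k σ).differentiableAt.differentiableWithinAt,
      hb k, ?_⟩
    refine (((ih k).const_mul isOpen_univ (2 * k)).add isOpen_univ
      ((ih (k + 1)).const_mul isOpen_univ (-2))).congr isOpen_univ fun _ σ _ => ?_
    exact (hasDerivAt_logGaussian k σ).deriv.symm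

/-- A smooth cut-off `Y (ℓ² / N²)` times a mask `(1 + ℓ) ^ γ F (log ℓ)` is, up to the factor
`N ^ γ`, a cosine series in the angle `θ` given by `exp (-ℓ² / N²) = (1 + cos θ) / 2`, with
coefficients bounded uniformly in `N` and `F`. -/
lemma multiplier_expansion {S : ℕ} {s : ℝ} (hs0 : 0 ≤ s) (hs : s + 1 / 2 < S) {Y : ℝ → ℝ}
    (hY : ContDiff ℝ ∞ Y) (hY0 : ∀ u ∉ Icc (1 / 4 : ℝ) 2, Y u = 0) {F : ι → ℝ → ℝ}
    (hF : UniformCk univ S F) (γ : ℝ) :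
    ∃ C, ∀ i, ∀ N : ℝ, 1 ≤ N → ∃ c : ℤ → ℝ,
      Summable (fun n : ℤ => |c n| * (1 + |(n : ℝ)|) ^ s) ∧
      ∑' n : ℤ, |c n| * (1 + |(n : ℝ)|) ^ s ≤ C ∧
      ∀ l θ : ℝ, 0 ≤ l → (1 + cos θ) / 2 = exp (-(l ^ 2 / N ^ 2)) →
        HasSum (fun n : ℤ => c n * (exp (-(l ^ 2 / N ^ 2)) * cos (n * θ)))
          (N ^ (-γ) * (Y (l ^ 2 / N ^ 2) * (1 + l) ^ γ * F i (log l))) := by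
  set U : Set ℝ := Ioo (exp (-3)) (exp (-(1 / 8))) with hU
  set K : Set ℝ := Icc (exp (-2)) (exp (-(1 / 4))) with hK
  have hKU : K ⊆ U := fun w hw =>
    ⟨(exp_lt_exp.2 (by norm_num)).trans_le hw.1, hw.2.trans_lt (exp_lt_exp.2 (by norm_num))⟩
  have hUV : ∀ w, w ∈ Icc (exp (-3)) (exp (-(1 / 8))) → w ∈ Ioo (0 : ℝ) 1 := fun w hw =>
    ⟨(exp_pos _).trans_le hw.1, hw.2.trans_lt (by rw [exp_lt_one_iff]; norm_num)⟩
  have hlog : ContDiffOn ℝ ∞ log (Ioo 0 1) := fun w hw =>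
    (contDiffAt_log.2 hw.1.ne').contDiffWithinAt
  have h1 : ContDiffOn ℝ ∞ (fun w => Y (-log w) * w⁻¹) (Ioo 0 1) :=
    (hY.comp_contDiffOn hlog.neg).mul (contDiffOn_id.inv fun w hw => hw.1.ne')
  have h2 : ContDiffOn ℝ ∞ (fun w => 1 / 2 * log (-log w)) (Ioo 0 1) :=
    contDiffOn_const.mul (hlog.neg.log fun w hw => (neg_pos.2 (log_neg hw.1 hw.2)).ne')
  let J := ι × {N : ℝ // 1 ≤ N}
  have u1 : UniformCk U S (fun _ : J => fun w => Y (-log w) * w⁻¹) :=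
    .of_contDiffOn isOpen_Ioo h1 isCompact_Icc Ioo_subset_Icc_self hUV
  have u2 : UniformCk U S (fun _ : J => fun w => 1 / 2 * log (-log w)) :=
    .of_contDiffOn isOpen_Ioo h2 isCompact_Icc Ioo_subset_Icc_self hUV
  have u3 : UniformCk (Ioo (-2) 2) S
      (fun (j : J) s => exp (0 * s) * ((j.2 : ℝ)⁻¹ + exp s) ^ γ) :=
    uniformCk_exp_mul_rpow S 0 γ 2 (fun j => inv_nonneg.2 (zero_le_one.trans j.2.2))
      (fun j => inv_le_one_of_one_le₀ j.2.2)
  have u4 : UniformCk (Ioo (-2) 2) S (fun (j : J) s => F j.1 (log j.2 + s)) :=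
    (hF.shift (fun N : {N : ℝ // 1 ≤ N} => log N)).mono (subset_univ _)
  have hmaps : ∀ _ : J, MapsTo (fun w => 1 / 2 * log (-log w)) U (Ioo (-2) 2) := by
    intro _ w hw
    have hw0 : 0 < w := (exp_pos _).trans hw.1
    have a1 : -log w < 3 := by
      have := (lt_log_iff_exp_lt hw0).2 hw.1
      linarith
    have a2 : 1 / 8 < -log w := by
      have := (log_lt_iff_lt_exp hw0).2 hw.2
      linarith
    have a3 : log (-log w) < 4 := by
      have := log_le_sub_one_of_pos (x := -log w) (by linarith)
      linarith
    have a4 : -4 < log (-log w) := by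
      rw [lt_log_iff_exp_lt (by linarith)]
      refine lt_trans ?_ a2
      have e1 : exp (-4 : ℝ) = (exp 4)⁻¹ := exp_neg 4
      have e2 : (8 : ℝ) < exp 4 := by
        have := quadratic_le_exp_of_nonneg (x := (4 : ℝ)) (by norm_num)
        norm_num at this
        linarith
      rw [e1, one_div]
      exact inv_strictAnti₀ (by norm_num) e2
    constructor <;> simp only <;> linarith
  have u5 := (u1.mul isOpen_Ioo ((u3.mul isOpen_Ioo u4).comp isOpen_Ioo isOpen_Ioo u2 hmaps))
  let G : J → ℝ → ℝ := fun j w => if 0 < w then Y (-log w) * w⁻¹ *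
    ((exp (0 * (1 / 2 * log (-log w))) * ((j.2 : ℝ)⁻¹ + exp (1 / 2 * log (-log w))) ^ γ) *
      F j.1 (log j.2 + 1 / 2 * log (-log w))) else 0
  have u6 : UniformCk U S G := u5.congr isOpen_Ioo fun j w hw => by
    simp only [G]
    rw [if_pos ((exp_pos _).trans hw.1)]
  have u7 : UniformCk univ S G := by
    refine u6.of_support isOpen_Ioo isClosed_Icc hKU fun j w hw => ?_
    simp only [G]
    split_ifs with hw0
    · rw [hY0, zero_mul, zero_mul]
      contrapose! hw
      constructor
      · rw [← le_log_iff_exp_le hw0]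
        linarith [hw.2]
      · rw [← log_le_iff_le_exp hw0]
        linarith [hw.1]
    · rfl
  have hw : UniformCk univ S (fun (_ : J) θ => 1 / 2 * (1 + cos θ)) :=
    (((UniformCk.const (fun _ => (1 : ℝ)) (fun _ => le_rfl)).add isOpen_univ
      (uniformCk_cos_sin S).1).const_mul isOpen_univ _)
  have u8 := u7.comp isOpen_univ isOpen_univ hw (fun _ => mapsTo_univ _ _)
  obtain ⟨C, hC⟩ := cosine_expansion hs0 hs u8 (fun j θ => by simp) (fun j θ => by simp)
  refine ⟨C, fun i N hN => ?_⟩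
  obtain ⟨c, hc1, hc2, hc3⟩ := hC (i, ⟨N, hN⟩)
  refine ⟨c, hc1, hc2, fun l θ hl hθ => ?_⟩
  have hN0 : 0 < N := by linarith
  have h := (hc3 θ).mul_left (exp (-(l ^ 2 / N ^ 2)))
  convert! h using 1
  · funext n
    ring
  · have e : 1 / 2 * (1 + cos θ) = exp (-(l ^ 2 / N ^ 2)) := by rw [← hθ]; ring
    simp only [G]
    rw [e, if_pos (exp_pos _), log_exp, neg_neg, zero_mul, exp_zero]
    rcases hl.eq_or_lt with rfl | hl
    · simp [hY0 0 (by norm_num)]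
    · have e1 : 1 / 2 * log (l ^ 2 / N ^ 2) = log (l / N) := by
        rw [← div_pow, log_pow]
        push_cast
        ring
      rw [e1, exp_log (by positivity), log_div hl.ne' hN0.ne',
        show log N + (log l - log N) = log l by ring]
      have e2 : N ^ (-γ) * (1 + l) ^ γ = (N⁻¹ + l / N) ^ γ := by
        rw [rpow_neg hN0.le, ← inv_rpow hN0.le, ← mul_rpow (by positivity) (by positivity)]
        congr 1
        field_simp
      rw [← e2]
      have := (exp_pos (-(l ^ 2 / N ^ 2))).ne'
      field_simp

end Multipliers

/-! ### Kernels of rapidly decreasing multipliers -/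

/-- The hypotheses on `(M, μ, φ, ℓ)` from which the upper bounds for kernels follow: Gaussian
bounds of the heat kernel, its conservativeness and the volume growth. -/
structure IsHeatSystem {M : Type*} [MetricSpace M] [MeasurableSpace M] (μ : Measure M)
    (φ : ℕ → M → ℝ) (ℓ : ℕ → ℝ) (α : ℝ) : Prop where
  sys : IsOrthonormalSystem μ φ ℓ
  pos : 0 < α
  ball : BallMeasureBound μ α
  gauss : HeatKernelGaussianBound φ ℓ α
  int : HeatKernelIntegral μ φ ℓ

/-- The supremum norm of a function. -/
noncomputable def supNorm {M : Type*} (f : M → ℝ) : ℝ := ⨆ x, |f x|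

/-- The kernel `∑_j m_j φ_j(x) φ_j(y)` of the spectral multiplier `m`. -/
noncomputable def ker {M : Type*} (φ : ℕ → M → ℝ) (m : ℕ → ℝ) (x y : M) : ℝ :=
  ∑' j, m j * φ j x * φ j y

/-- Multipliers decreasing so fast that their kernel series converges absolutely and uniformly. -/
def Adm {M : Type*} (φ : ℕ → M → ℝ) (m : ℕ → ℝ) : Prop :=
  Summable fun j => |m j| * supNorm (φ j) ^ 2

/-- The multiplier `exp (-ℓ_j² t)` of the heat kernel. -/
noncomputable def heatMul (ℓ : ℕ → ℝ) (t : ℝ) (j : ℕ) : ℝ := Real.exp (-(ℓ j) ^ 2 * t)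

section

variable {M : Type*} {φ : ℕ → M → ℝ} {ℓ : ℕ → ℝ}

lemma heatKernel_eq_ker (t : ℝ) : heatKernel φ ℓ t = ker φ (heatMul ℓ t) := rfl

lemma supNorm_nonneg (f : M → ℝ) : 0 ≤ supNorm f := Real.iSup_nonneg fun _ => abs_nonneg _

lemma abs_le_supNorm [TopologicalSpace M] [CompactSpace M] {f : M → ℝ} (hf : Continuous f)
    (x : M) : |f x| ≤ supNorm f :=
  le_ciSup (f := fun x => |f x|) (isCompact_range hf.abs).bddAbove x

lemma adm_mul_of_bdd {m m' : ℕ → ℝ} (hm : Adm φ m) {C : ℝ} (hC : ∀ j, |m' j| ≤ C) :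
    Adm φ (fun j => m j * m' j) := by
  refine Summable.of_nonneg_of_le (fun j => by positivity) (fun j => ?_) (hm.mul_left C)
  have h1 := hC j
  have h2 : 0 ≤ |m j| * supNorm (φ j) ^ 2 := by positivity
  rw [abs_mul]
  calc |m j| * |m' j| * supNorm (φ j) ^ 2 = |m' j| * (|m j| * supNorm (φ j) ^ 2) := by ring
    _ ≤ C * (|m j| * supNorm (φ j) ^ 2) := by gcongr

lemma ker_symm (m : ℕ → ℝ) (x y : M) : ker φ m x y = ker φ m y x := by
  simp only [ker, mul_assoc]
  refine tsum_congr fun j => ?_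
  ring

lemma ell_nonneg [MetricSpace M] [MeasurableSpace M] {μ : Measure M} {α : ℝ}
    (h : IsHeatSystem μ φ ℓ α) (j : ℕ) : 0 ≤ ℓ j := by
  rw [← h.sys.ell_zero]
  exact h.sys.ell_mono (Nat.zero_le j)

lemma finite_ell_le [MetricSpace M] [MeasurableSpace M] {μ : Measure M} {α : ℝ}
    (h : IsHeatSystem μ φ ℓ α) (L : ℝ) : {j | ℓ j ≤ L}.Finite := by
  obtain ⟨n, hn⟩ := (h.sys.ell_tendsto.eventually (eventually_gt_atTop L)).exists_forall_of_atTop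
  refine (finite_lt_nat n).subset fun j hj => ?_
  by_contra hcon
  exact absurd (hn j (not_lt.1 hcon)) (not_lt.2 hj)

end

section Kernels

variable {M : Type*} [MetricSpace M] [CompactSpace M] [MeasurableSpace M] [BorelSpace M]
  {μ : Measure M} [IsProbabilityMeasure μ] {φ : ℕ → M → ℝ} {ℓ : ℕ → ℝ} {α : ℝ}

lemma integrable_of_continuous {f : M → ℝ} (hf : Continuous f) : Integrable f μ :=
  hf.integrable_of_hasCompactSupport (HasCompactSupport.of_compactSpace f)

lemma adm_of_eventually_zero (h : IsHeatSystem μ φ ℓ α) {m : ℕ → ℝ} {L : ℝ}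
    (hm : ∀ j, L < ℓ j → m j = 0) : Adm φ m := by
  refine summable_of_hasFiniteSupport ?_
  refine (finite_ell_le h L).subset fun j hj => ?_
  by_contra hcon
  exact hj (by simp [hm j (not_le.1 hcon)])

/-- The uniform bound `φ_j(x)² ≤ exp (ℓ_j² s) K_s(x, x)` together with the integral of the heat
kernel over the diagonal. -/
lemma adm_heatMul (h : IsHeatSystem μ φ ℓ α) {t : ℝ} (ht : 0 < t) : Adm φ (heatMul ℓ t) := by
  obtain ⟨c₁, c, hc₁, hc, hK⟩ := h.gauss
  set s : ℝ := min (t / 2) 1 with hs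
  have hs0 : 0 < s := by positivity
  have hs1 : s ∈ Ioc (0 : ℝ) 1 := ⟨hs0, min_le_right _ _⟩
  have hst : 2 * s ≤ t := by linarith [min_le_left (t / 2) 1]
  set B : ℝ := c₁ * s ^ (-α / 2) with hB
  have hB0 : 0 < B := by positivity
  have hdiag : ∀ x, HasSum (fun j => heatMul ℓ s j * φ j x * φ j x) (heatKernel φ ℓ s x x) :=
    fun x => (hK s hs1 x x).1.hasSum
  have hnn : ∀ x j, 0 ≤ heatMul ℓ s j * φ j x * φ j x := fun x j => by
    rw [mul_assoc]
    exact mul_nonneg (Real.exp_pos _).le (mul_self_nonneg _)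
  have hle : ∀ x, heatKernel φ ℓ s x x ≤ B := fun x => by
    have := (le_abs_self _).trans (hK s hs1 x x).2
    simpa [hB] using this
  -- summability of `exp (-ℓ_j² s)`: integrate the partial sums of `K_s(x, x)`
  have hsum : Summable (heatMul ℓ s) := by
    refine summable_of_sum_range_le (c := B) (fun j => (Real.exp_pos _).le) fun n => ?_
    have hint : ∫ x, ∑ j ∈ Finset.range n, heatMul ℓ s j * φ j x * φ j x ∂μ =
        ∑ j ∈ Finset.range n, heatMul ℓ s j := by
      rw [integral_finsetSum]
      · refine Finset.sum_congr rfl fun j _ => ?_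
        simp_rw [mul_assoc]
        rw [integral_const_mul, h.sys.orthonormal j j, if_pos rfl, mul_one]
      · intro j _
        have := h.sys.continuous j
        exact integrable_of_continuous (by fun_prop)
    rw [← hint]
    calc ∫ x, ∑ j ∈ Finset.range n, heatMul ℓ s j * φ j x * φ j x ∂μ ≤ ∫ _, B ∂μ := by
          refine integral_mono (integrable_of_continuous ?_) (integrable_const _) fun x => ?_
          · have := h.sys.continuous
            fun_prop
          · exact (sum_le_hasSum _ (fun j _ => hnn x j) (hdiag x)).trans (hle x)
      _ = B := by simp
  have hsup : ∀ j, supNorm (φ j) ^ 2 ≤ B * Real.exp (ℓ j ^ 2 * s) := by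
    intro j
    have h1 : supNorm (φ j) ≤ Real.sqrt (B * Real.exp (ℓ j ^ 2 * s)) := by
      refine Real.iSup_le (fun x => Real.abs_le_sqrt ?_) (Real.sqrt_nonneg _)
      have h2 := (le_hasSum (hdiag x) j fun i _ => hnn x i).trans (hle x)
      have h3 : φ j x ^ 2 = Real.exp (ℓ j ^ 2 * s) * (heatMul ℓ s j * φ j x * φ j x) := by
        rw [heatMul, mul_assoc, ← mul_assoc, ← Real.exp_add]
        simp [sq]
      rw [h3, mul_comm B]
      gcongr
    calc supNorm (φ j) ^ 2 ≤ Real.sqrt (B * Real.exp (ℓ j ^ 2 * s)) ^ 2 := by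
          gcongr
          exact supNorm_nonneg _
      _ = _ := Real.sq_sqrt (by positivity)
  refine Summable.of_nonneg_of_le (fun j => by positivity) (fun j => ?_) (hsum.mul_left B)
  calc |heatMul ℓ t j| * supNorm (φ j) ^ 2
      ≤ heatMul ℓ t j * (B * Real.exp (ℓ j ^ 2 * s)) := by
        rw [heatMul, abs_of_pos (Real.exp_pos _)]
        gcongr
        exact hsup j
    _ = B * Real.exp (-(ℓ j) ^ 2 * t + ℓ j ^ 2 * s) := by rw [heatMul, Real.exp_add]; ring
    _ ≤ B * heatMul ℓ s j := by
        rw [heatMul]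
        gcongr
        nlinarith [sq_nonneg (ℓ j)]

lemma norm_ker_term_le (h : IsHeatSystem μ φ ℓ α) (m : ℕ → ℝ) (x y : M) (j : ℕ) :
    ‖m j * φ j x * φ j y‖ ≤ |m j| * supNorm (φ j) ^ 2 := by
  rw [Real.norm_eq_abs, abs_mul, abs_mul, sq, mul_assoc]
  have h1 := abs_le_supNorm (h.sys.continuous j) x
  have h2 := abs_le_supNorm (h.sys.continuous j) y
  have h3 := supNorm_nonneg (φ j)
  gcongr

lemma hasSum_ker (h : IsHeatSystem μ φ ℓ α) {m : ℕ → ℝ} (hm : Adm φ m) (x y : M) :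
    HasSum (fun j => m j * φ j x * φ j y) (ker φ m x y) :=
  (Summable.of_norm_bounded hm (norm_ker_term_le h m x y)).hasSum

lemma continuous_ker (h : IsHeatSystem μ φ ℓ α) {m : ℕ → ℝ} (hm : Adm φ m) :
    Continuous fun z : M × M => ker φ m z.1 z.2 := by
  refine continuous_tsum (fun j => ?_) hm fun j z => norm_ker_term_le h m z.1 z.2 j
  have := h.sys.continuous j
  fun_prop

lemma hasSum_integral_ker_mul (h : IsHeatSystem μ φ ℓ α) {m : ℕ → ℝ} (hm : Adm φ m)
    {f : M → ℝ} (hf : Integrable f μ) (x : M) :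
    HasSum (fun j => m j * φ j x * ∫ y, f y * φ j y ∂μ) (∫ y, ker φ m x y * f y ∂μ) := by
  have hint : ∀ j, Integrable (fun y => m j * φ j x * φ j y * f y) μ := fun j => by
    refine hf.bdd_mul (c := |m j| * supNorm (φ j) ^ 2) ?_ ?_
    · have := h.sys.continuous j
      exact Continuous.aestronglyMeasurable (by fun_prop)
    · exact Eventually.of_forall fun y => norm_ker_term_le h m x y j
  have hs : Summable fun j => ∫ y, ‖m j * φ j x * φ j y * f y‖ ∂μ := by
    refine Summable.of_nonneg_of_le (fun j => integral_nonneg fun _ => norm_nonneg _) (fun j => ?_)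
      (hm.mul_right (∫ y, ‖f y‖ ∂μ))
    rw [← integral_const_mul]
    refine integral_mono (hint j).norm (hf.norm.const_mul _) fun y => ?_
    simp only [norm_mul _ (f y)]
    gcongr
    exact norm_ker_term_le h m x y j
  have := hasSum_integral_of_summable_integral_norm hint hs
  convert! this using 1
  · funext j
    rw [← integral_const_mul]
    congr 1
    funext y
    ring
  · congr 1
    funext y
    rw [ker, tsum_mul_right]

lemma integral_ker_mul_phi (h : IsHeatSystem μ φ ℓ α) {m : ℕ → ℝ} (hm : Adm φ m) (x : M) (k : ℕ) :
    ∫ y, ker φ m x y * φ k y ∂μ = m k * φ k x := by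
  have h1 := hasSum_integral_ker_mul h hm (integrable_of_continuous (h.sys.continuous k)) x
  refine h1.unique ?_
  have h2 := hasSum_ite_eq k (m k * φ k x)
  convert! h2 using 1
  funext j
  rw [h.sys.orthonormal k j]
  by_cases hjk : j = k
  · simp [hjk]
  · simp [hjk, Ne.symm hjk]

lemma integral_ker_mul_ker (h : IsHeatSystem μ φ ℓ α) {m m' : ℕ → ℝ} (hm : Adm φ m)
    (hm' : Adm φ m') (x y : M) :
    ∫ z, ker φ m x z * ker φ m' z y ∂μ = ker φ (fun j => m j * m' j) x y := by
  have hc : Continuous fun z => ker φ m' z y :=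
    (continuous_ker h hm').comp (by fun_prop : Continuous fun z : M => (z, y))
  have h1 := hasSum_integral_ker_mul h hm (integrable_of_continuous hc) x
  refine h1.tsum_eq.symm.trans (tsum_congr fun j => ?_)
  have : ∫ z, ker φ m' z y * φ j z ∂μ = m' j * φ j y := by
    simp_rw [ker_symm m' _ y]
    exact integral_ker_mul_phi h hm' y j
  rw [this]
  ring

lemma continuous_ker_right (h : IsHeatSystem μ φ ℓ α) {m : ℕ → ℝ} (hm : Adm φ m) (x : M) :
    Continuous (ker φ m x) :=
  (continuous_ker h hm).comp (by fun_prop : Continuous fun z : M => (x, z))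

lemma continuous_ker_left (h : IsHeatSystem μ φ ℓ α) {m : ℕ → ℝ} (hm : Adm φ m) (y : M) :
    Continuous fun x => ker φ m x y :=
  (continuous_ker h hm).comp (by fun_prop : Continuous fun z : M => (z, y))

end Kernels

/-! ### The multiplier theorem -/

lemma summable_exp_neg_sq_mul_rpow {c : ℝ} (hc : 0 < c) (α : ℝ) :
    Summable fun m : ℕ => Real.exp (-c * (m : ℝ) ^ 2) * ((m : ℝ) + 1) ^ α := by
  obtain ⟨k, hk⟩ := exists_nat_ge α
  have h1 := ((summable_nat_add_iff 1).2 (Real.summable_pow_mul_exp_neg_nat_mul k hc)).mul_left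
    (Real.exp c)
  refine Summable.of_nonneg_of_le (fun m => by positivity) (fun m => ?_) h1
  have h2 : ((m : ℝ) + 1) ^ α ≤ ((m : ℝ) + 1) ^ k := by
    rw [← Real.rpow_natCast]
    exact Real.rpow_le_rpow_of_exponent_le (by linarith [(Nat.cast_nonneg m : (0 : ℝ) ≤ m)]) hk
  have h3 : Real.exp (-c * (m : ℝ) ^ 2) ≤ Real.exp c * Real.exp (-c * ((m + 1 : ℕ) : ℝ)) := by
    rw [← Real.exp_add]
    refine Real.exp_le_exp.2 ?_
    have : (m : ℝ) ≤ (m : ℝ) ^ 2 := by exact_mod_cast Nat.le_self_pow (by norm_num) m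
    push_cast
    nlinarith
  calc Real.exp (-c * (m : ℝ) ^ 2) * ((m : ℝ) + 1) ^ α
      ≤ (Real.exp c * Real.exp (-c * ((m + 1 : ℕ) : ℝ))) * ((m : ℝ) + 1) ^ k := by gcongr
    _ = _ := by push_cast; ring

section Kernels

variable {M : Type*} [MetricSpace M] [CompactSpace M] [MeasurableSpace M] [BorelSpace M]
  {μ : Measure M} [IsProbabilityMeasure μ] {φ : ℕ → M → ℝ} {ℓ : ℕ → ℝ} {α : ℝ}

/-- Gaussians of width `√t` have mass at most a multiple of `t ^ (α / 2)`: sum over the annuli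
`m √t ≤ ρ(x, y) ≤ (m + 1) √t`. -/
lemma lintegral_gaussian_le (hball : BallMeasureBound μ α) {c : ℝ} (hc : 0 < c) :
    ∃ C : ℝ, 0 < C ∧ ∀ t : ℝ, 0 < t → ∀ x,
      ∫⁻ y, ENNReal.ofReal (Real.exp (-c * dist x y ^ 2 / t)) ∂μ ≤
        ENNReal.ofReal (C * t ^ (α / 2)) := by
  obtain ⟨K, hK, hb⟩ := hball
  have hs := summable_exp_neg_sq_mul_rpow hc α
  refine ⟨K * ∑' m : ℕ, Real.exp (-c * (m : ℝ) ^ 2) * ((m : ℝ) + 1) ^ α, ?_, fun t ht x => ?_⟩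
  · exact mul_pos hK (hs.tsum_pos (fun m => by positivity) 0 (by positivity))
  have hst : 0 < Real.sqrt t := Real.sqrt_pos.2 ht
  have hst2 : Real.sqrt t ^ 2 = t := Real.sq_sqrt ht.le
  have hsa : Real.sqrt t ^ α = t ^ (α / 2) := by
    rw [Real.sqrt_eq_rpow, ← Real.rpow_mul ht.le]
    congr 1
    ring
  calc ∫⁻ y, ENNReal.ofReal (Real.exp (-c * dist x y ^ 2 / t)) ∂μ
      ≤ ∫⁻ y, ∑' m : ℕ, ENNReal.ofReal (Real.exp (-c * (m : ℝ) ^ 2)) *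
          (Metric.closedBall x (((m : ℝ) + 1) * Real.sqrt t)).indicator 1 y ∂μ := by
        refine lintegral_mono fun y => ?_
        set m := ⌊dist x y / Real.sqrt t⌋₊ with hm
        have h1 : (m : ℝ) * Real.sqrt t ≤ dist x y := by
          rw [← le_div_iff₀ hst]
          exact Nat.floor_le (by positivity)
        have h2 : dist x y ≤ ((m : ℝ) + 1) * Real.sqrt t := by
          rw [← div_le_iff₀ hst]
          exact (Nat.lt_floor_add_one _).le
        refine le_trans ?_ (ENNReal.le_tsum m)
        rw [indicator_of_mem (by rwa [Metric.mem_closedBall, dist_comm]), Pi.one_apply, mul_one]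
        refine ENNReal.ofReal_le_ofReal (Real.exp_le_exp.2 ?_)
        rw [div_le_iff₀ ht]
        have h3 : ((m : ℝ) * Real.sqrt t) ^ 2 ≤ dist x y ^ 2 := by gcongr
        rw [mul_pow, hst2] at h3
        nlinarith
    _ = ∑' m : ℕ, ENNReal.ofReal (Real.exp (-c * (m : ℝ) ^ 2)) *
          μ (Metric.closedBall x (((m : ℝ) + 1) * Real.sqrt t)) := by
        rw [lintegral_tsum]
        · refine tsum_congr fun m => ?_
          rw [lintegral_const_mul _ (measurable_one.indicator measurableSet_closedBall),
            lintegral_indicator_one measurableSet_closedBall]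
        · exact fun m =>
            ((measurable_one.indicator measurableSet_closedBall).const_mul _).aemeasurable
    _ ≤ ∑' m : ℕ, ENNReal.ofReal (K * t ^ (α / 2) *
          (Real.exp (-c * (m : ℝ) ^ 2) * ((m : ℝ) + 1) ^ α)) := by
        refine ENNReal.tsum_le_tsum fun m => ?_
        refine (mul_le_mul_right (hb x _ (by positivity)) _).trans ?_
        rw [← ENNReal.ofReal_mul (Real.exp_pos _).le, Real.mul_rpow (by positivity) hst.le, hsa]
        refine ENNReal.ofReal_le_ofReal (le_of_eq ?_)
        ring
    _ = ENNReal.ofReal (K * (∑' m : ℕ, Real.exp (-c * (m : ℝ) ^ 2) * ((m : ℝ) + 1) ^ α) *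
          t ^ (α / 2)) := by
        rw [← ENNReal.ofReal_tsum_of_nonneg (fun m => by positivity) (hs.mul_left _), tsum_mul_left]
        congr 1
        ring

lemma abs_heatKernel_le (h : IsHeatSystem μ φ ℓ α) : ∃ c₁ c : ℝ, 0 < c₁ ∧ 0 < c ∧
    ∀ t ∈ Ioc (0 : ℝ) 1, ∀ x y,
      |ker φ (heatMul ℓ t) x y| ≤ c₁ * t ^ (-α / 2) * Real.exp (-c * dist x y ^ 2 / t) := by
  obtain ⟨c₁, c, h1, h2, h3⟩ := h.gauss
  exact ⟨c₁, c, h1, h2, fun t ht x y => (h3 t ht x y).2⟩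

lemma lintegral_ker_heatMul_le (h : IsHeatSystem μ φ ℓ α) : ∃ C : ℝ, 0 < C ∧
    ∀ t ∈ Ioc (0 : ℝ) 1, ∀ x, ∫⁻ y, ‖ker φ (heatMul ℓ t) x y‖ₑ ∂μ ≤ ENNReal.ofReal C := by
  obtain ⟨c₁, c, hc₁, hc, hK⟩ := abs_heatKernel_le h
  obtain ⟨C, hC, hG⟩ := lintegral_gaussian_le h.ball hc
  refine ⟨c₁ * C, by positivity, fun t ht x => ?_⟩
  have ht0 : 0 < t := ht.1
  calc ∫⁻ y, ‖ker φ (heatMul ℓ t) x y‖ₑ ∂μ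
      ≤ ∫⁻ y, ENNReal.ofReal (c₁ * t ^ (-α / 2)) *
          ENNReal.ofReal (Real.exp (-c * dist x y ^ 2 / t)) ∂μ := by
        refine lintegral_mono fun y => ?_
        rw [← ENNReal.ofReal_mul (by positivity), Real.enorm_eq_ofReal_abs]
        exact ENNReal.ofReal_le_ofReal (hK t ht x y)
    _ ≤ ENNReal.ofReal (c₁ * t ^ (-α / 2)) * ENNReal.ofReal (C * t ^ (α / 2)) := by
        rw [lintegral_const_mul' _ _ ENNReal.ofReal_ne_top]
        gcongr
        exact hG t ht0 x
    _ = ENNReal.ofReal (c₁ * C) := by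
        rw [← ENNReal.ofReal_mul (by positivity)]
        congr 1
        have : t ^ (-α / 2) * t ^ (α / 2) = 1 := by
          rw [← Real.rpow_add ht0]
          simp [neg_div]
        calc _ = c₁ * C * (t ^ (-α / 2) * t ^ (α / 2)) := by ring
          _ = _ := by rw [this, mul_one]

/-- Orthonormality: the squared `L²` norms of the rows of the kernel of `exp (-ℓ_j² t) m_j`,
`|m_j| ≤ 1`, are bounded by the diagonal of the heat kernel. -/
lemma integral_ker_sq_le (h : IsHeatSystem μ φ ℓ α) {m : ℕ → ℝ} {t : ℝ} (ht : 0 < t)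
    (hm : ∀ j, |m j| ≤ 1) (x : M) :
    ∫⁻ y, ENNReal.ofReal (ker φ (fun j => heatMul ℓ t j * m j) x y ^ 2) ∂μ ≤
      ENNReal.ofReal (ker φ (heatMul ℓ t) x x) := by
  have hA := adm_heatMul h ht
  have hm' : Adm φ (fun j => heatMul ℓ t j * m j) := adm_mul_of_bdd hA hm
  have hc := continuous_ker_right h hm' x
  rw [← ofReal_integral_eq_lintegral_ofReal]
  · refine ENNReal.ofReal_le_ofReal ?_
    have h1 := integral_ker_mul_ker h hm' hm' x x
    simp_rw [ker_symm _ _ x, ← sq] at h1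
    rw [h1]
    have hb : ∀ j, |heatMul ℓ t j| ≤ 1 := fun j => by
      rw [heatMul, abs_of_pos (Real.exp_pos _), Real.exp_le_one_iff]
      nlinarith [sq_nonneg (ℓ j)]
    have hA2 : Adm φ (fun j => (heatMul ℓ t j * m j) * (heatMul ℓ t j * m j)) :=
      adm_mul_of_bdd hm' (C := 1) fun j => by
        rw [abs_mul]
        exact mul_le_one₀ (hb j) (abs_nonneg _) (hm j)
    refine hasSum_le (fun j => ?_) (by simpa [sq] using hasSum_ker h hA2 x x) (hasSum_ker h hA x x)
    have h2 : heatMul ℓ t j * (heatMul ℓ t j * m j ^ 2) ≤ heatMul ℓ t j * 1 := by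
      refine mul_le_mul_of_nonneg_left ?_ (Real.exp_pos _).le
      refine mul_le_one₀ ((le_abs_self _).trans (hb j)) (sq_nonneg _) ?_
      rw [← sq_abs]
      exact pow_le_one₀ (abs_nonneg _) (hm j)
    nlinarith [sq_nonneg (φ j x)]
  · exact integrable_of_continuous (by fun_prop)
  · exact Eventually.of_forall fun y => sq_nonneg _

/-- The rows of the kernel of `w_j cos (k θ_j)`, `w_j = exp (-ℓ_j² t) = (1 + cos θ_j) / 2`, have
`L¹` norm at most a multiple of `(1 + k) ^ (α / 2)`. Within distance `R ~ (k + 1) √t` this is the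
`L²` bound of orthonormality. Beyond `R` the multiplier is a polynomial in `w_j` of degree `k + 1`,
so that its kernel is a combination of heat kernels at times up to `(k + 1) t`; their Gaussian
decay there beats the coefficients. -/
lemma lintegral_ker_heatMul_mul_cos_le (h : IsHeatSystem μ φ ℓ α) : ∃ C : ℝ, 0 < C ∧
    ∀ t ∈ Ioc (0 : ℝ) 1, ∀ θ : ℕ → ℝ, (∀ j, (1 + Real.cos (θ j)) / 2 = heatMul ℓ t j) →
      ∀ (k : ℕ) x, ∫⁻ y, ‖ker φ (fun j => heatMul ℓ t j * Real.cos (k * θ j)) x y‖ₑ ∂μ ≤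
        ENNReal.ofReal (C * (1 + (k : ℝ)) ^ (α / 2)) := by
  obtain ⟨c₁, c, hc₁, hc, hK⟩ := abs_heatKernel_le h
  obtain ⟨C, hC, hG⟩ := lintegral_gaussian_le h.ball (half_pos hc)
  obtain ⟨B, hB, hball⟩ := h.ball
  have hα := h.pos
  set R₀ : ℝ := Real.sqrt (4 / c) with hR₀
  have hR₀pos : 0 < R₀ := Real.sqrt_pos.2 (by positivity)
  refine ⟨(max (B * R₀ ^ α) 1) + c₁ + c₁ * C, by positivity, fun t ht θ hθ k x => ?_⟩
  have ht0 : 0 < t := ht.1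
  have hA := adm_heatMul h ht0
  set κ : ℝ := 1 + (k : ℝ) with hκ
  have hκ1 : 1 ≤ κ := by rw [hκ]; linarith [(Nat.cast_nonneg k : (0 : ℝ) ≤ k)]
  have hκ0 : 0 < κ := by linarith
  set f : M → ℝ := ker φ (fun j => heatMul ℓ t j * Real.cos (k * θ j)) x with hf
  -- the two parts of `|f| ≤ λ + f² / λ` are balanced by this choice of `λ`
  set lam : ℝ := (κ * t) ^ (-α / 2) with hlam
  have hκt : 0 < κ * t := by positivity
  have hlam0 : 0 < lam := by positivity
  have hcos : ∀ j, |Real.cos (k * θ j)| ≤ 1 := fun j => Real.abs_cos_le_one _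
  have hfc : Continuous f := continuous_ker_right h (adm_mul_of_bdd hA hcos) x
  have hdiag : ker φ (heatMul ℓ t) x x ≤ c₁ * t ^ (-α / 2) := by
    simpa using (le_abs_self _).trans (hK t ht x x)
  have hyoung : ∀ y, |f y| ≤ lam + lam⁻¹ * f y ^ 2 := by
    intro y
    have e : lam⁻¹ * f y ^ 2 = (|f y| / lam) * |f y| := by
      rw [div_mul_eq_mul_div, ← sq, sq_abs]
      field_simp
    rw [e]
    rcases le_total |f y| lam with h1 | h1
    · have : 0 ≤ |f y| / lam * |f y| := by positivity
      linarith
    · have h2 : 1 ≤ |f y| / lam := (one_le_div hlam0).2 h1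
      nlinarith [abs_nonneg (f y)]
  have hsq : ∫⁻ y, ENNReal.ofReal (lam⁻¹ * f y ^ 2) ∂μ ≤ ENNReal.ofReal (c₁ * κ ^ (α / 2)) := by
    simp_rw [ENNReal.ofReal_mul (inv_nonneg.2 hlam0.le)]
    rw [lintegral_const_mul' _ _ ENNReal.ofReal_ne_top]
    calc _ ≤ ENNReal.ofReal lam⁻¹ * ENNReal.ofReal (c₁ * t ^ (-α / 2)) := by
          gcongr
          exact (integral_ker_sq_le h ht0 hcos x).trans (ENNReal.ofReal_le_ofReal hdiag)
      _ = _ := by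
          rw [← ENNReal.ofReal_mul (by positivity)]
          congr 1
          rw [hlam, neg_div, ← Real.rpow_neg hκt.le, neg_neg, Real.mul_rpow hκ0.le ht0.le,
            Real.rpow_neg ht0.le]
          have : t ^ (α / 2) ≠ 0 := by positivity
          field_simp
  rcases le_or_gt (κ * t) 1 with hcase | hcase
  · set R : ℝ := R₀ * (κ * Real.sqrt t) with hR
    have hRpos : 0 < R := by have := Real.sqrt_pos.2 ht0; positivity
    have hR2 : R ^ 2 = 4 / c * (κ ^ 2 * t) := by
      rw [hR, mul_pow, mul_pow, Real.sq_sqrt ht0.le, hR₀, Real.sq_sqrt (by positivity)]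
    have hRα : R ^ α = R₀ ^ α * (κ ^ α * t ^ (α / 2)) := by
      rw [hR, Real.mul_rpow hR₀pos.le (by positivity), Real.mul_rpow hκ0.le (by positivity),
        Real.sqrt_eq_rpow, ← Real.rpow_mul ht0.le]
      ring_nf
    have hfar : ∀ y, R ≤ dist x y →
        |f y| ≤ c₁ * t ^ (-α / 2) * Real.exp (-(c / 2) * dist x y ^ 2 / (κ * t)) := by
      intro y hy
      obtain ⟨d, -, hd1, hd2⟩ := exists_cos_nat_mul_eq_sum k
      have hexp : f y = ∑ i ∈ Finset.range (k + 1),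
          d i * ker φ (heatMul ℓ (((i : ℝ) + 1) * t)) x y := by
        have hs : ∀ i ∈ Finset.range (k + 1), HasSum
            (fun j => d i * (heatMul ℓ (((i : ℝ) + 1) * t) j * φ j x * φ j y))
            (d i * ker φ (heatMul ℓ (((i : ℝ) + 1) * t)) x y) := fun i _ =>
          (hasSum_ker h (adm_heatMul h (by positivity)) x y).mul_left _
        rw [← (hasSum_sum hs).tsum_eq, hf, ker]
        refine tsum_congr fun j => ?_
        rw [hd2, hθ, Finset.mul_sum, Finset.sum_mul, Finset.sum_mul]
        refine Finset.sum_congr rfl fun i _ => ?_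
        have : heatMul ℓ (((i : ℝ) + 1) * t) j = heatMul ℓ t j * heatMul ℓ t j ^ i := by
          simp only [heatMul]
          rw [← Real.exp_nat_mul, ← Real.exp_add]
          congr 1
          ring
        rw [this]
        ring
      have hterm : ∀ i ∈ Finset.range (k + 1), |d i * ker φ (heatMul ℓ (((i : ℝ) + 1) * t)) x y| ≤
          |d i| * (c₁ * t ^ (-α / 2) * Real.exp (-c * dist x y ^ 2 / (κ * t))) := by
        intro i hi
        rw [abs_mul]
        have hik : (i : ℝ) + 1 ≤ κ := by
          rw [hκ, add_comm]
          gcongr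
          exact Nat.lt_succ_iff.1 (Finset.mem_range.1 hi)
        have hi0 : (0 : ℝ) < (i : ℝ) + 1 := by positivity
        have hit : ((i : ℝ) + 1) * t ≤ κ * t := by gcongr
        have h1 := hK (((i : ℝ) + 1) * t) ⟨by positivity, hit.trans hcase⟩ x y
        refine mul_le_mul_of_nonneg_left (h1.trans ?_) (abs_nonneg _)
        have h2 : (((i : ℝ) + 1) * t) ^ (-α / 2) ≤ t ^ (-α / 2) := by
          refine Real.rpow_le_rpow_of_nonpos ht0 ?_ (by linarith)
          have : (0 : ℝ) ≤ i := Nat.cast_nonneg i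
          nlinarith
        have h3 : Real.exp (-c * dist x y ^ 2 / (((i : ℝ) + 1) * t)) ≤
            Real.exp (-c * dist x y ^ 2 / (κ * t)) := by
          refine Real.exp_le_exp.2 ?_
          rw [neg_mul, neg_div, neg_div, neg_le_neg_iff]
          gcongr
        gcongr
      have hdecay : 7 ^ k * Real.exp (-c * dist x y ^ 2 / (κ * t)) ≤
          Real.exp (-(c / 2) * dist x y ^ 2 / (κ * t)) := by
        have h7 : (7 : ℝ) ^ k ≤ Real.exp (2 * κ) := by
          have h1 : (7 : ℝ) ≤ Real.exp 1 ^ 2 := by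
            have := Real.exp_one_gt_d9
            nlinarith
          calc (7 : ℝ) ^ k ≤ (Real.exp 1 ^ 2) ^ k := by gcongr
            _ = Real.exp (2 * k) := by
              rw [← pow_mul, ← Real.exp_nat_mul]
              push_cast
              rw [mul_one]
            _ ≤ Real.exp (2 * κ) := Real.exp_le_exp.2 (by rw [hκ]; linarith)
        calc 7 ^ k * Real.exp (-c * dist x y ^ 2 / (κ * t))
            ≤ Real.exp (2 * κ) * Real.exp (-c * dist x y ^ 2 / (κ * t)) := by gcongr
          _ = Real.exp (2 * κ + -c * dist x y ^ 2 / (κ * t)) := (Real.exp_add _ _).symm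
          _ ≤ _ := by
            refine Real.exp_le_exp.2 ?_
            have h1 : R ^ 2 ≤ dist x y ^ 2 := by gcongr
            rw [hR2] at h1
            have h2 : 2 * κ ≤ (c / 2) * dist x y ^ 2 / (κ * t) := by
              rw [le_div_iff₀ hκt]
              have : c / 2 * (4 / c * (κ ^ 2 * t)) ≤ c / 2 * dist x y ^ 2 := by gcongr
              have e : c / 2 * (4 / c * (κ ^ 2 * t)) = 2 * κ * (κ * t) := by
                field_simp
                ring
              linarith
            have e1 : -c * dist x y ^ 2 / (κ * t) = -(2 * ((c / 2) * dist x y ^ 2 / (κ * t))) := by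
              ring
            have e2 : -(c / 2) * dist x y ^ 2 / (κ * t) = -((c / 2) * dist x y ^ 2 / (κ * t)) := by
              ring
            rw [e1, e2]
            linarith
      have hpos : 0 ≤ c₁ * t ^ (-α / 2) * Real.exp (-c * dist x y ^ 2 / (κ * t)) := by positivity
      calc |f y| ≤ ∑ i ∈ Finset.range (k + 1),
            |d i * ker φ (heatMul ℓ (((i : ℝ) + 1) * t)) x y| := by
            rw [hexp]
            exact Finset.abs_sum_le_sum_abs _ _
        _ ≤ (∑ i ∈ Finset.range (k + 1), |d i|) *
            (c₁ * t ^ (-α / 2) * Real.exp (-c * dist x y ^ 2 / (κ * t))) := by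
            rw [Finset.sum_mul]
            exact Finset.sum_le_sum hterm
        _ ≤ 7 ^ k * (c₁ * t ^ (-α / 2) * Real.exp (-c * dist x y ^ 2 / (κ * t))) := by gcongr
        _ = c₁ * t ^ (-α / 2) * (7 ^ k * Real.exp (-c * dist x y ^ 2 / (κ * t))) := by ring
        _ ≤ _ := by gcongr
    have hpt : ∀ y, ‖f y‖ₑ ≤ (Metric.closedBall x R).indicator (fun _ => ENNReal.ofReal lam) y +
        ENNReal.ofReal (lam⁻¹ * f y ^ 2) + ENNReal.ofReal (c₁ * t ^ (-α / 2)) *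
          ENNReal.ofReal (Real.exp (-(c / 2) * dist x y ^ 2 / (κ * t))) := by
      intro y
      rw [Real.enorm_eq_ofReal_abs]
      by_cases hy : y ∈ Metric.closedBall x R
      · rw [indicator_of_mem hy, ← ENNReal.ofReal_add hlam0.le (by positivity)]
        exact le_add_right (ENNReal.ofReal_le_ofReal (hyoung y))
      · rw [← ENNReal.ofReal_mul (by positivity)]
        refine le_add_left (ENNReal.ofReal_le_ofReal (hfar y ?_))
        rw [Metric.mem_closedBall, dist_comm, not_le] at hy
        exact hy.le
    calc ∫⁻ y, ‖f y‖ₑ ∂μ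
        ≤ ∫⁻ y, ((Metric.closedBall x R).indicator (fun _ => ENNReal.ofReal lam) y +
          ENNReal.ofReal (lam⁻¹ * f y ^ 2) + ENNReal.ofReal (c₁ * t ^ (-α / 2)) *
          ENNReal.ofReal (Real.exp (-(c / 2) * dist x y ^ 2 / (κ * t)))) ∂μ := lintegral_mono hpt
      _ = ENNReal.ofReal lam * μ (Metric.closedBall x R) +
          ∫⁻ y, ENNReal.ofReal (lam⁻¹ * f y ^ 2) ∂μ + ENNReal.ofReal (c₁ * t ^ (-α / 2)) *
          ∫⁻ y, ENNReal.ofReal (Real.exp (-(c / 2) * dist x y ^ 2 / (κ * t))) ∂μ := by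
          have m1 : Measurable ((Metric.closedBall x R).indicator fun _ => ENNReal.ofReal lam) :=
            measurable_const.indicator measurableSet_closedBall
          have m2 : Measurable fun y => ENNReal.ofReal (lam⁻¹ * f y ^ 2) :=
            (by fun_prop : Continuous fun y => lam⁻¹ * f y ^ 2).measurable.ennreal_ofReal
          have m3 : Measurable fun y =>
              (Metric.closedBall x R).indicator (fun _ => ENNReal.ofReal lam) y +
                ENNReal.ofReal (lam⁻¹ * f y ^ 2) := m1.add m2
          rw [lintegral_add_left m3, lintegral_add_left m1,
            lintegral_indicator_const measurableSet_closedBall,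
            lintegral_const_mul' _ _ ENNReal.ofReal_ne_top]
      _ ≤ ENNReal.ofReal (max (B * R₀ ^ α) 1 * κ ^ (α / 2)) + ENNReal.ofReal (c₁ * κ ^ (α / 2)) +
          ENNReal.ofReal (c₁ * C * κ ^ (α / 2)) := by
          have htt : t ^ (-α / 2) * t ^ (α / 2) = 1 := by
            rw [← Real.rpow_add ht0]
            simp [neg_div]
          gcongr
          · calc ENNReal.ofReal lam * μ (Metric.closedBall x R)
                ≤ ENNReal.ofReal lam * ENNReal.ofReal (B * R ^ α) := by
                  gcongr
                  exact hball x R hRpos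
              _ = ENNReal.ofReal (B * R₀ ^ α * κ ^ (α / 2)) := by
                  rw [← ENNReal.ofReal_mul hlam0.le, hRα, hlam, Real.mul_rpow hκ0.le ht0.le]
                  congr 1
                  have e : κ ^ α = κ ^ (α / 2) * κ ^ (α / 2) := by
                    rw [← Real.rpow_add hκ0]
                    congr 1
                    ring
                  have e2 : κ ^ (-α / 2) * κ ^ (α / 2) = 1 := by
                    rw [← Real.rpow_add hκ0]
                    simp [neg_div]
                  calc _ = B * R₀ ^ α * κ ^ (α / 2) * (κ ^ (-α / 2) * κ ^ (α / 2)) *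
                        (t ^ (-α / 2) * t ^ (α / 2)) := by rw [e]; ring
                    _ = _ := by rw [e2, htt]; ring
              _ ≤ _ := by
                  refine ENNReal.ofReal_le_ofReal ?_
                  gcongr
                  exact le_max_left _ _
          · calc _ ≤ ENNReal.ofReal (c₁ * t ^ (-α / 2)) *
                  ENNReal.ofReal (C * (κ * t) ^ (α / 2)) := by
                  gcongr
                  exact hG _ hκt x
              _ = _ := by
                  rw [← ENNReal.ofReal_mul (by positivity), Real.mul_rpow hκ0.le ht0.le]
                  congr 1
                  calc _ = c₁ * C * κ ^ (α / 2) * (t ^ (-α / 2) * t ^ (α / 2)) := by ring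
                    _ = _ := by rw [htt, mul_one]
      _ = _ := by
          rw [← ENNReal.ofReal_add (by positivity) (by positivity),
            ← ENNReal.ofReal_add (by positivity) (by positivity)]
          congr 1
          ring
  · calc ∫⁻ y, ‖f y‖ₑ ∂μ
        ≤ ∫⁻ y, (ENNReal.ofReal lam + ENNReal.ofReal (lam⁻¹ * f y ^ 2)) ∂μ := by
          refine lintegral_mono fun y => ?_
          rw [Real.enorm_eq_ofReal_abs, ← ENNReal.ofReal_add hlam0.le (by positivity)]
          exact ENNReal.ofReal_le_ofReal (hyoung y)
      _ = ENNReal.ofReal lam + ∫⁻ y, ENNReal.ofReal (lam⁻¹ * f y ^ 2) ∂μ := by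
          rw [lintegral_add_left measurable_const]
          simp
      _ ≤ ENNReal.ofReal (1 * κ ^ (α / 2)) + ENNReal.ofReal (c₁ * κ ^ (α / 2)) := by
          refine add_le_add (ENNReal.ofReal_le_ofReal ?_) hsq
          have h1 : lam ≤ 1 := Real.rpow_le_one_of_one_le_of_nonpos hcase.le (by linarith)
          have h2 : 1 ≤ κ ^ (α / 2) := Real.one_le_rpow hκ1 (by linarith)
          linarith
      _ ≤ _ := by
          rw [← ENNReal.ofReal_add (by positivity) (by positivity), ← add_mul]
          refine ENNReal.ofReal_le_ofReal ?_
          refine mul_le_mul_of_nonneg_right ?_ (by positivity)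
          have := le_max_right (B * R₀ ^ α) 1
          have : 0 ≤ c₁ * C := by positivity
          linarith

/-- **Multiplier theorem.** A mask of type `-γ` localized at frequencies comparable to `N` has a
kernel with rows of `L¹` norm at most a multiple of `N ^ γ`. -/
lemma lintegral_ker_multiplier_le (h : IsHeatSystem μ φ ℓ α) {S : ℕ} (hS : α < S) {Y : ℝ → ℝ}
    (hY : ContDiff ℝ ∞ Y) (hY0 : ∀ u ∉ Icc (1 / 4 : ℝ) 2, Y u = 0) {ι : Type*} {F : ι → ℝ → ℝ}
    (hF : UniformCk univ S F) (γ : ℝ) :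
    ∃ C : ℝ, 0 < C ∧ ∀ i, ∀ N : ℝ, 1 ≤ N → ∀ x,
      ∫⁻ y, ‖ker φ (fun j => Y (ℓ j ^ 2 / N ^ 2) * (1 + ℓ j) ^ γ * F i (Real.log (ℓ j))) x y‖ₑ ∂μ ≤
        ENNReal.ofReal (C * N ^ γ) := by
  have hα := h.pos
  have hS1 : (1 : ℝ) ≤ S := by
    have : 0 < S := by
      have : (0 : ℝ) < S := hα.trans hS
      exact_mod_cast this
    exact_mod_cast this
  obtain ⟨C₁, hC₁⟩ := multiplier_expansion (s := α / 2) (by linarith) (by linarith) hY hY0 hF γ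
  obtain ⟨C₂, hC₂, hcos⟩ := lintegral_ker_heatMul_mul_cos_le h
  refine ⟨C₂ * max C₁ 1, by positivity, fun i N hN x => ?_⟩
  have hN0 : 0 < N := by linarith
  obtain ⟨c, hc1, hc2, hc3⟩ := hC₁ i N hN
  set t : ℝ := 1 / N ^ 2 with ht
  have ht0 : 0 < t := by positivity
  have ht1 : t ∈ Ioc (0 : ℝ) 1 := ⟨ht0, by
    rw [ht, div_le_one (by positivity)]
    exact one_le_pow₀ hN⟩
  have hw : ∀ j, heatMul ℓ t j = Real.exp (-(ℓ j ^ 2 / N ^ 2)) := fun j => by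
    rw [heatMul, ht]
    congr 1
    ring
  set θ : ℕ → ℝ := fun j => Real.arccos (2 * heatMul ℓ t j - 1) with hθdef
  have hθ : ∀ j, (1 + Real.cos (θ j)) / 2 = heatMul ℓ t j := fun j => by
    have h0 : 0 < heatMul ℓ t j := Real.exp_pos _
    have h1 : heatMul ℓ t j ≤ 1 := by
      rw [heatMul, Real.exp_le_one_iff]
      nlinarith [sq_nonneg (ℓ j)]
    rw [hθdef, Real.cos_arccos (by linarith) (by linarith)]
    ring
  have hA := adm_heatMul h ht0
  have hcle : ∀ n : ℤ, |c n| ≤ |c n| * (1 + |(n : ℝ)|) ^ (α / 2) := fun n =>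
    le_mul_of_one_le_right (abs_nonneg _)
      (Real.one_le_rpow (by linarith [abs_nonneg (n : ℝ)]) (by linarith))
  have hc0 : Summable fun n : ℤ => |c n| :=
    Summable.of_nonneg_of_le (fun n => abs_nonneg _) hcle hc1
  set e : ℤ → ℕ → ℝ := fun n j => heatMul ℓ t j * Real.cos ((n.natAbs : ℝ) * θ j) with he
  have hcosabs : ∀ (n : ℤ) j, Real.cos ((n.natAbs : ℝ) * θ j) = Real.cos (n * θ j) := fun n j => by
    rw [Nat.cast_natAbs, Int.cast_abs]
    rcases abs_choice (n : ℝ) with h1 | h1 <;> rw [h1]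
    rw [neg_mul, Real.cos_neg]
  have hbound : ∀ n j (y : M), ‖e n j * φ j x * φ j y‖ ≤ |heatMul ℓ t j| * supNorm (φ j) ^ 2 := by
    intro n j y
    refine (norm_ker_term_le h _ x y j).trans ?_
    rw [he, abs_mul]
    refine mul_le_mul_of_nonneg_right ?_ (sq_nonneg _)
    exact mul_le_of_le_one_right (abs_nonneg _) (Real.abs_cos_le_one _)
  have hker : ∀ y, ker φ (fun j => Y (ℓ j ^ 2 / N ^ 2) * (1 + ℓ j) ^ γ * F i (Real.log (ℓ j))) x y =
      N ^ γ * ∑' n : ℤ, c n * ker φ (e n) x y := by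
    intro y
    have hs : Summable (Function.uncurry fun (j : ℕ) (n : ℤ) => c n * (e n j * φ j x * φ j y)) := by
      refine Summable.of_norm_bounded (g := fun z : ℕ × ℤ =>
        (|heatMul ℓ t z.1| * supNorm (φ z.1) ^ 2) * |c z.2|) ?_ fun z => ?_
      · exact Summable.mul_of_nonneg (f := fun j => |heatMul ℓ t j| * supNorm (φ j) ^ 2)
          (g := fun n : ℤ => |c n|) hA hc0 (fun j => by positivity) (fun n => by positivity)
      · simp only [Function.uncurry]
        rw [norm_mul, mul_comm, Real.norm_eq_abs (c z.2)]
        gcongr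
        exact hbound _ _ _
    rw [ker, ← tsum_mul_left]
    simp only [ker, ← tsum_mul_left]
    rw [Summable.tsum_comm]
    · refine tsum_congr fun j => ?_
      have h1 := (hc3 (ℓ j) (θ j) (ell_nonneg h j) (by rw [hθ, hw])).mul_right (φ j x * φ j y)
      have h2 := (h1.mul_left (N ^ γ)).tsum_eq
      have hNN : N ^ γ * N ^ (-γ) = 1 := by rw [← Real.rpow_add hN0]; simp
      rw [← hw j] at h2
      calc _ = (N ^ γ * N ^ (-γ)) * (Y (ℓ j ^ 2 / N ^ 2) * (1 + ℓ j) ^ γ *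
            F i (Real.log (ℓ j)) * φ j x * φ j y) := by rw [hNN, one_mul]
        _ = _ := by
          refine Eq.trans (by ring) (h2.symm.trans (tsum_congr fun n => ?_))
          simp only [he]
          rw [hcosabs]
          ring
    · exact hs.mul_left (N ^ γ)
  have hE : ∀ n : ℤ, Continuous (ker φ (e n) x) := fun n =>
    continuous_ker_right h (adm_mul_of_bdd hA fun j => Real.abs_cos_le_one _) x
  calc ∫⁻ y, ‖ker φ (fun j => Y (ℓ j ^ 2 / N ^ 2) * (1 + ℓ j) ^ γ *
        F i (Real.log (ℓ j))) x y‖ₑ ∂μ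
      ≤ ∫⁻ y, ENNReal.ofReal (N ^ γ) * ∑' n : ℤ, ENNReal.ofReal |c n| * ‖ker φ (e n) x y‖ₑ ∂μ := by
        refine lintegral_mono fun y => ?_
        rw [hker, enorm_mul, Real.enorm_eq_ofReal (by positivity)]
        gcongr
        refine enorm_tsum_le_tsum_enorm.trans (le_of_eq (tsum_congr fun n => ?_))
        rw [enorm_mul, Real.enorm_eq_ofReal_abs (c n)]
    _ = ENNReal.ofReal (N ^ γ) * ∑' n : ℤ, ENNReal.ofReal |c n| * ∫⁻ y, ‖ker φ (e n) x y‖ₑ ∂μ := by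
        rw [lintegral_const_mul' _ _ ENNReal.ofReal_ne_top, lintegral_tsum]
        · congr 1
          refine tsum_congr fun n => ?_
          rw [lintegral_const_mul' _ _ ENNReal.ofReal_ne_top]
        · exact fun n => ((hE n).enorm.measurable.const_mul _).aemeasurable
    _ ≤ ENNReal.ofReal (N ^ γ) * ∑' n : ℤ, ENNReal.ofReal
          (C₂ * (|c n| * (1 + |(n : ℝ)|) ^ (α / 2))) := by
        gcongr with n
        refine (mul_le_mul_right (hcos t ht1 θ hθ n.natAbs x) _).trans (le_of_eq ?_)
        rw [← ENNReal.ofReal_mul (abs_nonneg _), Nat.cast_natAbs, Int.cast_abs]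
        congr 1
        ring
    _ ≤ ENNReal.ofReal (C₂ * max C₁ 1 * N ^ γ) := by
        rw [← ENNReal.ofReal_tsum_of_nonneg (fun n => by positivity) (hc1.mul_left _),
          ← ENNReal.ofReal_mul (by positivity), tsum_mul_left]
        refine ENNReal.ofReal_le_ofReal ?_
        rw [mul_comm]
        have := hc2.trans (le_max_left C₁ 1)
        gcongr

end Kernels

/-! ### Schur's test -/

section Schur

variable {X Y : Type*} [MeasurableSpace X] [MeasurableSpace Y] {μ : Measure X} {ν : Measure Y}

/-- Jensen's inequality for the measure with density `k`. -/
lemma lintegral_mul_rpow_le {k f : Y → ℝ≥0∞} (hk : AEMeasurable k ν) (hf : AEMeasurable f ν)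
    {q : ℝ} (hq : 1 ≤ q) :
    (∫⁻ y, k y * f y ∂ν) ^ q ≤ (∫⁻ y, k y ∂ν) ^ (q - 1) * ∫⁻ y, k y * f y ^ q ∂ν := by
  rcases hq.eq_or_lt with rfl | hq
  · simp
  have hq0 : 0 < q := by linarith
  have hc : (q.conjExponent).HolderConjugate q := (Real.HolderConjugate.conjExponent hq).symm
  set r := q.conjExponent with hr
  have hr0 : 0 < r := hc.pos
  have h1 := ENNReal.lintegral_mul_le_Lp_mul_Lq ν hc (hk.pow_const (1 / r))
    ((hk.pow_const (1 / q)).mul hf)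
  have e1 : ∀ y, (k y ^ (1 / r)) * (k y ^ (1 / q) * f y) = k y * f y := fun y => by
    rw [← mul_assoc, ← ENNReal.rpow_add_of_nonneg _ _ (by positivity) (by positivity)]
    have := hc.inv_add_inv_eq_one
    rw [one_div, one_div, this, ENNReal.rpow_one]
  have e2 : ∀ y, (k y ^ (1 / r)) ^ r = k y := fun y => by
    rw [← ENNReal.rpow_mul, one_div_mul_cancel hr0.ne', ENNReal.rpow_one]
  have e3 : ∀ y, (k y ^ (1 / q) * f y) ^ q = k y * f y ^ q := fun y => by
    rw [ENNReal.mul_rpow_of_nonneg _ _ hq0.le, ← ENNReal.rpow_mul, one_div_mul_cancel hq0.ne',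
      ENNReal.rpow_one]
  simp only [Pi.mul_apply, e1, e2, e3] at h1
  refine (ENNReal.rpow_le_rpow h1 hq0.le).trans (le_of_eq ?_)
  rw [ENNReal.mul_rpow_of_nonneg _ _ hq0.le, ← ENNReal.rpow_mul, ← ENNReal.rpow_mul,
    one_div_mul_cancel hq0.ne', ENNReal.rpow_one]
  congr 2
  have := hc.inv_add_inv_eq_one
  field_simp at this ⊢
  linarith

/-- **Schur's test**: an integral operator whose kernel has rows of `L¹` norm at most `A` and
columns of `L¹` norm at most `B` is bounded on `L^p` with norm at most
`A ^ (1 - 1 / p) B ^ (1 / p)`. -/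
lemma eLpNorm_integral_mul_le [SFinite μ] [SFinite ν] {k : X → Y → ℝ}
    (hk : Measurable (Function.uncurry k)) {A B : ℝ} (hA0 : 0 < A) (hB0 : 0 < B)
    (hA : ∀ x, ∫⁻ y, ‖k x y‖ₑ ∂ν ≤ ENNReal.ofReal A)
    (hB : ∀ y, ∫⁻ x, ‖k x y‖ₑ ∂μ ≤ ENNReal.ofReal B) {p : ℝ≥0∞} (hp : 1 ≤ p) {f : Y → ℝ}
    (hf : AEStronglyMeasurable f ν) :
    eLpNorm (fun x => ∫ y, k x y * f y ∂ν) p μ ≤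
      ENNReal.ofReal (A ^ (1 - (p⁻¹).toReal) * B ^ (p⁻¹).toReal) * eLpNorm f p ν := by
  have hpt : ∀ x, ‖∫ y, k x y * f y ∂ν‖ₑ ≤ ∫⁻ y, ‖k x y‖ₑ * ‖f y‖ₑ ∂ν := fun x => by
    refine (enorm_integral_le_lintegral_enorm _).trans (le_of_eq ?_)
    simp_rw [enorm_mul]
  have hkx : ∀ x, Measurable (k x) := fun x => hk.comp measurable_prodMk_left
  have hky : ∀ y, Measurable fun x => k x y := fun y => hk.comp measurable_prodMk_right
  rcases eq_or_ne p ⊤ with rfl | hpT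
  · simp only [eLpNorm_exponent_top, ENNReal.inv_top, ENNReal.toReal_zero, sub_zero, Real.rpow_one,
      Real.rpow_zero, mul_one]
    refine essSup_le_of_ae_le _ (Eventually.of_forall fun x => (hpt x).trans ?_)
    calc ∫⁻ y, ‖k x y‖ₑ * ‖f y‖ₑ ∂ν ≤ ∫⁻ y, ‖k x y‖ₑ * eLpNormEssSup f ν ∂ν := by
          refine lintegral_mono_ae ?_
          filter_upwards [enorm_ae_le_eLpNormEssSup f ν] with y hy
          exact mul_le_mul_right hy _
      _ = (∫⁻ y, ‖k x y‖ₑ ∂ν) * eLpNormEssSup f ν :=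
          lintegral_mul_const _ (hkx x).enorm
      _ ≤ ENNReal.ofReal A * eLpNormEssSup f ν := mul_le_mul_left (hA x) _
  have hp0 : p ≠ 0 := (zero_lt_one.trans_le hp).ne'
  set q := p.toReal with hq
  have hq1 : 1 ≤ q := by
    rw [hq, ← ENNReal.toReal_one]
    exact ENNReal.toReal_mono hpT hp
  have hq0 : 0 < q := by linarith
  rw [eLpNorm_eq_lintegral_rpow_enorm_toReal hp0 hpT,
    eLpNorm_eq_lintegral_rpow_enorm_toReal hp0 hpT, ENNReal.toReal_inv, ← hq]
  have hmain : ∫⁻ x, ‖∫ y, k x y * f y ∂ν‖ₑ ^ q ∂μ ≤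
      ENNReal.ofReal A ^ (q - 1) * (ENNReal.ofReal B * ∫⁻ y, ‖f y‖ₑ ^ q ∂ν) := by
    have hm : AEMeasurable (Function.uncurry fun x y => ‖k x y‖ₑ * ‖f y‖ₑ ^ q) (μ.prod ν) :=
      hk.enorm.aemeasurable.mul ((hf.enorm.pow_const q).comp_snd)
    calc ∫⁻ x, ‖∫ y, k x y * f y ∂ν‖ₑ ^ q ∂μ
        ≤ ∫⁻ x, ENNReal.ofReal A ^ (q - 1) * ∫⁻ y, ‖k x y‖ₑ * ‖f y‖ₑ ^ q ∂ν ∂μ := by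
          refine lintegral_mono fun x => ?_
          refine (ENNReal.rpow_le_rpow (hpt x) hq0.le).trans ?_
          refine (lintegral_mul_rpow_le (hkx x).enorm.aemeasurable hf.enorm hq1).trans ?_
          have := hA x
          gcongr
      _ = ENNReal.ofReal A ^ (q - 1) * ∫⁻ y, (∫⁻ x, ‖k x y‖ₑ ∂μ) * ‖f y‖ₑ ^ q ∂ν := by
          rw [lintegral_const_mul' _ _ (ENNReal.rpow_ne_top_of_nonneg (by linarith)
            ENNReal.ofReal_ne_top), lintegral_lintegral_swap hm]
          congr 1
          refine lintegral_congr fun y => ?_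
          exact lintegral_mul_const _ (hky y).enorm
      _ ≤ ENNReal.ofReal A ^ (q - 1) * ∫⁻ y, ENNReal.ofReal B * ‖f y‖ₑ ^ q ∂ν := by
          gcongr with y
          exact hB y
      _ = _ := by rw [lintegral_const_mul' _ _ ENNReal.ofReal_ne_top]
  refine (ENNReal.rpow_le_rpow hmain (by positivity)).trans (le_of_eq ?_)
  rw [ENNReal.mul_rpow_of_nonneg _ _ (by positivity),
    ENNReal.mul_rpow_of_nonneg _ _ (by positivity), ← mul_assoc, ← ENNReal.rpow_mul,
    ENNReal.ofReal_rpow_of_pos hA0, ENNReal.ofReal_rpow_of_pos hB0,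
    ← ENNReal.ofReal_mul (by positivity)]
  congr 4
  · field_simp
  · field_simp

end Schur

/-! ### Volume and separated sets -/

section Geometry

variable {M : Type*} [MetricSpace M] [CompactSpace M] [MeasurableSpace M] [BorelSpace M]
  {μ : Measure M} [IsProbabilityMeasure μ] {φ : ℕ → M → ℝ} {ℓ : ℕ → ℝ} {α : ℝ}

/-- Conservativeness of the heat kernel forces balls of radius `s` to have measure at least a
multiple of `s ^ α`: at time `t = η s²`, `η` small, less than half of `∫ K_t(x, y) dμ(y) = 1` comes
from outside of the ball. -/
lemma le_measure_closedBall (h : IsHeatSystem μ φ ℓ α) : ∃ c : ℝ, 0 < c ∧ ∀ x,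
    ∀ s ∈ Ioc (0 : ℝ) 1, ENNReal.ofReal (c * s ^ α) ≤ μ (Metric.closedBall x s) := by
  obtain ⟨c₁, c, hc₁, hc, hK⟩ := abs_heatKernel_le h
  obtain ⟨C, hC, hG⟩ := lintegral_gaussian_le h.ball (half_pos hc)
  set η : ℝ := min 1 (c / (4 * c₁ * C)) with hη
  have hη0 : 0 < η := by positivity
  have hη2 : c₁ * C * Real.exp (-(c / (2 * η))) ≤ 1 / 2 := by
    have h1 : η ≤ c / (4 * c₁ * C) := min_le_right _ _
    rw [le_div_iff₀ (by positivity)] at h1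
    have h2 : c / (2 * η) + 1 ≤ Real.exp (c / (2 * η)) := Real.add_one_le_exp _
    have h3 : 2 * (c₁ * C) ≤ c / (2 * η) := by
      rw [le_div_iff₀ (by positivity)]
      linarith
    rw [Real.exp_neg, ← div_eq_mul_inv, div_le_iff₀ (Real.exp_pos _)]
    linarith
  refine ⟨η ^ (α / 2) / (2 * c₁), by positivity, fun x s hs => ?_⟩
  have hs0 : 0 < s := hs.1
  set t : ℝ := η * s ^ 2 with ht
  have ht0 : 0 < t := by positivity
  have ht1 : t ∈ Ioc (0 : ℝ) 1 := ⟨ht0, by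
    have h1 : η ≤ 1 := min_le_left _ _
    have h2 : s ^ 2 ≤ 1 := pow_le_one₀ hs0.le hs.2
    exact mul_le_one₀ h1 (sq_nonneg s) h2⟩
  have htt : t ^ (-α / 2) * t ^ (α / 2) = 1 := by
    rw [← Real.rpow_add ht0]
    simp [neg_div]
  set E := c₁ * t ^ (-α / 2) with hE
  have hE0 : 0 < E := by positivity
  have hpt : ∀ y, ‖ker φ (heatMul ℓ t) x y‖ₑ ≤
      (Metric.closedBall x s).indicator (fun _ => ENNReal.ofReal E) y +
        ENNReal.ofReal (E * Real.exp (-(c / (2 * η)))) *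
          ENNReal.ofReal (Real.exp (-(c / 2) * dist x y ^ 2 / t)) := by
    intro y
    rw [Real.enorm_eq_ofReal_abs]
    by_cases hy : y ∈ Metric.closedBall x s
    · rw [indicator_of_mem hy]
      refine le_add_right (ENNReal.ofReal_le_ofReal ((hK t ht1 x y).trans ?_))
      refine mul_le_of_le_one_right hE0.le ?_
      rw [Real.exp_le_one_iff, neg_mul, neg_div, neg_nonpos]
      positivity
    · rw [← ENNReal.ofReal_mul (by positivity)]
      refine le_add_left (ENNReal.ofReal_le_ofReal ((hK t ht1 x y).trans ?_))
      rw [mul_assoc E, ← Real.exp_add]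
      refine mul_le_mul_of_nonneg_left (Real.exp_le_exp.2 ?_) hE0.le
      rw [Metric.mem_closedBall, dist_comm, not_le] at hy
      have h1 : c / (2 * η) ≤ c / 2 * dist x y ^ 2 / t := by
        rw [le_div_iff₀ ht0, ht]
        have : s ^ 2 ≤ dist x y ^ 2 := by gcongr
        have e : c / (2 * η) * (η * s ^ 2) = c / 2 * s ^ 2 := by field_simp
        rw [e]
        gcongr
      have e1 : -c * dist x y ^ 2 / t = -(2 * (c / 2 * dist x y ^ 2 / t)) := by ring
      have e2 : -(c / 2) * dist x y ^ 2 / t = -(c / 2 * dist x y ^ 2 / t) := by ring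
      rw [e1, e2]
      linarith
  have h1 : (1 : ℝ≥0∞) ≤ ENNReal.ofReal E * μ (Metric.closedBall x s) + ENNReal.ofReal (1 / 2) := by
    have hone : (1 : ℝ≥0∞) = ‖∫ y, heatKernel φ ℓ t x y ∂μ‖ₑ := by
      rw [(h.int t ht1 x).2]
      simp
    calc (1 : ℝ≥0∞) ≤ ∫⁻ y, ‖ker φ (heatMul ℓ t) x y‖ₑ ∂μ := by
          rw [hone]
          exact enorm_integral_le_lintegral_enorm _
      _ ≤ _ := lintegral_mono hpt
      _ = ENNReal.ofReal E * μ (Metric.closedBall x s) +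
          ENNReal.ofReal (E * Real.exp (-(c / (2 * η)))) *
          ∫⁻ y, ENNReal.ofReal (Real.exp (-(c / 2) * dist x y ^ 2 / t)) ∂μ := by
          rw [lintegral_add_left (measurable_const.indicator measurableSet_closedBall),
            lintegral_indicator_const measurableSet_closedBall,
            lintegral_const_mul' _ _ ENNReal.ofReal_ne_top]
      _ ≤ _ := by
          gcongr
          calc _ ≤ ENNReal.ofReal (E * Real.exp (-(c / (2 * η)))) *
                ENNReal.ofReal (C * t ^ (α / 2)) := by
                gcongr
                exact hG t ht0 x
            _ ≤ _ := by
                rw [← ENNReal.ofReal_mul (by positivity)]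
                refine ENNReal.ofReal_le_ofReal (le_trans (le_of_eq ?_) hη2)
                calc _ = c₁ * C * Real.exp (-(c / (2 * η))) * (t ^ (-α / 2) * t ^ (α / 2)) := by
                      rw [hE]; ring
                  _ = _ := by rw [htt, mul_one]
  have hfin : μ (Metric.closedBall x s) ≠ ⊤ := measure_ne_top _ _
  rw [ENNReal.ofReal_le_iff_le_toReal hfin]
  rw [← ENNReal.ofReal_toReal hfin, ← ENNReal.ofReal_mul hE0.le,
    ← ENNReal.ofReal_add (by positivity) (by norm_num), ENNReal.one_le_ofReal] at h1
  set m := (μ (Metric.closedBall x s)).toReal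
  have h2 : 1 / 2 ≤ E * m := by linarith
  have hts : t ^ (α / 2) = η ^ (α / 2) * s ^ α := by
    rw [ht, Real.mul_rpow hη0.le (by positivity), ← Real.rpow_natCast s 2, ← Real.rpow_mul hs0.le]
    congr 2
    push_cast
    ring
  have h3 : t ^ (α / 2) * (1 / 2) ≤ t ^ (α / 2) * (E * m) := by gcongr
  have e3 : t ^ (α / 2) * (E * m) = c₁ * m := by
    calc _ = c₁ * m * (t ^ (-α / 2) * t ^ (α / 2)) := by rw [hE]; ring
      _ = _ := by rw [htt, mul_one]
  rw [e3, hts] at h3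
  rw [div_mul_eq_mul_div, div_le_iff₀ (by positivity)]
  linarith

/-- The sum over an `s`-separated set is compared with the integral of a wider Gaussian over the
disjoint balls of radius `s / 3` about its points, whose volume is bounded below. -/
lemma sum_gaussian_le_of_separated (h : IsHeatSystem μ φ ℓ α) {c : ℝ} (hc : 0 < c) :
    ∃ C : ℝ, 0 < C ∧ ∀ s ∈ Ioc (0 : ℝ) 1, ∀ D : Finset M,
      (∀ y ∈ D, ∀ z ∈ D, y ≠ z → s ≤ dist y z) →
      ∀ x, ∑ y ∈ D, Real.exp (-c * dist x y ^ 2 / s ^ 2) ≤ C := by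
  obtain ⟨v, hv, hvol⟩ := le_measure_closedBall h
  obtain ⟨C, hC, hG⟩ := lintegral_gaussian_le h.ball (half_pos hc)
  refine ⟨Real.exp c * C * 3 ^ α / v, by positivity, fun s hs D hD x => ?_⟩
  have hs0 : 0 < s := hs.1
  have hs3 : s / 3 ∈ Ioc (0 : ℝ) 1 := ⟨by positivity, by linarith [hs.2]⟩
  have hdisj : (D : Set M).PairwiseDisjoint fun y => Metric.closedBall y (s / 3) := by
    intro y hy z hz hyz
    refine Metric.closedBall_disjoint_closedBall ?_
    have := hD y hy z hz hyz
    linarith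
  have hterm : ∀ y, ENNReal.ofReal (Real.exp (-c * dist x y ^ 2 / s ^ 2) * (v * (s / 3) ^ α)) ≤
      ∫⁻ z in Metric.closedBall y (s / 3), ENNReal.ofReal (Real.exp c) *
        ENNReal.ofReal (Real.exp (-(c / 2) * dist x z ^ 2 / s ^ 2)) ∂μ := by
    intro y
    rw [ENNReal.ofReal_mul (Real.exp_pos _).le]
    calc _ ≤ ENNReal.ofReal (Real.exp (-c * dist x y ^ 2 / s ^ 2)) *
          μ (Metric.closedBall y (s / 3)) := by
          gcongr
          exact hvol y _ hs3
      _ = ∫⁻ z in Metric.closedBall y (s / 3),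
          ENNReal.ofReal (Real.exp (-c * dist x y ^ 2 / s ^ 2)) ∂μ := by
          rw [setLIntegral_const]
      _ ≤ _ := by
          refine setLIntegral_mono' measurableSet_closedBall fun z hz => ?_
          rw [← ENNReal.ofReal_mul (Real.exp_pos _).le, ← Real.exp_add]
          refine ENNReal.ofReal_le_ofReal (Real.exp_le_exp.2 ?_)
          rw [Metric.mem_closedBall, dist_comm] at hz
          have h1 : dist x z ≤ dist x y + s / 3 := (dist_triangle x y z).trans (by linarith)
          have h2 : dist x z ^ 2 ≤ 2 * dist x y ^ 2 + 2 * s ^ 2 := by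
            have h3 : dist x z ^ 2 ≤ (dist x y + s / 3) ^ 2 := by gcongr
            nlinarith [sq_nonneg (dist x y - s / 3), sq_nonneg s]
          have e : c + -(c / 2) * dist x z ^ 2 / s ^ 2 =
              (c * s ^ 2 + -(c / 2) * dist x z ^ 2) / s ^ 2 := by field_simp
          rw [e]
          refine div_le_div_of_nonneg_right ?_ (by positivity)
          nlinarith
  have hsum : ∑ y ∈ D, ENNReal.ofReal (Real.exp (-c * dist x y ^ 2 / s ^ 2) * (v * (s / 3) ^ α)) ≤
      ENNReal.ofReal (Real.exp c * (C * s ^ α)) := by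
    refine (Finset.sum_le_sum fun y _ => hterm y).trans ?_
    rw [← lintegral_biUnion_finset hdisj fun y _ => measurableSet_closedBall]
    refine (setLIntegral_le_lintegral _ _).trans ?_
    rw [lintegral_const_mul' _ _ ENNReal.ofReal_ne_top, ENNReal.ofReal_mul (Real.exp_pos _).le]
    gcongr
    refine (hG (s ^ 2) (by positivity) x).trans (le_of_eq ?_)
    rw [← Real.rpow_natCast s 2, ← Real.rpow_mul hs0.le]
    congr 3
    push_cast
    ring
  rw [← ENNReal.ofReal_sum_of_nonneg fun y _ => by positivity,
    ENNReal.ofReal_le_ofReal_iff (by positivity), ← Finset.sum_mul,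
    Real.div_rpow hs0.le (by norm_num)] at hsum
  rw [le_div_iff₀ hv]
  have hsα : 0 < s ^ α := by positivity
  have h3 : (0 : ℝ) < 3 ^ α := by positivity
  have e : (∑ y ∈ D, Real.exp (-c * dist x y ^ 2 / s ^ 2)) * v =
      ((∑ y ∈ D, Real.exp (-c * dist x y ^ 2 / s ^ 2)) * (v * (s ^ α / 3 ^ α))) *
        3 ^ α / s ^ α := by
    field_simp
  rw [e, div_le_iff₀ hsα]
  calc _ ≤ (Real.exp c * (C * s ^ α)) * 3 ^ α := by gcongr
    _ = _ := by ring

end Geometry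

/-! ### Completeness of the system -/

section Completeness

variable {M : Type*} [MetricSpace M] [CompactSpace M] [MeasurableSpace M] [BorelSpace M]
  {μ : Measure M} [IsProbabilityMeasure μ] {φ : ℕ → M → ℝ} {ℓ : ℕ → ℝ} {α : ℝ}

lemma eLpNorm_integral_ker_le (h : IsHeatSystem μ φ ℓ α) {m : ℕ → ℝ} (hm : Adm φ m) {C : ℝ}
    (hC : 0 < C) (hrow : ∀ x, ∫⁻ y, ‖ker φ m x y‖ₑ ∂μ ≤ ENNReal.ofReal C) {p : ℝ≥0∞} (hp : 1 ≤ p)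
    {f : M → ℝ} (hf : AEStronglyMeasurable f μ) :
    eLpNorm (fun x => ∫ y, ker φ m x y * f y ∂μ) p μ ≤ ENNReal.ofReal C * eLpNorm f p μ := by
  have h1 := eLpNorm_integral_mul_le (k := ker φ m) (continuous_ker h hm).measurable hC hC hrow
    (fun y => by simpa only [ker_symm m _ y] using hrow y) hp hf
  rwa [← Real.rpow_add hC, sub_add_cancel, Real.rpow_one] at h1

/-- The heat kernel is an approximate identity on continuous functions. -/
lemma exists_heat_approx (h : IsHeatSystem μ φ ℓ α) {g : M → ℝ} (hg : Continuous g) {δ : ℝ}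
    (hδ : 0 < δ) : ∃ t ∈ Ioc (0 : ℝ) 1,
      ∀ x, ‖g x - ∫ y, ker φ (heatMul ℓ t) x y * g y ∂μ‖ₑ ≤ ENNReal.ofReal δ := by
  obtain ⟨c₁, c, hc₁, hc, hK⟩ := abs_heatKernel_le h
  obtain ⟨C, hC, hG⟩ := lintegral_gaussian_le h.ball (half_pos hc)
  have hu := CompactSpace.uniformContinuous_of_continuous hg
  obtain ⟨η, hη, hgη⟩ := Metric.uniformContinuous_iff.1 hu (δ / (2 * (c₁ * C))) (by positivity)
  set B := supNorm g with hB
  have hB0 : 0 ≤ B := supNorm_nonneg g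
  set Q : ℝ := 2 * B / η ^ 2 * (2 / c) with hQ
  have hQ0 : 0 ≤ Q := by positivity
  set t : ℝ := min 1 (δ / (2 * (c₁ * C) * (Q + 1))) with ht
  have ht0 : 0 < t := by positivity
  have ht1 : t ∈ Ioc (0 : ℝ) 1 := ⟨ht0, min_le_left _ _⟩
  have htQ : Q * t ≤ δ / (2 * (c₁ * C)) := by
    have h1 : t ≤ δ / (2 * (c₁ * C) * (Q + 1)) := min_le_right _ _
    rw [le_div_iff₀ (by positivity)] at h1 ⊢
    have : 0 ≤ t * (2 * (c₁ * C)) := by positivity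
    nlinarith
  refine ⟨t, ht1, fun x => ?_⟩
  have hA := adm_heatMul h ht0
  have hosc : ∀ y, |g x - g y| ≤ δ / (2 * (c₁ * C)) + 2 * B / η ^ 2 * dist x y ^ 2 := by
    intro y
    rcases lt_or_ge (dist x y) η with h1 | h1
    · have h2 := (hgη h1).le
      rw [Real.dist_eq] at h2
      have : 0 ≤ 2 * B / η ^ 2 * dist x y ^ 2 := by positivity
      linarith
    · have h2 := abs_le_supNorm hg x
      have h3 := abs_le_supNorm hg y
      have h4 : |g x - g y| ≤ 2 * B := (abs_sub _ _).trans (by linarith)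
      have h5 : 2 * B ≤ 2 * B / η ^ 2 * dist x y ^ 2 := by
        rw [div_mul_eq_mul_div, le_div_iff₀ (by positivity)]
        have : η ^ 2 ≤ dist x y ^ 2 := by gcongr
        gcongr
      have : 0 < δ / (2 * (c₁ * C)) := by positivity
      linarith
  have hrep : g x - ∫ y, ker φ (heatMul ℓ t) x y * g y ∂μ =
      ∫ y, ker φ (heatMul ℓ t) x y * (g x - g y) ∂μ := by
    have h1 := (h.int t ht1 x).2
    rw [heatKernel_eq_ker] at h1
    have hc1 := continuous_ker_right h hA x
    simp_rw [mul_sub]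
    rw [integral_sub (integrable_of_continuous (by fun_prop))
      (integrable_of_continuous (by fun_prop)), integral_mul_const, h1, one_mul]
  rw [hrep]
  calc _ ≤ ∫⁻ y, ‖ker φ (heatMul ℓ t) x y * (g x - g y)‖ₑ ∂μ :=
        enorm_integral_le_lintegral_enorm _
    _ ≤ ∫⁻ y, ENNReal.ofReal (c₁ * t ^ (-α / 2) * (δ / (c₁ * C))) *
          ENNReal.ofReal (Real.exp (-(c / 2) * dist x y ^ 2 / t)) ∂μ := by
        refine lintegral_mono fun y => ?_
        rw [← ENNReal.ofReal_mul (by positivity), Real.enorm_eq_ofReal_abs, abs_mul]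
        refine ENNReal.ofReal_le_ofReal ?_
        set u : ℝ := c / 2 * dist x y ^ 2 / t with hu
        have hu0 : 0 ≤ u := by positivity
        have e1 : -c * dist x y ^ 2 / t = -u + -u := by rw [hu]; ring
        have e2 : -(c / 2) * dist x y ^ 2 / t = -u := by rw [hu]; ring
        have e3 : 2 * B / η ^ 2 * dist x y ^ 2 = Q * t * u := by
          rw [hQ, hu]
          field_simp
        have h1 := hK t ht1 x y
        rw [e1, Real.exp_add] at h1
        have h2 := hosc y
        rw [e3] at h2
        rw [e2]
        have h3 : Real.exp (-u) * (1 + u) ≤ 1 := by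
          rw [Real.exp_neg, inv_mul_le_iff₀ (Real.exp_pos _), mul_one, add_comm]
          exact Real.add_one_le_exp u
        have h4 : |g x - g y| ≤ δ / (2 * (c₁ * C)) * (1 + u) := by
          have : Q * t * u ≤ δ / (2 * (c₁ * C)) * u := by gcongr
          linarith
        have hq : 0 < δ / (2 * (c₁ * C)) := by positivity
        calc _ ≤ (c₁ * t ^ (-α / 2) * (Real.exp (-u) * Real.exp (-u))) *
              (δ / (2 * (c₁ * C)) * (1 + u)) := by gcongr
          _ = c₁ * t ^ (-α / 2) * (δ / (2 * (c₁ * C))) * Real.exp (-u) *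
              (Real.exp (-u) * (1 + u)) := by ring
          _ ≤ c₁ * t ^ (-α / 2) * (δ / (2 * (c₁ * C))) * Real.exp (-u) * 1 := by gcongr
          _ ≤ _ := by
            have hq' : δ / (2 * (c₁ * C)) ≤ δ / (c₁ * C) := by
              have : 0 < c₁ * C := by positivity
              exact div_le_div_of_nonneg_left hδ.le this (by linarith)
            have hE : 0 ≤ c₁ * t ^ (-α / 2) := by positivity
            rw [mul_one]
            exact mul_le_mul_of_nonneg_right (mul_le_mul_of_nonneg_left hq' hE) (Real.exp_pos _).le
    _ ≤ ENNReal.ofReal (c₁ * t ^ (-α / 2) * (δ / (c₁ * C))) * ENNReal.ofReal (C * t ^ (α / 2)) := by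
        rw [lintegral_const_mul' _ _ ENNReal.ofReal_ne_top]
        gcongr
        exact hG t ht0 x
    _ = ENNReal.ofReal δ := by
        rw [← ENNReal.ofReal_mul (by positivity)]
        congr 1
        have : t ^ (-α / 2) * t ^ (α / 2) = 1 := by
          rw [← Real.rpow_add ht0]
          simp [neg_div]
        calc _ = c₁ * C * (δ / (c₁ * C)) * (t ^ (-α / 2) * t ^ (α / 2)) := by ring
          _ = _ := by
            rw [this]
            field_simp

/-- An integrable function is determined by its coefficients: if they vanish, then so do all heat
means of the function, which is close to a continuous function reproduced by the heat kernel. -/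
lemma ae_eq_zero_of_coeff_eq_zero (h : IsHeatSystem μ φ ℓ α) {f : M → ℝ} (hf : Integrable f μ)
    (h0 : ∀ k, ∫ x, f x * φ k x ∂μ = 0) : f =ᵐ[μ] 0 := by
  obtain ⟨C, hC, hrow⟩ := lintegral_ker_heatMul_le h
  have hKf : ∀ t : ℝ, 0 < t → ∀ x, ∫ y, ker φ (heatMul ℓ t) x y * f y ∂μ = 0 := fun t ht x => by
    have := hasSum_integral_ker_mul h (adm_heatMul h ht) hf x
    simp only [h0, mul_zero] at this
    exact this.unique hasSum_zero
  have hle : ∀ ε : ℝ, 0 < ε → eLpNorm f 1 μ ≤ ENNReal.ofReal ((2 + C) * ε) := by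
    intro ε hε
    obtain ⟨g', hg, hgm⟩ := (memLp_one_iff_integrable.2 hf).exists_boundedContinuous_eLpNorm_sub_le
      ENNReal.one_ne_top (ε := ENNReal.ofReal ε) (by simpa using hε)
    set g : M → ℝ := ⇑g'
    have hgc : Continuous g := g'.continuous
    have hgi : Integrable g μ := integrable_of_continuous hgc
    obtain ⟨t, ht, happ⟩ := exists_heat_approx h hgc hε
    have hA := adm_heatMul h ht.1
    have hc := fun x => continuous_ker_right h hA x
    have hid : f = (f - g) + ((fun x => g x - ∫ y, ker φ (heatMul ℓ t) x y * g y ∂μ) +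
        fun x => ∫ y, ker φ (heatMul ℓ t) x y * (g - f) y ∂μ) := by
      funext x
      have hi : ∀ {u : M → ℝ}, Integrable u μ →
          Integrable (fun y => ker φ (heatMul ℓ t) x y * u y) μ := fun {u} hu =>
        hu.bdd_mul (c := supNorm (ker φ (heatMul ℓ t) x)) (hc x).aestronglyMeasurable
          (Eventually.of_forall fun y => abs_le_supNorm (hc x) y)
      simp only [Pi.add_apply, Pi.sub_apply, mul_sub]
      rw [integral_sub (hi hgi) (hi hf), hKf t ht.1 x]
      ring
    have hm1 : AEStronglyMeasurable (f - g) μ := hf.1.sub hgi.1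
    have hact : ∀ {u : M → ℝ}, Integrable u μ →
        AEStronglyMeasurable (fun x => ∫ y, ker φ (heatMul ℓ t) x y * u y ∂μ) μ := fun {u} hu => by
      have := ((continuous_ker h hA).aestronglyMeasurable (μ := μ.prod μ)).mul
        (hu.1.comp_snd (μ := μ))
      exact this.integral_prod_right'
    have e1 : eLpNorm (fun x => g x - ∫ y, ker φ (heatMul ℓ t) x y * g y ∂μ) 1 μ ≤
        ENNReal.ofReal ε := by
      rw [eLpNorm_one_eq_lintegral_enorm]
      calc _ ≤ ∫⁻ _, ENNReal.ofReal ε ∂μ := lintegral_mono happ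
        _ = _ := by simp
    have e2 : eLpNorm (fun x => ∫ y, ker φ (heatMul ℓ t) x y * (g - f) y ∂μ) 1 μ ≤
        ENNReal.ofReal C * ENNReal.ofReal ε := by
      refine (eLpNorm_integral_ker_le h hA hC (hrow t ht) le_rfl (hgi.1.sub hf.1)).trans ?_
      rw [eLpNorm_sub_comm]
      gcongr
    calc eLpNorm f 1 μ ≤ eLpNorm (f - g) 1 μ + (ENNReal.ofReal ε +
          ENNReal.ofReal C * ENNReal.ofReal ε) := by
          conv_lhs => rw [hid]
          have hm2 := hgi.1.sub (hact hgi)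
          have hm3 := hact (hgi.sub hf)
          refine (eLpNorm_add_le hm1 (hm2.add hm3) le_rfl).trans ?_
          gcongr
          exact (eLpNorm_add_le hm2 hm3 le_rfl).trans (add_le_add e1 e2)
      _ ≤ ENNReal.ofReal ε + (ENNReal.ofReal ε + ENNReal.ofReal C * ENNReal.ofReal ε) := by
          gcongr
      _ = _ := by
          rw [← ENNReal.ofReal_mul hC.le, ← ENNReal.ofReal_add hε.le (by positivity),
            ← ENNReal.ofReal_add hε.le (by positivity)]
          congr 1
          ring
  have hz : eLpNorm f 1 μ = 0 := by
    have hlim : Tendsto (fun ε : ℝ => ENNReal.ofReal ((2 + C) * ε)) (𝓝[>] 0) (𝓝 0) := by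
      have : Tendsto (fun ε : ℝ => ENNReal.ofReal ((2 + C) * ε)) (𝓝 0)
          (𝓝 (ENNReal.ofReal ((2 + C) * 0))) :=
        (ENNReal.continuous_ofReal.comp (by fun_prop)).tendsto 0
      rw [mul_zero, ENNReal.ofReal_zero] at this
      exact this.mono_left nhdsWithin_le_nhds
    refine le_antisymm (ge_of_tendsto hlim ?_) bot_le
    filter_upwards [self_mem_nhdsWithin] with ε hε using hle ε hε
  exact (eLpNorm_eq_zero_iff hf.1 one_ne_zero).1 hz

lemma ae_eq_of_coeff_eq (h : IsHeatSystem μ φ ℓ α) {f g : M → ℝ} (hf : Integrable f μ)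
    (hg : Integrable g μ) (hfg : ∀ k, ∫ x, f x * φ k x ∂μ = ∫ x, g x * φ k x ∂μ) : f =ᵐ[μ] g := by
  have hi : ∀ {u : M → ℝ}, Integrable u μ → ∀ k, Integrable (fun y => u y * φ k y) μ :=
    fun {u} hu k => hu.mul_bdd (c := supNorm (φ k)) (h.sys.continuous k).aestronglyMeasurable
      (Eventually.of_forall fun y => abs_le_supNorm (h.sys.continuous k) y)
  have := ae_eq_zero_of_coeff_eq_zero h (hf.sub hg) fun k => by
    simp only [Pi.sub_apply, sub_mul]
    rw [integral_sub (hi hf k) (hi hg k), hfg, sub_self]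
  filter_upwards [this] with x hx
  exact sub_eq_zero.1 hx

/-- A series of diffusion polynomials that converges absolutely in `L^p` sums to an element of
`X^p`, whose coefficients are the limits of the coefficients of the partial sums. -/
lemma exists_memX_of_tsum_ne_top (h : IsHeatSystem μ φ ℓ α) {p : ℝ≥0∞} (hp : 1 ≤ p)
    {u : ℕ → M → ℝ} (hu : ∀ n, Continuous (u n)) (hsum : ∑' n, eLpNorm (u n) p μ ≠ ⊤)
    (hpoly : ∀ m, ∑ n ∈ Finset.range m, u n ∈ allDiffusionPoly φ ℓ) {v : ℕ → ℝ}
    (hv : ∀ k, ∀ᶠ m in atTop, ∫ x, (∑ n ∈ Finset.range m, u n) x * φ k x ∂μ = v k) :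
    ∃ g : M → ℝ, MemX μ φ ℓ p g ∧ Integrable g μ ∧ eLpNorm g p μ ≤ ∑' n, eLpNorm (u n) p μ ∧
      ∀ k, ∫ x, g x * φ k x ∂μ = v k := by
  have hfact : Fact (1 ≤ p) := ⟨hp⟩
  have huL : ∀ n, MemLp (u n) p μ := fun n =>
    MemLp.of_bound (hu n).aestronglyMeasurable (supNorm (u n))
      (Eventually.of_forall fun x => abs_le_supNorm (hu n) x)
  let F : ℕ → Lp ℝ p μ := fun n => (huL n).toLp (u n)
  have hFn : ∀ n, ‖F n‖ₑ = eLpNorm (u n) p μ := fun n => Lp.enorm_toLp (huL n)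
  have hFs : Summable F := by
    refine Summable.of_norm ?_
    have : ∀ n, ‖F n‖ = (eLpNorm (u n) p μ).toReal := fun n => by rw [← hFn, toReal_enorm]
    simp_rw [this]
    exact ENNReal.summable_toReal hsum
  set G : Lp ℝ p μ := ∑' n, F n with hG
  have hGL : MemLp (G : M → ℝ) p μ := Lp.memLp G
  have hpart : ∀ m, ((∑ n ∈ Finset.range m, F n : Lp ℝ p μ) : M → ℝ) =ᵐ[μ]
      ∑ n ∈ Finset.range m, u n := by
    intro m
    induction m with
    | zero => simpa using Lp.coeFn_zero ℝ p μ
    | succ m ih =>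
      rw [Finset.sum_range_succ, Finset.sum_range_succ]
      exact (Lp.coeFn_add _ _).trans (ih.add (huL m).coeFn_toLp)
  have hdiff : ∀ m, eLpNorm ((G : M → ℝ) - ∑ n ∈ Finset.range m, u n) p μ =
      ‖G - ∑ n ∈ Finset.range m, F n‖ₑ := by
    intro m
    rw [Lp.enorm_def]
    refine eLpNorm_congr_ae ?_
    filter_upwards [Lp.coeFn_sub G (∑ n ∈ Finset.range m, F n), hpart m] with x h1 h2
    rw [h1, Pi.sub_apply, Pi.sub_apply, h2]
  have hlim : Tendsto (fun m => eLpNorm ((G : M → ℝ) - ∑ n ∈ Finset.range m, u n) p μ) atTop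
      (𝓝 0) := by
    simp_rw [hdiff]
    have h1 := (tendsto_const_nhds (x := G)).sub hFs.hasSum.tendsto_sum_nat
    rw [sub_self] at h1
    simpa using h1.enorm
  have hGi : Integrable (G : M → ℝ) μ := hGL.integrable hp
  refine ⟨G, ⟨hGL, ?_⟩, hGi, ?_, fun k => ?_⟩
  · refine le_antisymm (ge_of_tendsto' hlim fun m => ?_) bot_le
    exact iInf₂_le _ (hpoly m)
  · rw [← Lp.enorm_def]
    refine enorm_tsum_le_tsum_enorm.trans (le_of_eq (tsum_congr hFn))
  · have hc : ∀ m, Continuous (∑ n ∈ Finset.range m, u n) := fun m =>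
      by rw [Finset.sum_fn]; exact continuous_finsetSum _ fun n _ => hu n
    have hle : ∀ᶠ m in atTop, ‖∫ x, (G : M → ℝ) x * φ k x ∂μ - v k‖ₑ ≤
        eLpNorm ((G : M → ℝ) - ∑ n ∈ Finset.range m, u n) p μ * ENNReal.ofReal (supNorm (φ k)) := by
      filter_upwards [hv k] with m hm
      have hi : ∀ {w : M → ℝ}, Integrable w μ → Integrable (fun y => w y * φ k y) μ :=
        fun {w} hw => hw.mul_bdd (c := supNorm (φ k)) (h.sys.continuous k).aestronglyMeasurable
          (Eventually.of_forall fun y => abs_le_supNorm (h.sys.continuous k) y)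
      rw [← hm, ← integral_sub (hi hGi) (hi (integrable_of_continuous (hc m)))]
      calc _ ≤ ∫⁻ x, ‖(G : M → ℝ) x * φ k x - (∑ n ∈ Finset.range m, u n) x * φ k x‖ₑ ∂μ :=
            enorm_integral_le_lintegral_enorm _
        _ ≤ ∫⁻ x, ‖((G : M → ℝ) - ∑ n ∈ Finset.range m, u n) x‖ₑ *
              ENNReal.ofReal (supNorm (φ k)) ∂μ := by
            refine lintegral_mono fun x => ?_
            rw [← sub_mul, enorm_mul, Pi.sub_apply]
            gcongr
            rw [Real.enorm_eq_ofReal_abs]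
            exact ENNReal.ofReal_le_ofReal (abs_le_supNorm (h.sys.continuous k) x)
        _ = eLpNorm ((G : M → ℝ) - ∑ n ∈ Finset.range m, u n) 1 μ *
              ENNReal.ofReal (supNorm (φ k)) := by
            rw [lintegral_mul_const' _ _ ENNReal.ofReal_ne_top, eLpNorm_one_eq_lintegral_enorm]
        _ ≤ _ := by
            gcongr
            exact eLpNorm_le_eLpNorm_of_exponent_le hp
              (hGL.1.sub (hc m).aestronglyMeasurable)
    have hz : Tendsto (fun m => eLpNorm ((G : M → ℝ) - ∑ n ∈ Finset.range m, u n) p μ *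
        ENNReal.ofReal (supNorm (φ k))) atTop (𝓝 0) := by
      simpa using ENNReal.Tendsto.mul_const hlim (Or.inr ENNReal.ofReal_ne_top)
    have h0 : ‖∫ x, (G : M → ℝ) x * φ k x ∂μ - v k‖ₑ = 0 :=
      le_antisymm (ge_of_tendsto hz hle) bot_le
    exact sub_eq_zero.1 (enorm_eq_zero.1 h0)

end Completeness

/-! ### Dyadic frequency pieces -/

/-- A smooth cut-off, equal to `1` for `u ≤ 1` and to `0` for `u ≥ 2`. -/
noncomputable def cutoff (u : ℝ) : ℝ := Real.smoothTransition (2 - u)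

/-- The smooth dyadic bump `cutoff u - cutoff (4 u)`, supported in `[1/4, 2]`. -/
noncomputable def bump (u : ℝ) : ℝ := cutoff u - cutoff (4 * u)

/-- The low-pass filter to frequencies `l` at most of the order of `2 ^ m / 2`; it is zero
for `m = 0`. -/
noncomputable def lowPass : ℕ → ℝ → ℝ
  | 0, _ => 0
  | m + 1, l => cutoff (l ^ 2 / ((2 : ℝ) ^ m) ^ 2)

/-- The `n`-th dyadic frequency piece: all frequencies up to about `1` for `n = 0`, and those
comparable to `2 ^ n` for `n > 0`. -/
noncomputable def piece (n : ℕ) (l : ℝ) : ℝ := lowPass (n + 1) l - lowPass n l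

lemma contDiff_cutoff : ContDiff ℝ ∞ cutoff :=
  Real.smoothTransition.contDiff.comp (contDiff_const.sub contDiff_id)

lemma cutoff_eq_one {u : ℝ} (hu : u ≤ 1) : cutoff u = 1 :=
  Real.smoothTransition.one_of_one_le (by linarith)

lemma cutoff_eq_zero {u : ℝ} (hu : 2 ≤ u) : cutoff u = 0 :=
  Real.smoothTransition.zero_of_nonpos (by linarith)

lemma contDiff_bump : ContDiff ℝ ∞ bump :=
  contDiff_cutoff.sub (contDiff_cutoff.comp (contDiff_const.mul contDiff_id))

lemma bump_eq_zero {u : ℝ} (hu : u ∉ Icc (1 / 4 : ℝ) 2) : bump u = 0 := by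
  rcases lt_or_ge u (1 / 4) with h | h
  · rw [bump, cutoff_eq_one (by linarith), cutoff_eq_one (by linarith), sub_self]
  · have : 2 < u := by
      by_contra hcon
      exact hu ⟨h, not_lt.1 hcon⟩
    rw [bump, cutoff_eq_zero this.le, cutoff_eq_zero (by linarith), sub_self]

lemma sum_piece (m : ℕ) (l : ℝ) : ∑ n ∈ Finset.range m, piece n l = lowPass m l := by
  simp only [piece]
  rw [Finset.sum_range_sub (fun n => lowPass n l)]
  simp [lowPass]

lemma piece_zero (l : ℝ) : piece 0 l = cutoff (l ^ 2) := by simp [piece, lowPass]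

lemma piece_of_pos {n : ℕ} (hn : 0 < n) (l : ℝ) : piece n l = bump (l ^ 2 / ((2 : ℝ) ^ n) ^ 2) := by
  obtain ⟨k, rfl⟩ := Nat.exists_eq_succ_of_ne_zero hn.ne'
  simp only [piece, lowPass, bump, Nat.succ_eq_add_one]
  congr 2
  rw [pow_succ]
  field_simp
  ring

lemma abs_piece_zero_le (l : ℝ) : |piece 0 l| ≤ 1 := by
  rw [piece_zero, cutoff, abs_of_nonneg (Real.smoothTransition.nonneg _)]
  exact Real.smoothTransition.le_one _

lemma lowPass_eq_zero {m : ℕ} {l : ℝ} (hl : (2 : ℝ) ^ (m + 1) < l) : lowPass m l = 0 := by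
  cases m with
  | zero => rfl
  | succ m =>
    refine cutoff_eq_zero ?_
    rw [le_div_iff₀ (by positivity)]
    have h1 : (2 : ℝ) ^ (m + 1) ≤ 2 ^ (m + 1 + 1) := pow_le_pow_right₀ (by norm_num) (by omega)
    have h2 : ((2 : ℝ) ^ (m + 1)) ^ 2 ≤ l ^ 2 := by
      have := h1.trans hl.le
      gcongr
    rw [pow_succ (2 : ℝ) m] at h2
    nlinarith [sq_nonneg ((2 : ℝ) ^ m)]

lemma piece_eq_zero {n : ℕ} {l : ℝ} (hl : (2 : ℝ) ^ (n + 2) < l) : piece n l = 0 := by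
  rw [piece, lowPass_eq_zero hl, lowPass_eq_zero, sub_zero]
  exact (pow_le_pow_right₀ (by norm_num) (by omega)).trans_lt hl

lemma eventually_lowPass_eq_one (l : ℝ) : ∀ᶠ m in atTop, lowPass m l = 1 := by
  obtain ⟨k, hk⟩ := pow_unbounded_of_one_lt |l| (by norm_num : (1 : ℝ) < 2)
  filter_upwards [eventually_ge_atTop (k + 1)] with m hm
  obtain ⟨i, rfl⟩ := Nat.exists_eq_add_of_le hm
  rw [show k + 1 + i = (k + i) + 1 by ring]
  refine cutoff_eq_one ?_
  rw [div_le_one (by positivity), sq_le_sq, abs_of_pos (by positivity : (0 : ℝ) < 2 ^ (k + i))]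
  exact hk.le.trans (pow_le_pow_right₀ (by norm_num) (by omega))

/-- Products of a function supported in `[1/4, 2]` with a function smooth away from `0` are
smooth. -/
lemma contDiff_bump_mul {g : ℝ → ℝ} (hg : ∀ u, u ≠ 0 → ContDiffAt ℝ ∞ g u) :
    ContDiff ℝ ∞ fun u => bump u * g u := by
  rw [contDiff_iff_contDiffAt]
  intro u
  rcases eq_or_ne u 0 with rfl | hu
  · have : (fun u => bump u * g u) =ᶠ[𝓝 0] fun _ => 0 := by
      filter_upwards [Iio_mem_nhds (show (0 : ℝ) < 1 / 4 by norm_num)] with v hv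
      rw [bump_eq_zero fun h => absurd h.1 (not_le.2 hv), zero_mul]
    exact contDiffAt_const.congr_of_eventuallyEq this
  · exact contDiff_bump.contDiffAt.mul (hg u hu)

section Pieces

variable {M : Type*} [MetricSpace M] [CompactSpace M] [MeasurableSpace M] [BorelSpace M]
  {μ : Measure M} [IsProbabilityMeasure μ] {φ : ℕ → M → ℝ} {ℓ : ℕ → ℝ} {α : ℝ}

lemma adm_piece_mul (h : IsHeatSystem μ φ ℓ α) (n : ℕ) (m : ℕ → ℝ) :
    Adm φ (fun j => piece n (ℓ j) * m j) :=
  adm_of_eventually_zero h (L := (2 : ℝ) ^ (n + 2)) fun j hj => by rw [piece_eq_zero hj, zero_mul]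

/-- Below frequency `2` there are only finitely many `φ_j`, so that no smoothness of the multiplier
is needed there. -/
lemma lintegral_ker_le_of_low (h : IsHeatSystem μ φ ℓ α) (w : ℕ → ℝ) :
    ∃ C : ℝ, 0 < C ∧ ∀ m : ℕ → ℝ, (∀ j, 2 < ℓ j → m j = 0) → ∀ A : ℝ, 0 < A →
      (∀ j, |m j| ≤ A * |w j|) → ∀ x, ∫⁻ y, ‖ker φ m x y‖ₑ ∂μ ≤ ENNReal.ofReal (C * A) := by
  set J := (finite_ell_le h 2).toFinset with hJ
  refine ⟨∑ j ∈ J, |w j| * supNorm (φ j) ^ 2 + 1, by positivity, fun m hm A hA hmA x => ?_⟩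
  have hz : ∀ j ∉ J, m j = 0 := fun j hj => hm j (by simpa [hJ] using hj)
  have hpt : ∀ y, ‖ker φ m x y‖ₑ ≤
      ENNReal.ofReal ((∑ j ∈ J, |w j| * supNorm (φ j) ^ 2 + 1) * A) := by
    intro y
    rw [Real.enorm_eq_ofReal_abs]
    refine ENNReal.ofReal_le_ofReal ?_
    rw [ker, tsum_eq_sum (s := J) fun j hj => by rw [hz j hj, zero_mul, zero_mul]]
    calc _ ≤ ∑ j ∈ J, |m j * φ j x * φ j y| := Finset.abs_sum_le_sum_abs _ _
      _ ≤ ∑ j ∈ J, (|w j| * supNorm (φ j) ^ 2) * A := by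
          refine Finset.sum_le_sum fun j _ => (norm_ker_term_le h m x y j).trans ?_
          calc |m j| * supNorm (φ j) ^ 2 ≤ (A * |w j|) * supNorm (φ j) ^ 2 := by
                gcongr
                exact hmA j
            _ = _ := by ring
      _ ≤ _ := by
          rw [← Finset.sum_mul, add_mul]
          linarith
  calc _ ≤ ∫⁻ _, _ ∂μ := lintegral_mono hpt
    _ = _ := by simp

/-- The multiplier theorem for families of multipliers `e i n` localized to the dyadic pieces; the
positive factors `A i n` are to be optimized in applications. -/
lemma lintegral_ker_piece_le (h : IsHeatSystem μ φ ℓ α) {S : ℕ} (hS : α < S) {Y : ℝ → ℝ}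
    (hY : ContDiff ℝ ∞ Y) (hY0 : ∀ u ∉ Icc (1 / 4 : ℝ) 2, Y u = 0) {ι : Type*} {F : ι → ℝ → ℝ}
    (hF : UniformCk univ S F) (γ : ℝ) {e : ι → ℕ → ℕ → ℝ} {A : ι → ℕ → ℝ} (hA : ∀ i n, 0 < A i n)
    {w : ℕ → ℝ} (he0 : ∀ i j, 2 < ℓ j → e i 0 j = 0) (hew : ∀ i j, |e i 0 j| ≤ A i 0 * |w j|)
    (he : ∀ i n, 0 < n → ∀ j, e i n j = A i n * (Y (ℓ j ^ 2 / ((2 : ℝ) ^ n) ^ 2) * (1 + ℓ j) ^ γ *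
      F i (Real.log (ℓ j)))) :
    ∃ C : ℝ, 0 < C ∧ ∀ i n x, ∫⁻ y, ‖ker φ (e i n) x y‖ₑ ∂μ ≤
      ENNReal.ofReal (C * (A i n * ((2 : ℝ) ^ n) ^ γ)) := by
  obtain ⟨C₀, hC₀, h0⟩ := lintegral_ker_le_of_low h w
  obtain ⟨C₁, hC₁, h1⟩ := lintegral_ker_multiplier_le h hS hY hY0 hF γ
  refine ⟨max C₀ C₁, by positivity, fun i n x => ?_⟩
  have hAn := hA i n
  rcases Nat.eq_zero_or_pos n with rfl | hn
  · refine (h0 (e i 0) (he0 i) (A i 0) hAn (hew i) x).trans (ENNReal.ofReal_le_ofReal ?_)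
    rw [pow_zero, Real.one_rpow, mul_one]
    gcongr
    exact le_max_left _ _
  · have hk : ∀ y, ker φ (e i n) x y = A i n * ker φ (fun j =>
        Y (ℓ j ^ 2 / ((2 : ℝ) ^ n) ^ 2) * (1 + ℓ j) ^ γ * F i (Real.log (ℓ j))) x y := fun y => by
      rw [ker, ker, ← tsum_mul_left]
      refine tsum_congr fun j => ?_
      rw [he i n hn j]
      ring
    simp_rw [hk, enorm_mul, Real.enorm_eq_ofReal hAn.le]
    rw [lintegral_const_mul' _ _ ENNReal.ofReal_ne_top]
    refine (mul_le_mul_right (h1 i _ (one_le_pow₀ (by norm_num)) x) _).trans ?_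
    rw [← ENNReal.ofReal_mul hAn.le]
    refine ENNReal.ofReal_le_ofReal ?_
    calc A i n * (C₁ * ((2 : ℝ) ^ n) ^ γ) = C₁ * (A i n * ((2 : ℝ) ^ n) ^ γ) := by ring
      _ ≤ _ := by
        gcongr
        exact le_max_right _ _

lemma piece_zero_eq_zero {l : ℝ} (hl : 2 < l) : piece 0 l = 0 := by
  rw [piece_zero]
  exact cutoff_eq_zero (by nlinarith)

/-- The time `4 ^ (-n)` belonging to the frequency `2 ^ n`. -/
noncomputable def dyadicTime (n : ℕ) : ℝ := (((2 : ℝ) ^ n) ^ 2)⁻¹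

lemma dyadicTime_mem (n : ℕ) : dyadicTime n ∈ Ioc (0 : ℝ) 1 :=
  ⟨by rw [dyadicTime]; positivity,
    inv_le_one_of_one_le₀ (one_le_pow₀ (one_le_pow₀ (by norm_num)))⟩

lemma dyadicTime_rpow (n : ℕ) (α : ℝ) : dyadicTime n ^ (-α / 2) = ((2 : ℝ) ^ n) ^ α := by
  rw [dyadicTime, Real.inv_rpow (by positivity), ← Real.rpow_neg (by positivity),
    ← Real.rpow_natCast _ 2, ← Real.rpow_mul (by positivity)]
  congr 1
  push_cast
  ring

/-- Multiplication of the `n`-th frequency piece by `(1 + ℓ) ^ r`. -/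
lemma lintegral_ker_piece_rpow_le (h : IsHeatSystem μ φ ℓ α) {S : ℕ} (hS : α < S) (r : ℝ) :
    ∃ C : ℝ, 0 < C ∧ ∀ n x, ∫⁻ y, ‖ker φ (fun j => piece n (ℓ j) * (1 + ℓ j) ^ r) x y‖ₑ ∂μ ≤
      ENNReal.ofReal (C * ((2 : ℝ) ^ n) ^ r) := by
  have hF : UniformCk univ S (fun _ : Unit => fun _ : ℝ => (1 : ℝ)) :=
    .const (fun _ => 1) (fun _ => le_rfl)
  obtain ⟨C, hC, h1⟩ := lintegral_ker_piece_le h hS contDiff_bump (fun u hu => bump_eq_zero hu) hF r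
    (e := fun _ n j => piece n (ℓ j) * (1 + ℓ j) ^ r) (A := fun _ _ => 1) (fun _ _ => one_pos)
    (w := fun j => (1 + ℓ j) ^ r)
    (fun _ j hj => by rw [piece_zero_eq_zero hj, zero_mul])
    (fun _ j => by
      rw [abs_mul]
      gcongr
      exact abs_piece_zero_le _)
    (fun _ n hn j => by rw [piece_of_pos hn]; ring)
  exact ⟨C, hC, fun n x => by simpa using h1 () n x⟩

section Mask

variable {S : ℕ} {β : ℝ} {b : ℝ → ℝ}

lemma IsMask.pos (hb : IsMask S β b) {l : ℝ} (hl : 0 ≤ l) : 0 < b l := by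
  obtain ⟨-, hcont, F, -, hF, -, m, hm, hmF⟩ := hb
  rcases hl.eq_or_lt with rfl | hl
  · -- the value at `0` is the limit of values bounded below
    have h1 : Tendsto b (𝓝[>] 0) (𝓝 (b 0)) := hcont.continuous.continuousWithinAt
    have h2 : Tendsto (fun t : ℝ => (1 + t) ^ (-β) * m) (𝓝[>] 0) (𝓝 ((1 + 0 : ℝ) ^ (-β) * m)) := by
      refine Tendsto.mono_left ?_ nhdsWithin_le_nhds
      refine ContinuousAt.tendsto (f := fun t : ℝ => (1 + t) ^ (-β) * m) ?_
      exact (ContinuousAt.rpow_const (by fun_prop) (Or.inl (by norm_num))).mul continuousAt_const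
    refine lt_of_lt_of_le ?_ (le_of_tendsto_of_tendsto h2 h1 ?_)
    · simpa using hm
    · filter_upwards [self_mem_nhdsWithin] with t ht
      have ht0 : (0 : ℝ) < t := ht
      rw [hF t ht0]
      have := hmF (Real.log t)
      gcongr
  · rw [hF l hl]
    have := hm.trans_le (hmF (Real.log l))
    positivity

/-- The `n`-th frequency piece of `(1 + ℓ) ^ r b(ℓ)`, divided by the heat multiplier at time
`4 ^ (-n)`. -/
lemma lintegral_ker_piece_mask_le (h : IsHeatSystem μ φ ℓ α) (hS : α < S) (hb : IsMask S β b)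
    (r : ℝ) : ∃ C : ℝ, 0 < C ∧ ∀ n x, ∫⁻ y, ‖ker φ (fun j => piece n (ℓ j) *
      ((1 + ℓ j) ^ r * b (ℓ j) * Real.exp (ℓ j ^ 2 * dyadicTime n))) x y‖ₑ ∂μ ≤
      ENNReal.ofReal (C * ((2 : ℝ) ^ n) ^ (r - β)) := by
  obtain ⟨-, hcont, F, hFc, hF, ⟨B, hB⟩, -⟩ := hb
  have hFu : UniformCk univ S (fun _ : Unit => F) := .of_iteratedDeriv hFc hB
  obtain ⟨C, hC, h1⟩ := lintegral_ker_piece_le h hS (Y := fun u => bump u * Real.exp u)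
    (contDiff_bump.mul Real.contDiff_exp) (fun u hu => by simp [bump_eq_zero hu]) hFu (r - β)
    (e := fun _ n j => piece n (ℓ j) *
      ((1 + ℓ j) ^ r * b (ℓ j) * Real.exp (ℓ j ^ 2 * dyadicTime n)))
    (A := fun _ _ => 1) (fun _ _ => one_pos)
    (w := fun j => (1 + ℓ j) ^ r * b (ℓ j) * Real.exp (ℓ j ^ 2 * dyadicTime 0))
    (fun _ j hj => by rw [piece_zero_eq_zero hj, zero_mul])
    (fun _ j => by
      rw [abs_mul]
      gcongr
      exact abs_piece_zero_le _)
    (fun _ n hn j => by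
      rw [piece_of_pos hn, dyadicTime, ← div_eq_mul_inv]
      rcases (ell_nonneg h j).eq_or_lt with h0 | h0
      · rw [← h0, zero_pow two_ne_zero, zero_div, bump_eq_zero (by norm_num)]
        ring
      · rw [hF _ h0, sub_eq_add_neg, Real.rpow_add (by linarith)]
        ring)
  exact ⟨C, hC, fun n x => by simpa using h1 () n x⟩

/-- The `n`-th frequency piece of the multiplier that turns `∑_y a_y G(·, y)` into
`∑_y a_y K_t(·, y)`, `t = 4 ^ (-i)`. The power `κ` is free: the Gaussian is at most a multiple of
`(ℓ² t) ^ (-κ)`. -/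
lemma lintegral_ker_piece_heat_div_mask_le (h : IsHeatSystem μ φ ℓ α) (hS : α < S)
    (hb : IsMask S β b) (κ : ℕ) : ∃ C : ℝ, 0 < C ∧ ∀ i n x, ∫⁻ y, ‖ker φ (fun j => piece n (ℓ j) *
      (heatMul ℓ (dyadicTime i) j * (b (ℓ j))⁻¹)) x y‖ₑ ∂μ ≤
      ENNReal.ofReal (C * ((((2 : ℝ) ^ i / 2 ^ n) ^ 2) ^ κ * ((2 : ℝ) ^ n) ^ β)) := by
  have hbpos := fun j => hb.pos (ell_nonneg h j)
  obtain ⟨-, hcont, F, hFc, hF, ⟨B, hB⟩, m, hm, hmF⟩ := hb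
  have u1 : UniformCk univ S (fun (z : Unit × ℕ) σ => (F σ)⁻¹) :=
    (UniformCk.of_iteratedDeriv hFc hB).inv isOpen_univ hm fun _ x _ => hmF x
  have u2 := (uniformCk_logGaussian (ι := Unit) S κ).shift
    (fun i : ℕ => 1 / 2 * Real.log (dyadicTime i))
  have u3 := (u1.mul isOpen_univ u2).reindex (fun i : ℕ => ((), i))
  have hY : ContDiff ℝ ∞ fun u : ℝ => bump u * (u ^ κ)⁻¹ :=
    contDiff_bump_mul fun u hu => (contDiffAt_id.pow κ).inv (pow_ne_zero κ hu)
  obtain ⟨C, hC, h1⟩ := lintegral_ker_piece_le h hS hY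
    (fun u hu => by simp [bump_eq_zero hu]) u3 β
    (e := fun i n j => piece n (ℓ j) * (heatMul ℓ (dyadicTime i) j * (b (ℓ j))⁻¹))
    (A := fun i n => (((2 : ℝ) ^ i / 2 ^ n) ^ 2) ^ κ) (fun _ _ => by positivity)
    (w := fun j => (b (ℓ j))⁻¹)
    (fun _ j hj => by rw [piece_zero_eq_zero hj, zero_mul])
    (fun i j => by
      rw [abs_mul, abs_mul]
      have e1 : |heatMul ℓ (dyadicTime i) j| ≤ 1 := by
        rw [heatMul, abs_of_pos (Real.exp_pos _), Real.exp_le_one_iff]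
        nlinarith [sq_nonneg (ℓ j), (dyadicTime_mem i).1]
      have e2 : (1 : ℝ) ≤ (((2 : ℝ) ^ i / 2 ^ 0) ^ 2) ^ κ := by
        rw [pow_zero, div_one]
        exact one_le_pow₀ (one_le_pow₀ (one_le_pow₀ (by norm_num)))
      have e3 := abs_piece_zero_le (ℓ j)
      calc _ ≤ 1 * (1 * |(b (ℓ j))⁻¹|) := by gcongr
        _ ≤ _ := by
          rw [one_mul]
          gcongr)
    (fun i n hn j => by
      rw [piece_of_pos hn]
      rcases (ell_nonneg h j).eq_or_lt with h0 | h0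
      · rw [← h0, zero_pow two_ne_zero, zero_div, bump_eq_zero (by norm_num)]
        ring
      · have ht := (dyadicTime_mem i).1
        have e1 : 2 * (1 / 2 * Real.log (dyadicTime i) + Real.log (ℓ j)) =
            Real.log (dyadicTime i * ℓ j ^ 2) := by
          rw [Real.log_mul ht.ne' (by positivity), Real.log_pow]
          push_cast
          ring
        have e2 : logGaussian κ (1 / 2 * Real.log (dyadicTime i) + Real.log (ℓ j)) =
            (dyadicTime i * ℓ j ^ 2) ^ κ * heatMul ℓ (dyadicTime i) j := by
          rw [logGaussian, mul_right_comm, e1, Real.exp_log (by positivity), mul_comm _ (κ : ℝ),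
            Real.exp_nat_mul, Real.exp_log (by positivity), heatMul]
          congr 2
          ring
        have hFp := hm.trans_le (hmF (Real.log (ℓ j)))
        simp only
        rw [e2, hF _ h0, Real.rpow_neg (by linarith), mul_inv, inv_inv]
        have e3 : (((2 : ℝ) ^ i / 2 ^ n) ^ 2) ^ κ * ((ℓ j ^ 2 / ((2 : ℝ) ^ n) ^ 2) ^ κ)⁻¹ *
            (dyadicTime i * ℓ j ^ 2) ^ κ = 1 := by
          rw [← inv_pow, ← mul_pow, ← mul_pow, dyadicTime]
          have : ((2 : ℝ) ^ i / 2 ^ n) ^ 2 * (ℓ j ^ 2 / ((2 : ℝ) ^ n) ^ 2)⁻¹ *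
              ((((2 : ℝ) ^ i) ^ 2)⁻¹ * ℓ j ^ 2) = 1 := by
            field_simp
          rw [this, one_pow]
        calc _ = bump (ℓ j ^ 2 / ((2 : ℝ) ^ n) ^ 2) * (heatMul ℓ (dyadicTime i) j *
              ((1 + ℓ j) ^ β * (F (Real.log (ℓ j)))⁻¹)) * 1 := by ring
          _ = _ := by
            rw [← e3]
            ring)
  exact ⟨C, hC, h1⟩

end Mask

end Pieces

/-! ### Sums of kernels over finite sets -/

section Nodes

variable {M : Type*} [MeasurableSpace M] [MeasurableSingletonClass M]

/-- The counting measure of the finite set `D`, whose `L^p` norm is the `ℓ^p` norm of the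
coefficients of an eignet. -/
noncomputable def nodeMeasure (D : Finset M) : Measure M := ∑ y ∈ D, Measure.dirac y

instance (D : Finset M) : IsFiniteMeasure (nodeMeasure D) := by
  rw [nodeMeasure]
  infer_instance

lemma lintegral_nodeMeasure (D : Finset M) (f : M → ℝ≥0∞) :
    ∫⁻ y, f y ∂(nodeMeasure D) = ∑ y ∈ D, f y := by
  rw [nodeMeasure, lintegral_finsetSum_measure]
  simp

lemma integral_nodeMeasure (D : Finset M) (f : M → ℝ) :
    ∫ y, f y ∂(nodeMeasure D) = ∑ y ∈ D, f y := by
  rw [nodeMeasure, integral_finsetSum_measure fun i _ => integrable_dirac (by simp)]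
  simp

lemma aestronglyMeasurable_nodeMeasure (D : Finset M) (f : M → ℝ) :
    AEStronglyMeasurable f (nodeMeasure D) := by
  classical
  rw [nodeMeasure]
  induction D using Finset.induction_on with
  | empty => simp
  | insert y D hy ih =>
    rw [Finset.sum_insert hy, aestronglyMeasurable_add_measure_iff]
    exact ⟨aestronglyMeasurable_dirac, ih⟩

lemma ae_mem_nodeMeasure (D : Finset M) : ∀ᵐ y ∂(nodeMeasure D), y ∈ D := by
  rw [ae_iff, nodeMeasure, Measure.finsetSum_apply]
  refine Finset.sum_eq_zero fun y hy => ?_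
  rw [Measure.dirac_apply]
  simp [hy]

lemma eLpNorm_nodeMeasure_lt_top (D : Finset M) (p : ℝ≥0∞) (a : M → ℝ) :
    eLpNorm a p (nodeMeasure D) < ⊤ := by
  have : MemLp a p (nodeMeasure D) := by
    refine MemLp.of_bound (aestronglyMeasurable_nodeMeasure D a) (∑ y ∈ D, |a y|) ?_
    filter_upwards [ae_mem_nodeMeasure D] with y hy
    exact Finset.single_le_sum (f := fun y => |a y|) (fun _ _ => abs_nonneg _) hy
  exact this.2

end Nodes

/-- The linear combination `∑_{y ∈ D} a_y Φ(·, y)` of the kernel `Φ` of a multiplier. -/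
noncomputable def kerSum {M : Type*} (φ : ℕ → M → ℝ) (m : ℕ → ℝ) (D : Finset M) (a : M → ℝ)
    (x : M) : ℝ := ∑ y ∈ D, a y * ker φ m x y

section KerSum

variable {M : Type*} [MetricSpace M] [CompactSpace M] [MeasurableSpace M] [BorelSpace M]
  {μ : Measure M} [IsProbabilityMeasure μ] {φ : ℕ → M → ℝ} {ℓ : ℕ → ℝ} {α : ℝ}
  {D : Finset M} {a : M → ℝ} {p : ℝ≥0∞}

lemma continuous_kerSum (h : IsHeatSystem μ φ ℓ α) {m : ℕ → ℝ} (hm : Adm φ m) :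
    Continuous (kerSum φ m D a) :=
  continuous_finsetSum _ fun y _ => continuous_const.mul (continuous_ker_left h hm y)

lemma integral_kerSum_mul_phi (h : IsHeatSystem μ φ ℓ α) {m : ℕ → ℝ} (hm : Adm φ m) (k : ℕ) :
    ∫ x, kerSum φ m D a x * φ k x ∂μ = m k * ∑ y ∈ D, a y * φ k y := by
  simp only [kerSum, Finset.sum_mul]
  rw [integral_finsetSum _ fun y _ => ?_, Finset.mul_sum]
  · refine Finset.sum_congr rfl fun y _ => ?_
    simp_rw [mul_assoc, ker_symm m _ y]
    rw [integral_const_mul, integral_ker_mul_phi h hm]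
    ring
  · have := continuous_ker_left h hm y
    have := h.sys.continuous k
    exact integrable_of_continuous (by fun_prop)

lemma integral_ker_mul_kerSum (h : IsHeatSystem μ φ ℓ α) {m w : ℕ → ℝ} (hm : Adm φ m)
    (hw : Adm φ w) (x : M) : ∫ z, ker φ m x z * kerSum φ w D a z ∂μ =
      kerSum φ (fun j => m j * w j) D a x := by
  have hc := continuous_ker_right h hm x
  simp only [kerSum, Finset.mul_sum]
  rw [integral_finsetSum _ fun y _ => ?_]
  · refine Finset.sum_congr rfl fun y _ => ?_
    rw [← integral_ker_mul_ker h hm hw x y, ← integral_const_mul]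
    congr 1
    funext z
    ring
  · have := continuous_ker_left h hw y
    exact integrable_of_continuous (by fun_prop)

/-- A function with the coefficients of `∑_y a_y G(·, y)` is mapped by a multiplier kernel to a
kernel sum. -/
lemma integral_ker_mul_of_coeff (h : IsHeatSystem μ φ ℓ α) {m w : ℕ → ℝ} (hm : Adm φ m)
    (hmw : Adm φ fun j => m j * w j) {f : M → ℝ} (hf : Integrable f μ)
    (hfc : ∀ k, ∫ x, f x * φ k x ∂μ = w k * ∑ y ∈ D, a y * φ k y) (x : M) :
    ∫ z, ker φ m x z * f z ∂μ = kerSum φ (fun j => m j * w j) D a x := by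
  have h1 := hasSum_integral_ker_mul h hm hf x
  have h2 : HasSum (fun j => ∑ y ∈ D, a y * (m j * w j * φ j x * φ j y))
      (kerSum φ (fun j => m j * w j) D a x) :=
    hasSum_sum fun y _ => (hasSum_ker h hmw x y).mul_left (a y)
  refine h1.unique ?_
  convert! h2 using 1
  funext j
  rw [hfc, Finset.mul_sum, Finset.mul_sum]
  refine Finset.sum_congr rfl fun y _ => ?_
  ring

lemma sum_kerSum_piece (h : IsHeatSystem μ φ ℓ α) (m : ℕ → ℝ) (N : ℕ) :
    ∑ n ∈ Finset.range N, kerSum φ (fun j => piece n (ℓ j) * m j) D a =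
      kerSum φ (fun j => lowPass N (ℓ j) * m j) D a := by
  funext x
  simp only [Finset.sum_apply, kerSum]
  rw [Finset.sum_comm]
  refine Finset.sum_congr rfl fun y _ => ?_
  rw [← Finset.mul_sum]
  congr 1
  have h1 := hasSum_sum (s := Finset.range N) fun n _ => hasSum_ker h (adm_piece_mul h n m) x y
  rw [← h1.tsum_eq, ker]
  refine tsum_congr fun j => ?_
  rw [← sum_piece, Finset.sum_mul, Finset.sum_mul, Finset.sum_mul]

lemma kerSum_lowPass_mem (h : IsHeatSystem μ φ ℓ α) (m : ℕ → ℝ) (N : ℕ) :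
    kerSum φ (fun j => lowPass N (ℓ j) * m j) D a ∈ allDiffusionPoly φ ℓ := by
  refine ⟨(2 : ℝ) ^ (N + 1), by positivity, ?_⟩
  set J := (finite_ell_le h ((2 : ℝ) ^ (N + 1))).toFinset with hJ
  have hJm : ∀ j, j ∈ J ↔ ℓ j ≤ (2 : ℝ) ^ (N + 1) := fun j => by simp [hJ]
  have he : kerSum φ (fun j => lowPass N (ℓ j) * m j) D a =
      ∑ j ∈ J, (lowPass N (ℓ j) * m j * ∑ y ∈ D, a y * φ j y) • φ j := by
    funext x
    simp only [kerSum, ker, Finset.sum_apply, Pi.smul_apply, smul_eq_mul]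
    have : ∀ y, ∑' j, lowPass N (ℓ j) * m j * φ j x * φ j y =
        ∑ j ∈ J, lowPass N (ℓ j) * m j * φ j x * φ j y := fun y => by
      refine tsum_eq_sum fun j hj => ?_
      rw [hJm, not_le] at hj
      rw [lowPass_eq_zero hj]
      ring
    simp_rw [this, Finset.mul_sum, Finset.sum_mul]
    rw [Finset.sum_comm]
    refine Finset.sum_congr rfl fun j _ => Finset.sum_congr rfl fun y _ => ?_
    ring
  rw [he]
  exact Submodule.sum_mem _ fun j hj => Submodule.smul_mem _ _
    (Submodule.subset_span ⟨j, (hJm j).1 hj, rfl⟩)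

/-- If the dyadic pieces of `∑_j m_j (∑_y a_y φ_j(y)) φ_j` are summable in `L^p`, then this series
defines an element of `X^p`. -/
lemma exists_memX_of_pieces (h : IsHeatSystem μ φ ℓ α) (hp : 1 ≤ p) (m : ℕ → ℝ) (D : Finset M)
    (a : M → ℝ)
    (hsum : ∑' n, eLpNorm (kerSum φ (fun j => piece n (ℓ j) * m j) D a) p μ ≠ ⊤) :
    ∃ g : M → ℝ, MemX μ φ ℓ p g ∧ Integrable g μ ∧
      eLpNorm g p μ ≤ ∑' n, eLpNorm (kerSum φ (fun j => piece n (ℓ j) * m j) D a) p μ ∧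
      ∀ k, ∫ x, g x * φ k x ∂μ = m k * ∑ y ∈ D, a y * φ k y := by
  refine exists_memX_of_tsum_ne_top h hp (fun n => continuous_kerSum h (adm_piece_mul h n m)) hsum
    (fun N => ?_) fun k => ?_
  · rw [sum_kerSum_piece h]
    exact kerSum_lowPass_mem h m N
  · filter_upwards [eventually_lowPass_eq_one (ℓ k)] with N hN
    have hA : Adm φ (fun j => lowPass N (ℓ j) * m j) :=
      adm_of_eventually_zero h (L := (2 : ℝ) ^ (N + 1)) fun j hj => by
        rw [lowPass_eq_zero hj, zero_mul]
    rw [sum_kerSum_piece h, integral_kerSum_mul_phi h hA, hN, one_mul]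

/-- Schur's test for sums of heat kernels: `A` bounds the sums over the nodes, `B` the integrals. -/
lemma eLpNorm_kerSum_heat_le (h : IsHeatSystem μ φ ℓ α) (hp : 1 ≤ p) {t A B : ℝ} (ht : 0 < t)
    (hA0 : 0 < A) (hB0 : 0 < B) (hA : ∀ x, ∑ y ∈ D, |ker φ (heatMul ℓ t) x y| ≤ A)
    (hB : ∀ x, ∫⁻ y, ‖ker φ (heatMul ℓ t) x y‖ₑ ∂μ ≤ ENNReal.ofReal B) :
    eLpNorm (kerSum φ (heatMul ℓ t) D a) p μ ≤
      ENNReal.ofReal (A ^ (1 - (p⁻¹).toReal) * B ^ (p⁻¹).toReal) *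
        eLpNorm a p (nodeMeasure D) := by
  have h1 := eLpNorm_integral_mul_le (μ := μ) (ν := nodeMeasure D) (k := ker φ (heatMul ℓ t))
    (continuous_ker h (adm_heatMul h ht)).measurable hA0 hB0 (fun x => ?_)
    (fun y => by simpa only [ker_symm _ _ y] using hB y) hp
    (aestronglyMeasurable_nodeMeasure D a)
  · refine le_trans (le_of_eq ?_) h1
    congr 1
    funext x
    rw [integral_nodeMeasure, kerSum]
    exact Finset.sum_congr rfl fun y _ => mul_comm _ _
  · rw [lintegral_nodeMeasure]
    simp_rw [Real.enorm_eq_ofReal_abs]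
    rw [← ENNReal.ofReal_sum_of_nonneg fun _ _ => abs_nonneg _]
    exact ENNReal.ofReal_le_ofReal (hA x)

/-- Synthesis: the `n`-th frequency piece of `∑_y a_y (Δ^*)^r G(·, y)` in terms of the
coefficients `a`. The piece is the image of a sum of heat kernels at time `4 ^ (-n)` under a
multiplier to which the multiplier theorem applies. -/
lemma eLpNorm_kerSum_piece_mask_le (h : IsHeatSystem μ φ ℓ α) {S : ℕ} (hS : α < S) {β : ℝ}
    {b : ℝ → ℝ} (hb : IsMask S β b) (hp : 1 ≤ p) (r : ℝ) : ∃ C : ℝ, 0 < C ∧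
      ∀ (D : Finset M) (a : M → ℝ) (A : ℝ) (n : ℕ), 0 < A →
      (∀ x, ∑ y ∈ D, |ker φ (heatMul ℓ (dyadicTime n)) x y| ≤ A * ((2 : ℝ) ^ n) ^ α) →
      eLpNorm (kerSum φ (fun j => piece n (ℓ j) * ((1 + ℓ j) ^ r * b (ℓ j))) D a) p μ ≤
        ENNReal.ofReal (C * A ^ (1 - (p⁻¹).toReal) *
          ((2 : ℝ) ^ n) ^ (r - β + α * (1 - (p⁻¹).toReal))) * eLpNorm a p (nodeMeasure D) := by
  obtain ⟨C, hC, hrow⟩ := lintegral_ker_piece_mask_le h hS hb r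
  obtain ⟨B, hB, hheat⟩ := lintegral_ker_heatMul_le h
  set θ := (p⁻¹).toReal
  refine ⟨C * B ^ θ, by positivity, fun D a A n hA hD => ?_⟩
  have ht := dyadicTime_mem n
  have hN : (0 : ℝ) < 2 ^ n := by positivity
  have hAd := adm_piece_mul h n
    (fun j => (1 + ℓ j) ^ r * b (ℓ j) * Real.exp (ℓ j ^ 2 * dyadicTime n))
  have e : kerSum φ (fun j => piece n (ℓ j) * ((1 + ℓ j) ^ r * b (ℓ j))) D a = fun x =>
      ∫ z, ker φ (fun j => piece n (ℓ j) *
        ((1 + ℓ j) ^ r * b (ℓ j) * Real.exp (ℓ j ^ 2 * dyadicTime n))) x z *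
        kerSum φ (heatMul ℓ (dyadicTime n)) D a z ∂μ := by
    funext x
    rw [integral_ker_mul_kerSum h hAd (adm_heatMul h ht.1)]
    congr 1
    funext j
    have : Real.exp (ℓ j ^ 2 * dyadicTime n) * heatMul ℓ (dyadicTime n) j = 1 := by
      rw [heatMul, ← Real.exp_add, neg_mul, add_neg_cancel, Real.exp_zero]
    calc _ = piece n (ℓ j) * ((1 + ℓ j) ^ r * b (ℓ j)) *
          (Real.exp (ℓ j ^ 2 * dyadicTime n) * heatMul ℓ (dyadicTime n) j) := by rw [this, mul_one]
      _ = _ := by ring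
  rw [e]
  refine (eLpNorm_integral_ker_le h hAd (by positivity) (hrow n) hp
    (continuous_kerSum h (adm_heatMul h ht.1)).aestronglyMeasurable).trans ?_
  refine (mul_le_mul_right (eLpNorm_kerSum_heat_le h hp ht.1 (by positivity) hB hD (hheat _ ht))
    _).trans (le_of_eq ?_)
  rw [← mul_assoc, ← ENNReal.ofReal_mul (by positivity)]
  congr 2
  rw [Real.mul_rpow hA.le (by positivity), ← Real.rpow_mul hN.le, Real.rpow_add hN]
  ring

/-- Row sums of the heat kernel over separated nodes, at times not above the squared separation. -/
lemma sum_abs_heat_le_of_separated (h : IsHeatSystem μ φ ℓ α) : ∃ A : ℝ, 0 < A ∧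
    ∀ (n₀ : ℕ) (D : Finset M), (∀ y ∈ D, ∀ z ∈ D, y ≠ z → ((2 : ℝ) ^ n₀)⁻¹ ≤ dist y z) →
      ∀ n, n₀ ≤ n → ∀ x, ∑ y ∈ D, |ker φ (heatMul ℓ (dyadicTime n)) x y| ≤
        A * ((2 : ℝ) ^ n) ^ α := by
  obtain ⟨c₁, c, hc₁, hc, hK⟩ := abs_heatKernel_le h
  obtain ⟨C, hC, hsep⟩ := sum_gaussian_le_of_separated h hc
  refine ⟨c₁ * C, by positivity, fun n₀ D hD n hn x => ?_⟩
  have h1 := hsep ((2 : ℝ) ^ n₀)⁻¹ ⟨by positivity,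
    inv_le_one_of_one_le₀ (one_le_pow₀ (by norm_num))⟩ D hD x
  calc _ ≤ ∑ y ∈ D, c₁ * ((2 : ℝ) ^ n) ^ α *
        Real.exp (-c * dist x y ^ 2 / (((2 : ℝ) ^ n₀)⁻¹) ^ 2) := by
        refine Finset.sum_le_sum fun y _ => (hK _ (dyadicTime_mem n) x y).trans ?_
        rw [dyadicTime_rpow]
        refine mul_le_mul_of_nonneg_left (Real.exp_le_exp.2 ?_) (by positivity)
        have e : dyadicTime n = (((2 : ℝ) ^ n)⁻¹) ^ 2 := by rw [dyadicTime, inv_pow]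
        rw [neg_mul, neg_div, neg_div, neg_le_neg_iff, e]
        have : ((2 : ℝ) ^ n)⁻¹ ≤ ((2 : ℝ) ^ n₀)⁻¹ :=
          inv_anti₀ (by positivity) (pow_le_pow_right₀ (by norm_num) hn)
        gcongr
    _ = c₁ * ((2 : ℝ) ^ n) ^ α *
        ∑ y ∈ D, Real.exp (-c * dist x y ^ 2 / (((2 : ℝ) ^ n₀)⁻¹) ^ 2) := by rw [Finset.mul_sum]
    _ ≤ c₁ * ((2 : ℝ) ^ n) ^ α * C := by gcongr
    _ = _ := by ring

lemma exists_sum_abs_heat_le (h : IsHeatSystem μ φ ℓ α) (D : Finset M) : ∃ A : ℝ, 0 < A ∧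
    ∀ n x, ∑ y ∈ D, |ker φ (heatMul ℓ (dyadicTime n)) x y| ≤ A * ((2 : ℝ) ^ n) ^ α := by
  obtain ⟨c₁, c, hc₁, hc, hK⟩ := abs_heatKernel_le h
  refine ⟨((D.card : ℝ) + 1) * c₁, by positivity, fun n x => ?_⟩
  calc _ ≤ ∑ y ∈ D, c₁ * ((2 : ℝ) ^ n) ^ α := by
        refine Finset.sum_le_sum fun y _ => (hK _ (dyadicTime_mem n) x y).trans ?_
        rw [dyadicTime_rpow]
        refine mul_le_of_le_one_right (by positivity) ?_
        rw [Real.exp_le_one_iff, neg_mul, neg_div, neg_nonpos]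
        have := (dyadicTime_mem n).1
        positivity
    _ ≤ _ := by
        rw [Finset.sum_const, nsmul_eq_mul, ← mul_assoc]
        gcongr
        linarith

end KerSum

/-! ### Stability of eignets -/

lemma exists_tsum_pow_natAbs_le {ρ : ℝ} (h0 : 0 < ρ) (h1 : ρ < 1) : ∃ K : ℝ, 0 < K ∧
    ∀ i : ℕ, ∑' n : ℕ, ENNReal.ofReal (ρ ^ ((n : ℤ) - i).natAbs) ≤ ENNReal.ofReal K := by
  have hs : Summable fun z : ℤ => ρ ^ z.natAbs := by
    refine Summable.of_nat_of_neg ?_ ?_ <;>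
    · simpa using summable_geometric_of_lt_one h0.le h1
  refine ⟨∑' z : ℤ, ρ ^ z.natAbs, hs.tsum_pos (fun z => by positivity) 0 (by simp), fun i => ?_⟩
  rw [ENNReal.ofReal_tsum_of_nonneg (fun z => by positivity) hs]
  have hinj : Function.Injective fun n : ℕ => (n : ℤ) - i := fun m n hmn => by
    simpa using hmn
  exact ENNReal.tsum_comp_le_tsum_of_injective hinj fun z : ℤ => ENNReal.ofReal (ρ ^ z.natAbs)

open Classical in
/-- The kernel `k` restricted to the off-diagonal pairs of points of the finite set `D`. -/
noncomputable def offDiagKer {M : Type*} (D : Finset M) (k : M → M → ℝ) (x y : M) : ℝ :=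
  if x ∈ D ∧ y ∈ D ∧ x ≠ y then k x y else 0

section Stability

variable {M : Type*} [MetricSpace M] [CompactSpace M] [MeasurableSpace M] [BorelSpace M]
  {μ : Measure M} [IsProbabilityMeasure μ] {φ : ℕ → M → ℝ} {ℓ : ℕ → ℝ} {α : ℝ}
  {p : ℝ≥0∞}

/-- The off-diagonal part of the kernel matrix of the heat kernel on separated nodes is small
compared with its diagonal, provided the time is a small multiple of the squared separation. -/
lemma exists_sum_offDiag_heat_le (h : IsHeatSystem μ φ ℓ α) {ε : ℝ} (hε : 0 < ε) : ∃ d : ℕ,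
    0 < d ∧ ∀ (n₀ : ℕ) (D : Finset M),
      (∀ y ∈ D, ∀ z ∈ D, y ≠ z → ((2 : ℝ) ^ n₀)⁻¹ ≤ dist y z) → ∀ x ∈ D,
      ∑ y ∈ D, |offDiagKer D (ker φ (heatMul ℓ (2 * dyadicTime (n₀ + d)))) x y| ≤
        ε * (2 * dyadicTime (n₀ + d)) ^ (-α / 2) := by
  obtain ⟨c₁, c, hc₁, hc, hK⟩ := abs_heatKernel_le h
  obtain ⟨C, hC, hsep⟩ := sum_gaussian_le_of_separated h (c := c / 4) (by positivity)
  obtain ⟨d, hd⟩ := pow_unbounded_of_one_lt (4 * c₁ * C / (c * ε)) (by norm_num : (1 : ℝ) < 4)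
  refine ⟨d + 1, d.succ_pos, fun n₀ D hD x hx => ?_⟩
  have hexp : c₁ * C * Real.exp (-(c / 4 * 4 ^ (d + 1))) ≤ ε := by
    rw [Real.exp_neg, ← div_eq_mul_inv, div_le_iff₀ (Real.exp_pos _)]
    have h1 : 4 * c₁ * C ≤ 4 ^ (d + 1) * (c * ε) := by
      rw [div_lt_iff₀ (by positivity)] at hd
      have : (0 : ℝ) ≤ 4 ^ d * (c * ε) := by positivity
      rw [pow_succ]
      linarith
    calc c₁ * C ≤ ε * (c / 4 * 4 ^ (d + 1)) := by linarith
      _ ≤ _ := by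
        gcongr
        linarith [Real.add_one_le_exp (c / 4 * 4 ^ (d + 1))]
  set n := n₀ + (d + 1) with hn
  set t := dyadicTime n with ht
  have ht0 : 0 < t := (dyadicTime_mem n).1
  have hts : t * 4 ^ (d + 1) = (((2 : ℝ) ^ n₀)⁻¹) ^ 2 := by
    rw [ht, dyadicTime, hn, pow_add (2 : ℝ) n₀ (d + 1), mul_pow, ← pow_mul 2 (d + 1) 2,
      mul_comm (d + 1) 2, pow_mul 2 2 (d + 1)]
    norm_num
    field_simp
  have ht1 : 2 * t ∈ Ioc (0 : ℝ) 1 := by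
    refine ⟨by positivity, ?_⟩
    have h1 : (((2 : ℝ) ^ n₀)⁻¹) ^ 2 ≤ 1 :=
      pow_le_one₀ (by positivity) (inv_le_one_of_one_le₀ (one_le_pow₀ (by norm_num)))
    have h2 : (4 : ℝ) ≤ 4 ^ (d + 1) := by
      rw [pow_succ]
      linarith [one_le_pow₀ (n := d) (by norm_num : (1 : ℝ) ≤ 4)]
    nlinarith
  set s := ((2 : ℝ) ^ n₀)⁻¹ with hs
  have hs0 : 0 < s := by positivity
  have hs1 : s ≤ 1 := inv_le_one_of_one_le₀ (one_le_pow₀ (by norm_num))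
  calc _ ≤ ∑ y ∈ D, c₁ * (2 * t) ^ (-α / 2) * Real.exp (-(c / 4 * 4 ^ (d + 1))) *
        Real.exp (-(c / 4) * dist x y ^ 2 / s ^ 2) := by
        refine Finset.sum_le_sum fun y hy => ?_
        rw [offDiagKer]
        split_ifs with hxy
        · refine (hK _ ht1 x y).trans ?_
          rw [mul_assoc, mul_assoc (c₁ * _), ← Real.exp_add]
          rw [← mul_assoc]
          refine mul_le_mul_of_nonneg_left (Real.exp_le_exp.2 ?_) (by positivity)
          have h1 : 1 ≤ dist x y ^ 2 / s ^ 2 := by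
            rw [one_le_div (by positivity)]
            have := hD x hx y hy hxy.2.2
            gcongr
          have e1 : -c * dist x y ^ 2 / (2 * t) =
              -(c / 2 * 4 ^ (d + 1) * (dist x y ^ 2 / s ^ 2)) := by
            rw [← hts]
            field_simp
          have e2 : -(c / 4) * dist x y ^ 2 / s ^ 2 = -(c / 4 * (dist x y ^ 2 / s ^ 2)) := by ring
          rw [e1, e2]
          have h2 : (1 : ℝ) ≤ 4 ^ (d + 1) := one_le_pow₀ (by norm_num)
          have h3 : 0 ≤ c * 4 ^ (d + 1) * (dist x y ^ 2 / s ^ 2 - 1) := by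
            have : 0 ≤ dist x y ^ 2 / s ^ 2 - 1 := by linarith
            positivity
          have h4 : 0 ≤ c * (dist x y ^ 2 / s ^ 2) * (4 ^ (d + 1) - 1) := by
            have : (0 : ℝ) ≤ 4 ^ (d + 1) - 1 := by linarith
            positivity
          linarith
        · rw [abs_zero]
          positivity
    _ = c₁ * (2 * t) ^ (-α / 2) * Real.exp (-(c / 4 * 4 ^ (d + 1))) *
        ∑ y ∈ D, Real.exp (-(c / 4) * dist x y ^ 2 / s ^ 2) := by rw [Finset.mul_sum]
    _ ≤ c₁ * (2 * t) ^ (-α / 2) * Real.exp (-(c / 4 * 4 ^ (d + 1))) * C := by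
        gcongr
        exact hsep s ⟨hs0, hs1⟩ D hD x
    _ = c₁ * C * Real.exp (-(c / 4 * 4 ^ (d + 1))) * (2 * t) ^ (-α / 2) := by ring
    _ ≤ _ := by gcongr

lemma heatMul_mul_heatMul (t : ℝ) :
    (fun j => heatMul ℓ t j * heatMul ℓ t j) = heatMul ℓ (2 * t) := by
  funext j
  rw [heatMul, heatMul, ← Real.exp_add]
  congr 1
  ring

/-- Stability: on separated nodes, the `ℓ^p` norm of the coefficients is controlled by the `L^p`
norm of the sum of heat kernels. The values of the sum at double time, taken at the nodes, are
given by a diagonally dominant matrix. -/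
lemma exists_eLpNorm_nodeMeasure_le (h : IsHeatSystem μ φ ℓ α)
    (hlow : HeatKernelLowerBound φ ℓ α) (hp : 1 ≤ p) : ∃ (C : ℝ) (d : ℕ), 0 < C ∧
      ∀ (n₀ : ℕ) (D : Finset M),
      (∀ y ∈ D, ∀ z ∈ D, y ≠ z → ((2 : ℝ) ^ n₀)⁻¹ ≤ dist y z) → ∀ a : M → ℝ,
      eLpNorm a p (nodeMeasure D) ≤
        ENNReal.ofReal (C * ((2 : ℝ) ^ (n₀ + d)) ^ (-(α * (1 - (p⁻¹).toReal)))) *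
          eLpNorm (kerSum φ (heatMul ℓ (dyadicTime (n₀ + d))) D a) p μ := by
  obtain ⟨c, hc, hdiag⟩ := hlow
  obtain ⟨A, hA, hcol⟩ := sum_abs_heat_le_of_separated h
  obtain ⟨B, hB, hrow⟩ := lintegral_ker_heatMul_le h
  obtain ⟨d, hd0, hoff⟩ := exists_sum_offDiag_heat_le h (half_pos hc)
  set θ := (p⁻¹).toReal with hθ
  refine ⟨2 / c * 2 ^ (α / 2) * B ^ (1 - θ) * A ^ θ, d, by positivity, fun n₀ D hD a => ?_⟩
  set n := n₀ + d with hn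
  set t := dyadicTime n with ht
  have ht0 : 0 < t := (dyadicTime_mem n).1
  have hAd := adm_heatMul h ht0
  have ht2 : 2 * t ∈ Ioc (0 : ℝ) 1 := by
    refine ⟨by positivity, ?_⟩
    have h1 : (2 : ℝ) ^ 1 ≤ 2 ^ n := pow_le_pow_right₀ (by norm_num) (by omega)
    rw [ht, dyadicTime, ← div_eq_mul_inv, div_le_one (by positivity)]
    nlinarith
  have hAd2 := adm_heatMul h ht2.1
  -- `κ` bounds the diagonal from below, and `κ / 2` the off-diagonal row sums from above
  set κ := c * (2 * t) ^ (-α / 2) with hκ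
  have hκ0 : 0 < κ := by
    have := ht2.1
    positivity
  set w := kerSum φ (heatMul ℓ t) D a with hw
  set F : M → ℝ := fun x => ∫ z, ker φ (heatMul ℓ t) x z * w z ∂μ with hF
  set E : M → M → ℝ := offDiagKer D (ker φ (heatMul ℓ (2 * t))) with hE
  have hEm : Measurable (Function.uncurry E) := by
    classical
    refine Measurable.ite (p := fun z : M × M => z.1 ∈ D ∧ z.2 ∈ D ∧ z.1 ≠ z.2) ?_
      (continuous_ker h hAd2).measurable measurable_const
    refine Set.Finite.measurableSet ((D ×ˢ D).finite_toSet.subset fun z hz => ?_)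
    simpa using ⟨hz.1, hz.2.1⟩
  have hEsymm : ∀ x y, E x y = E y x := fun x y => by
    classical
    simp only [hE, offDiagKer]
    rw [ker_symm _ x y]
    exact if_congr (by rw [ne_comm, and_left_comm]) rfl rfl
  have hErow : ∀ x, ∫⁻ y, ‖E x y‖ₑ ∂(nodeMeasure D) ≤ ENNReal.ofReal (κ / 2) := by
    intro x
    rw [lintegral_nodeMeasure]
    simp_rw [Real.enorm_eq_ofReal_abs]
    rw [← ENNReal.ofReal_sum_of_nonneg fun _ _ => abs_nonneg _]
    refine ENNReal.ofReal_le_ofReal ?_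
    by_cases hx : x ∈ D
    · have := hoff n₀ D hD x hx
      rw [hκ, mul_div_right_comm]
      exact this
    · rw [Finset.sum_eq_zero fun y _ => by simp [hE, offDiagKer, hx]]
      positivity
  have hEnorm : eLpNorm (fun x => ∫ y, E x y * a y ∂(nodeMeasure D)) p (nodeMeasure D) ≤
      ENNReal.ofReal (κ / 2) * eLpNorm a p (nodeMeasure D) := by
    have h1 := eLpNorm_integral_mul_le (μ := nodeMeasure D) (ν := nodeMeasure D) hEm
      (half_pos hκ0) (half_pos hκ0) hErow (fun y => by simpa only [hEsymm _ y] using hErow y) hp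
      (aestronglyMeasurable_nodeMeasure D a)
    rwa [← Real.rpow_add (half_pos hκ0), sub_add_cancel, Real.rpow_one] at h1
  have hFnorm : eLpNorm F p (nodeMeasure D) ≤
      ENNReal.ofReal (B ^ (1 - θ) * (A * ((2 : ℝ) ^ n) ^ α) ^ θ) * eLpNorm w p μ := by
    refine eLpNorm_integral_mul_le (continuous_ker h hAd).measurable hB (by positivity)
      (hrow t (dyadicTime_mem n)) (fun y => ?_) hp (continuous_kerSum h hAd).aestronglyMeasurable
    rw [lintegral_nodeMeasure]
    simp_rw [Real.enorm_eq_ofReal_abs, ker_symm _ _ y]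
    rw [← ENNReal.ofReal_sum_of_nonneg fun _ _ => abs_nonneg _]
    exact ENNReal.ofReal_le_ofReal (hcol n₀ D hD n (by omega) y)
  have hFE : ∀ x ∈ D, F x - ∫ y, E x y * a y ∂(nodeMeasure D) =
      ker φ (heatMul ℓ (2 * t)) x x * a x := by
    classical
    intro x hx
    simp only [hF, hw]
    rw [integral_ker_mul_kerSum h hAd hAd, heatMul_mul_heatMul, integral_nodeMeasure, kerSum,
      ← Finset.sum_sub_distrib, Finset.sum_eq_single_of_mem x hx]
    · simp [hE, offDiagKer, mul_comm]
    · intro y hy hyx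
      simp [hE, offDiagKer, hx, hy, hyx.symm, mul_comm]
  have hmain : ENNReal.ofReal κ * eLpNorm a p (nodeMeasure D) ≤ eLpNorm F p (nodeMeasure D) +
      ENNReal.ofReal (κ / 2) * eLpNorm a p (nodeMeasure D) := by
    calc _ = eLpNorm (κ • a) p (nodeMeasure D) := by
          rw [eLpNorm_const_smul, Real.enorm_eq_ofReal hκ0.le]
      _ ≤ eLpNorm (F - fun x => ∫ y, E x y * a y ∂(nodeMeasure D)) p (nodeMeasure D) := by
          refine eLpNorm_mono_ae ?_
          filter_upwards [ae_mem_nodeMeasure D] with x hx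
          rw [Pi.sub_apply, hFE x hx, Pi.smul_apply, smul_eq_mul, norm_mul κ,
            norm_mul (ker φ _ x x)]
          refine mul_le_mul_of_nonneg_right ?_ (norm_nonneg _)
          rw [Real.norm_of_nonneg hκ0.le]
          exact (hdiag _ ht2 x).trans (le_abs_self _)
      _ ≤ _ := (eLpNorm_sub_le (aestronglyMeasurable_nodeMeasure D _)
          (aestronglyMeasurable_nodeMeasure D _) hp).trans (add_le_add le_rfl hEnorm)
  have hfin : ENNReal.ofReal (κ / 2) * eLpNorm a p (nodeMeasure D) ≠ ⊤ :=
    ENNReal.mul_ne_top ENNReal.ofReal_ne_top (eLpNorm_nodeMeasure_lt_top D p a).ne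
  have hhalf : ENNReal.ofReal (κ / 2) * eLpNorm a p (nodeMeasure D) ≤
      eLpNorm F p (nodeMeasure D) := by
    refine ENNReal.le_of_add_le_add_right hfin ?_
    refine le_trans (le_of_eq ?_) hmain
    rw [← add_mul, ← ENNReal.ofReal_add (by positivity) (by positivity), add_halves]
  have hN : (0 : ℝ) < 2 ^ n := by positivity
  calc eLpNorm a p (nodeMeasure D)
      = ENNReal.ofReal (κ / 2)⁻¹ * (ENNReal.ofReal (κ / 2) * eLpNorm a p (nodeMeasure D)) := by
        rw [← mul_assoc, ← ENNReal.ofReal_mul (by positivity), inv_mul_cancel₀ (by positivity),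
          ENNReal.ofReal_one, one_mul]
    _ ≤ ENNReal.ofReal (κ / 2)⁻¹ *
        (ENNReal.ofReal (B ^ (1 - θ) * (A * ((2 : ℝ) ^ n) ^ α) ^ θ) * eLpNorm w p μ) := by
        exact mul_le_mul_right (hhalf.trans hFnorm) _
    _ = _ := by
        rw [← mul_assoc, ← ENNReal.ofReal_mul (by positivity)]
        congr 2
        have e : (κ / 2)⁻¹ = 2 / c * 2 ^ (α / 2) * ((2 : ℝ) ^ n) ^ (-α) := by
          rw [hκ, Real.mul_rpow (by norm_num) ht0.le, ht, dyadicTime_rpow, neg_div,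
            Real.rpow_neg hN.le, Real.rpow_neg (by norm_num : (0 : ℝ) ≤ 2)]
          field_simp
        have e2 : -(α * (1 - θ)) = -α + α * θ := by ring
        rw [e, e2, Real.rpow_add hN, Real.mul_rpow hA.le (by positivity), ← Real.rpow_mul hN.le]
        ring

end Stability

/-! ### The Bernstein inequality -/

lemma two_pow_add_rpow (i k : ℕ) (s : ℝ) :
    ((2 : ℝ) ^ (i + k)) ^ s = ((2 : ℝ) ^ i) ^ s * ((2 : ℝ) ^ s) ^ k := by
  rw [pow_add, Real.mul_rpow (by positivity) (by positivity), Real.rpow_pow_comm (by norm_num)]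

section Bernstein

variable {M : Type*} [MetricSpace M] [CompactSpace M] [MeasurableSpace M] [BorelSpace M]
  {μ : Measure M} [IsProbabilityMeasure μ] {φ : ℕ → M → ℝ} {ℓ : ℕ → ℝ} {α : ℝ}
  {p : ℝ≥0∞} {S : ℕ} {β : ℝ} {b : ℝ → ℝ}

/-- The frequency `2 ^ n` contributes to a heat kernel at time `4 ^ (-i)` with a factor
exponentially small in `|n - i|`. -/
lemma lintegral_ker_piece_heat_div_mask_le_pow (h : IsHeatSystem μ φ ℓ α) (hS : α < S)
    (hb : IsMask S β b) (hβ : 0 < β) : ∃ C ρ : ℝ, 0 < C ∧ 0 < ρ ∧ ρ < 1 ∧ ∀ (i n : ℕ) x,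
      ∫⁻ y, ‖ker φ (fun j => piece n (ℓ j) *
        (heatMul ℓ (dyadicTime i) j * (b (ℓ j))⁻¹)) x y‖ₑ ∂μ ≤
      ENNReal.ofReal (C * ((2 : ℝ) ^ i) ^ β * ρ ^ ((n : ℤ) - i).natAbs) := by
  set w : ℝ := 2 ^ β with hw
  have hw1 : 1 < w := Real.one_lt_rpow (by norm_num) hβ
  obtain ⟨k, hk⟩ := pow_unbounded_of_one_lt (2 * w) (by norm_num : (1 : ℝ) < 4)
  -- no Gaussian decay is used below the frequency `2 ^ i`, and enough of it above to beat `2 ^ β`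
  obtain ⟨C₀, hC₀, h0⟩ := lintegral_ker_piece_heat_div_mask_le h hS hb 0
  obtain ⟨C₁, hC₁, h1⟩ := lintegral_ker_piece_heat_div_mask_le h hS hb k
  refine ⟨max C₀ C₁, max (1 / 2) w⁻¹, by positivity, by positivity,
    max_lt (by norm_num) (inv_lt_one_of_one_lt₀ hw1), fun i n x => ?_⟩
  rcases le_total n i with hni | hni
  · obtain ⟨l, rfl⟩ := Nat.exists_eq_add_of_le hni
    refine (h0 (n + l) n x).trans (ENNReal.ofReal_le_ofReal ?_)
    have e : ((n : ℤ) - (n + l : ℕ)).natAbs = l := by omega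
    rw [e, two_pow_add_rpow, pow_zero, one_mul]
    have h3 : 1 ≤ w ^ l * max (1 / 2) w⁻¹ ^ l := by
      calc (1 : ℝ) = w ^ l * w⁻¹ ^ l := by
            rw [← mul_pow, mul_inv_cancel₀ (by positivity), one_pow]
        _ ≤ _ := by
          gcongr
          exact le_max_right _ _
    calc C₀ * ((2 : ℝ) ^ n) ^ β ≤ max C₀ C₁ * ((2 : ℝ) ^ n) ^ β := by
          gcongr
          exact le_max_left _ _
      _ ≤ max C₀ C₁ * ((2 : ℝ) ^ n) ^ β * (w ^ l * max (1 / 2) w⁻¹ ^ l) :=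
          le_mul_of_one_le_right (by positivity) h3
      _ = _ := by ring
  · obtain ⟨l, rfl⟩ := Nat.exists_eq_add_of_le hni
    refine (h1 i (i + l) x).trans (ENNReal.ofReal_le_ofReal ?_)
    have e : (((i + l : ℕ) : ℤ) - i).natAbs = l := by omega
    have e2 : (((2 : ℝ) ^ i / 2 ^ (i + l)) ^ 2) ^ k = (((4 : ℝ) ^ k)⁻¹) ^ l := by
      have : (2 : ℝ) ^ i / 2 ^ (i + l) = (2 ^ l)⁻¹ := by
        rw [pow_add]
        field_simp
      rw [this, inv_pow, inv_pow, inv_pow, ← pow_mul, ← pow_mul, ← pow_mul,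
        (by norm_num : (4 : ℝ) = 2 ^ 2), ← pow_mul]
      congr 2
      ring
    rw [e, e2, two_pow_add_rpow]
    have h3 : (((4 : ℝ) ^ k)⁻¹) ^ l * w ^ l ≤ max (1 / 2) w⁻¹ ^ l := by
      rw [← mul_pow]
      refine pow_le_pow_left₀ (by positivity) (le_trans ?_ (le_max_left _ _)) l
      rw [inv_mul_le_iff₀ (by positivity)]
      linarith
    calc C₁ * ((((4 : ℝ) ^ k)⁻¹) ^ l * (((2 : ℝ) ^ i) ^ β * w ^ l))
        = C₁ * ((2 : ℝ) ^ i) ^ β * ((((4 : ℝ) ^ k)⁻¹) ^ l * w ^ l) := by ring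
      _ ≤ _ := by
        gcongr
        exact le_max_right _ _

/-- Analysis: the sum of heat kernels at time `4 ^ (-i)` is controlled by the eignet with the same
coefficients. -/
lemma eLpNorm_kerSum_heat_le_of_coeff (h : IsHeatSystem μ φ ℓ α) (hS : α < S)
    (hb : IsMask S β b) (hβ : 0 < β) (hp : 1 ≤ p) : ∃ C : ℝ, 0 < C ∧
      ∀ (i : ℕ) (D : Finset M) (a f : M → ℝ), Integrable f μ → eLpNorm f p μ ≠ ⊤ →
      (∀ k, ∫ x, f x * φ k x ∂μ = b (ℓ k) * ∑ y ∈ D, a y * φ k y) →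
      eLpNorm (kerSum φ (heatMul ℓ (dyadicTime i)) D a) p μ ≤
        ENNReal.ofReal (C * ((2 : ℝ) ^ i) ^ β) * eLpNorm f p μ := by
  obtain ⟨C, ρ, hC, hρ0, hρ1, hrow⟩ := lintegral_ker_piece_heat_div_mask_le_pow h hS hb hβ
  obtain ⟨K, hK, hsum⟩ := exists_tsum_pow_natAbs_le hρ0 hρ1
  refine ⟨C * K, by positivity, fun i D a f hf hfp hfc => ?_⟩
  have hpiece : ∀ n, eLpNorm (kerSum φ
      (fun j => piece n (ℓ j) * heatMul ℓ (dyadicTime i) j) D a) p μ ≤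
      ENNReal.ofReal (C * ((2 : ℝ) ^ i) ^ β) * ENNReal.ofReal (ρ ^ ((n : ℤ) - i).natAbs) *
        eLpNorm f p μ := fun n => by
    have he : kerSum φ (fun j => piece n (ℓ j) * heatMul ℓ (dyadicTime i) j) D a = fun x =>
        ∫ z, ker φ (fun j => piece n (ℓ j) *
          (heatMul ℓ (dyadicTime i) j * (b (ℓ j))⁻¹)) x z * f z ∂μ := by
      have hm : (fun j => piece n (ℓ j) * heatMul ℓ (dyadicTime i) j) = fun j =>
          piece n (ℓ j) * (heatMul ℓ (dyadicTime i) j * (b (ℓ j))⁻¹) * b (ℓ j) := by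
        funext j
        have := (hb.pos (ell_nonneg h j)).ne'
        field_simp
      have hmw := adm_piece_mul h n (heatMul ℓ (dyadicTime i))
      rw [hm] at hmw
      funext x
      rw [integral_ker_mul_of_coeff h (adm_piece_mul h n _) hmw hf hfc, hm]
    rw [he, ← ENNReal.ofReal_mul (by positivity)]
    exact eLpNorm_integral_ker_le h (adm_piece_mul h n _) (by positivity) (hrow i n) hp hf.1
  have htsum : ∑' n, eLpNorm (kerSum φ
      (fun j => piece n (ℓ j) * heatMul ℓ (dyadicTime i) j) D a) p μ ≤
      ENNReal.ofReal (C * K * ((2 : ℝ) ^ i) ^ β) * eLpNorm f p μ := by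
    refine (ENNReal.tsum_le_tsum hpiece).trans ?_
    rw [ENNReal.tsum_mul_right, ENNReal.tsum_mul_left]
    refine mul_le_mul_left ((mul_le_mul_right (hsum i) _).trans (le_of_eq ?_)) _
    rw [← ENNReal.ofReal_mul (by positivity)]
    congr 1
    ring
  obtain ⟨g, -, hgi, hgle, hgc⟩ := exists_memX_of_pieces h hp (heatMul ℓ (dyadicTime i)) D a
    (ne_top_of_le_ne_top (ENNReal.mul_ne_top ENNReal.ofReal_ne_top hfp) htsum)
  have hA := adm_heatMul h (dyadicTime_mem i).1
  have hae : kerSum φ (heatMul ℓ (dyadicTime i)) D a =ᵐ[μ] g :=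
    ae_eq_of_coeff_eq h (integrable_of_continuous (continuous_kerSum h hA)) hgi fun k => by
      rw [integral_kerSum_mul_phi h hA, hgc]
  rw [eLpNorm_congr_ae hae]
  exact hgle.trans htsum

/-- Stability of eignets: on separated nodes, the coefficients are controlled by the `L^p` norm. -/
lemma exists_eLpNorm_nodeMeasure_le_of_coeff (h : IsHeatSystem μ φ ℓ α)
    (hlow : HeatKernelLowerBound φ ℓ α) (hS : α < S) (hb : IsMask S β b) (hβ : 0 < β)
    (hp : 1 ≤ p) : ∃ C : ℝ, 0 < C ∧ ∀ (n₀ : ℕ) (D : Finset M),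
      (∀ y ∈ D, ∀ z ∈ D, y ≠ z → ((2 : ℝ) ^ n₀)⁻¹ ≤ dist y z) → ∀ a f : M → ℝ,
      Integrable f μ → eLpNorm f p μ ≠ ⊤ →
      (∀ k, ∫ x, f x * φ k x ∂μ = b (ℓ k) * ∑ y ∈ D, a y * φ k y) →
      eLpNorm a p (nodeMeasure D) ≤
        ENNReal.ofReal (C * ((2 : ℝ) ^ n₀) ^ (β - α * (1 - (p⁻¹).toReal))) * eLpNorm f p μ := by
  obtain ⟨C₁, d, hC₁, h1⟩ := exists_eLpNorm_nodeMeasure_le h hlow hp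
  obtain ⟨C₂, hC₂, h2⟩ := eLpNorm_kerSum_heat_le_of_coeff h hS hb hβ hp
  refine ⟨C₁ * C₂ * ((2 : ℝ) ^ (β - α * (1 - (p⁻¹).toReal))) ^ d, by positivity,
    fun n₀ D hD a f hf hfp hfc => ?_⟩
  refine (h1 n₀ D hD a).trans ((mul_le_mul_right (h2 (n₀ + d) D a f hf hfp hfc) _).trans
    (le_of_eq ?_))
  rw [← mul_assoc, ← ENNReal.ofReal_mul (by positivity)]
  congr 2
  calc _ = C₁ * C₂ * (((2 : ℝ) ^ (n₀ + d)) ^ β *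
        ((2 : ℝ) ^ (n₀ + d)) ^ (-(α * (1 - (p⁻¹).toReal)))) := by ring
    _ = _ := by
      rw [← Real.rpow_add (by positivity), ← sub_eq_add_neg, two_pow_add_rpow]
      ring

/-- Eignets have `s` derivatives in `X^p` for `s < β - α / p'`. -/
lemma exists_memX_mask (h : IsHeatSystem μ φ ℓ α) (hS : α < S) (hb : IsMask S β b) (hp : 1 ≤ p)
    {s : ℝ} (hs : s < β - α * (1 - (p⁻¹).toReal)) (D : Finset M) (a : M → ℝ) :
    ∃ g : M → ℝ, MemX μ φ ℓ p g ∧ Integrable g μ ∧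
      ∀ k, ∫ x, g x * φ k x ∂μ = (1 + ℓ k) ^ s * b (ℓ k) * ∑ y ∈ D, a y * φ k y := by
  obtain ⟨C, hC, h1⟩ := eLpNorm_kerSum_piece_mask_le h hS hb hp s
  obtain ⟨A, hA, hD⟩ := exists_sum_abs_heat_le h D
  set θ := (p⁻¹).toReal
  have hρ1 : (2 : ℝ) ^ (s - β + α * (1 - θ)) < 1 :=
    Real.rpow_lt_one_of_one_lt_of_neg (by norm_num) (by linarith)
  obtain ⟨K, hK, hsum⟩ := exists_tsum_pow_natAbs_le (by positivity) hρ1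
  have htop : ∑' n, eLpNorm (kerSum φ
      (fun j => piece n (ℓ j) * ((1 + ℓ j) ^ s * b (ℓ j))) D a) p μ ≠ ⊤ := by
    have hle : ∑' n, eLpNorm (kerSum φ
        (fun j => piece n (ℓ j) * ((1 + ℓ j) ^ s * b (ℓ j))) D a) p μ ≤
        ENNReal.ofReal (C * A ^ (1 - θ)) * ENNReal.ofReal K * eLpNorm a p (nodeMeasure D) := by
      refine (ENNReal.tsum_le_tsum fun n => h1 D a A n hA (hD n)).trans ?_
      rw [ENNReal.tsum_mul_right]
      refine mul_le_mul_left ?_ _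
      refine le_trans (le_of_eq ?_) (mul_le_mul_right (hsum 0) _)
      rw [← ENNReal.tsum_mul_left]
      refine tsum_congr fun n => ?_
      rw [ENNReal.ofReal_mul (by positivity), ← Real.rpow_pow_comm (by norm_num)]
      simp
    exact ne_top_of_le_ne_top (ENNReal.mul_ne_top (ENNReal.mul_ne_top ENNReal.ofReal_ne_top
      ENNReal.ofReal_ne_top) (eLpNorm_nodeMeasure_lt_top D p a).ne) hle
  obtain ⟨g, hg, hgi, -, hgc⟩ := exists_memX_of_pieces h hp _ D a htop
  exact ⟨g, hg, hgi, hgc⟩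

/-- **Bernstein inequality for eignets** in terms of a dyadic lower bound `2 ^ (-n₀)` of the
separation. Frequencies below `2 ^ n₀` are estimated by the multiplier theorem, those above by the
coefficients of the eignet, to which stability applies. -/
lemma exists_bernstein (h : IsHeatSystem μ φ ℓ α) (hlow : HeatKernelLowerBound φ ℓ α) (hS : α < S)
    (hb : IsMask S β b) (hp : 1 ≤ p) {r : ℝ} (hr : 0 < r)
    (hrβ : r < β - α * (1 - (p⁻¹).toReal)) : ∃ C : ℝ, 0 < C ∧ ∀ (n₀ : ℕ) (D : Finset M),
      (∀ y ∈ D, ∀ z ∈ D, y ≠ z → ((2 : ℝ) ^ n₀)⁻¹ ≤ dist y z) → ∀ a f g : M → ℝ,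
      Integrable f μ → eLpNorm f p μ ≠ ⊤ →
      (∀ k, ∫ x, f x * φ k x ∂μ = b (ℓ k) * ∑ y ∈ D, a y * φ k y) → Integrable g μ →
      (∀ k, ∫ x, g x * φ k x ∂μ = (1 + ℓ k) ^ r * ∫ x, f x * φ k x ∂μ) →
      eLpNorm g p μ ≤ ENNReal.ofReal (C * ((2 : ℝ) ^ n₀) ^ r) * eLpNorm f p μ := by
  have hθ1 : (p⁻¹).toReal ≤ 1 := by
    have := ENNReal.toReal_mono ENNReal.one_ne_top (ENNReal.inv_le_one.2 hp)
    simpa using this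
  have hβ : 0 < β := by
    have : 0 ≤ α * (1 - (p⁻¹).toReal) := mul_nonneg h.pos.le (by linarith)
    linarith
  obtain ⟨C₁, hC₁, h1⟩ := lintegral_ker_piece_rpow_le h hS r
  obtain ⟨C₂, hC₂, h2⟩ := eLpNorm_kerSum_piece_mask_le h hS hb hp r
  obtain ⟨A, hA, hD⟩ := sum_abs_heat_le_of_separated h
  obtain ⟨C₃, hC₃, h3⟩ := exists_eLpNorm_nodeMeasure_le_of_coeff h hlow hS hb hβ hp
  set θ := (p⁻¹).toReal
  set γ := β - α * (1 - θ) with hγ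
  have hρ₁ : (2 : ℝ) ^ (-r) < 1 := Real.rpow_lt_one_of_one_lt_of_neg (by norm_num) (by linarith)
  have hρ₂ : (2 : ℝ) ^ (r - γ) < 1 :=
    Real.rpow_lt_one_of_one_lt_of_neg (by norm_num) (by linarith)
  set ρ : ℝ := max (2 ^ (-r)) (2 ^ (r - γ)) with hρ
  have hρ0 : 0 < ρ := by positivity
  obtain ⟨K, hK, hsum⟩ := exists_tsum_pow_natAbs_le hρ0 (max_lt hρ₁ hρ₂)
  set C₀ := max C₁ (C₂ * A ^ (1 - θ) * C₃) with hC₀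
  have hC₀0 : 0 < C₀ := by positivity
  refine ⟨C₀ * K, by positivity, fun n₀ D hsep a f g hf hfp hfc hg hgc => ?_⟩
  have hpiece : ∀ n, eLpNorm (kerSum φ
      (fun j => piece n (ℓ j) * ((1 + ℓ j) ^ r * b (ℓ j))) D a) p μ ≤
      ENNReal.ofReal (C₀ * ((2 : ℝ) ^ n₀) ^ r) * ENNReal.ofReal (ρ ^ ((n : ℤ) - n₀).natAbs) *
        eLpNorm f p μ := by
    intro n
    rw [← ENNReal.ofReal_mul (by positivity)]
    rcases le_total n n₀ with hn | hn
    · have he : kerSum φ (fun j => piece n (ℓ j) * ((1 + ℓ j) ^ r * b (ℓ j))) D a = fun x =>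
          ∫ z, ker φ (fun j => piece n (ℓ j) * (1 + ℓ j) ^ r) x z * f z ∂μ := by
        have hmw := adm_piece_mul h n (fun j => (1 + ℓ j) ^ r * b (ℓ j))
        simp_rw [← mul_assoc] at hmw ⊢
        funext x
        rw [integral_ker_mul_of_coeff h (adm_piece_mul h n _) hmw hf hfc]
      rw [he]
      refine (eLpNorm_integral_ker_le h (adm_piece_mul h n _) (by positivity) (h1 n) hp
        hf.1).trans (mul_le_mul_left (ENNReal.ofReal_le_ofReal ?_) _)
      obtain ⟨l, rfl⟩ := Nat.exists_eq_add_of_le hn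
      have e : ((n : ℤ) - (n + l : ℕ)).natAbs = l := by omega
      rw [e, two_pow_add_rpow]
      have h4 : 1 ≤ ((2 : ℝ) ^ r) ^ l * ρ ^ l := by
        calc (1 : ℝ) = ((2 : ℝ) ^ r) ^ l * ((2 : ℝ) ^ (-r)) ^ l := by
              rw [← mul_pow, ← Real.rpow_add (by norm_num), add_neg_cancel, Real.rpow_zero,
                one_pow]
          _ ≤ _ := by
            gcongr
            exact le_max_left _ _
      calc C₁ * ((2 : ℝ) ^ n) ^ r ≤ C₀ * ((2 : ℝ) ^ n) ^ r := by
            gcongr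
            exact le_max_left _ _
        _ ≤ C₀ * ((2 : ℝ) ^ n) ^ r * (((2 : ℝ) ^ r) ^ l * ρ ^ l) :=
            le_mul_of_one_le_right (by positivity) h4
        _ = _ := by ring
    · refine (h2 D a A n hA (hD n₀ D hsep n hn)).trans ((mul_le_mul_right
        (h3 n₀ D hsep a f hf hfp hfc) _).trans ?_)
      rw [← mul_assoc, ← ENNReal.ofReal_mul (by positivity)]
      refine mul_le_mul_left (ENNReal.ofReal_le_ofReal ?_) _
      obtain ⟨l, rfl⟩ := Nat.exists_eq_add_of_le hn
      have e : (((n₀ + l : ℕ) : ℤ) - n₀).natAbs = l := by omega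
      have e2 : r - β + α * (1 - θ) = r - γ := by rw [hγ]; ring
      rw [e, e2, two_pow_add_rpow]
      calc _ = C₂ * A ^ (1 - θ) * C₃ * (((2 : ℝ) ^ n₀) ^ (r - γ) * ((2 : ℝ) ^ n₀) ^ γ) *
            ((2 : ℝ) ^ (r - γ)) ^ l := by ring
        _ = C₂ * A ^ (1 - θ) * C₃ * ((2 : ℝ) ^ n₀) ^ r * ((2 : ℝ) ^ (r - γ)) ^ l := by
            rw [← Real.rpow_add (by positivity), sub_add_cancel]
        _ ≤ _ := by
            gcongr
            · exact le_max_right _ _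
            · exact le_max_right _ _
  have htsum : ∑' n, eLpNorm (kerSum φ
      (fun j => piece n (ℓ j) * ((1 + ℓ j) ^ r * b (ℓ j))) D a) p μ ≤
      ENNReal.ofReal (C₀ * K * ((2 : ℝ) ^ n₀) ^ r) * eLpNorm f p μ := by
    refine (ENNReal.tsum_le_tsum hpiece).trans ?_
    rw [ENNReal.tsum_mul_right, ENNReal.tsum_mul_left]
    refine mul_le_mul_left ((mul_le_mul_right (hsum n₀) _).trans (le_of_eq ?_)) _
    rw [← ENNReal.ofReal_mul (by positivity)]
    congr 1
    ring
  obtain ⟨g', -, hgi, hgle, hgc'⟩ := exists_memX_of_pieces h hp _ D a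
    (ne_top_of_le_ne_top (ENNReal.mul_ne_top ENNReal.ofReal_ne_top hfp) htsum)
  have hae : g =ᵐ[μ] g' := ae_eq_of_coeff_eq h hg hgi fun k => by
    rw [hgc, hfc, hgc', mul_assoc]
  rw [eLpNorm_congr_ae hae]
  exact hgle.trans htsum

lemma MemX.congr_ae {f g : M → ℝ} (hg : MemX μ φ ℓ p g) (hfg : f =ᵐ[μ] g) : MemX μ φ ℓ p f := by
  refine ⟨hg.1.ae_eq hfg.symm, ?_⟩
  rw [← hg.2, distLp, distLp]
  exact iInf_congr fun P => iInf_congr fun _ => eLpNorm_congr_ae (hfg.sub (ae_eq_refl P))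

lemma integrable_eignet {G : M → M → ℝ} (hG : HasFormalExpansion μ φ ℓ b G) (D : Finset M)
    (a : M → ℝ) : Integrable (eignet G D a) μ :=
  integrable_finsetSum _ fun y _ => (hG y).1.const_mul (a y)

lemma integral_eignet_mul_phi (h : IsHeatSystem μ φ ℓ α) {G : M → M → ℝ}
    (hG : HasFormalExpansion μ φ ℓ b G) (D : Finset M) (a : M → ℝ) (k : ℕ) :
    ∫ x, eignet G D a x * φ k x ∂μ = b (ℓ k) * ∑ y ∈ D, a y * φ k y := by
  simp only [eignet, Finset.sum_mul, mul_assoc]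
  rw [integral_finsetSum _ fun y _ => ?_, Finset.mul_sum]
  · refine Finset.sum_congr rfl fun y _ => ?_
    rw [integral_const_mul, (hG y).2]
    ring
  · refine Integrable.const_mul ?_ _
    exact (hG y).1.mul_bdd (c := supNorm (φ k)) (h.sys.continuous k).aestronglyMeasurable
      (Eventually.of_forall fun x => abs_le_supNorm (h.sys.continuous k) x)

end Bernstein

lemma exists_two_pow_near_inv {q T : ℝ} (hq : 0 < q) (hT : 2 ≤ T) (hqT : q ≤ T) :
    ∃ n : ℕ, ((2 : ℝ) ^ n)⁻¹ ≤ q ∧ (2 : ℝ) ^ n ≤ T / q := by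
  rcases le_or_gt 1 q with h1 | h1
  · exact ⟨0, by simpa using h1, by rw [pow_zero, one_le_div hq]; exact hqT⟩
  · obtain ⟨n, hn1, hn2⟩ := exists_nat_pow_near (one_le_inv_iff₀.2 ⟨hq, h1.le⟩)
      (by norm_num : (1 : ℝ) < 2)
    refine ⟨n + 1, inv_le_of_inv_le₀ hq hn2.le, ?_⟩
    rw [le_div_iff₀ hq, pow_succ]
    have := mul_le_mul_of_nonneg_right hn1 hq.le
    rw [inv_mul_cancel₀ hq.ne'] at this
    linarith

end Eignet

theorem theorem6p3 {n : ℕ} {M : Type*} [MetricSpace M] [CompactSpace M] [ConnectedSpace M]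
    [ChartedSpace (EuclideanSpace ℝ (Fin n)) M] [IsManifold (𝓡 n) ∞ M]
    [RiemannianBundle (fun x : M => TangentSpace (𝓡 n) x)]
    [IsContMDiffRiemannianBundle (𝓡 n) ∞ (EuclideanSpace ℝ (Fin n))
      (fun x : M => TangentSpace (𝓡 n) x)]
    [IsRiemannianManifold (𝓡 n) M]
    [MeasurableSpace M] [BorelSpace M]
    (μ : Measure M) [IsProbabilityMeasure μ]
    (φ : ℕ → M → ℝ) (ℓ : ℕ → ℝ) (hsys : Eignet.IsOrthonormalSystem μ φ ℓ)
    (α : ℝ) (hα : 0 < α)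
    (hball : Eignet.BallMeasureBound μ α)
    (hint : Eignet.HeatKernelIntegral μ φ ℓ)
    (hgauss : Eignet.HeatKernelGaussianBound φ ℓ α)
    (hgrad : Eignet.HeatKernelGradientBound (n := n) φ ℓ α)
    (A : ℝ) (hA : 2 ≤ A) (hprod : Eignet.ProductAssumption μ φ ℓ A)
    (hlow : Eignet.HeatKernelLowerBound φ ℓ α)
    (S : ℕ) (hS : α < S) (β : ℝ) (b : ℝ → ℝ) (hb : Eignet.IsMask S β b)
    (G : M → M → ℝ) (hG : Eignet.HasFormalExpansion μ φ ℓ b G)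
    (p : ℝ≥0∞) (hp : 1 ≤ p)
    -- `1 - 1 / p` is `1 / p'`, with `p⁻¹ = 0` for `p = ∞`
    (r : ℝ) (hr : 0 < r) (hrβ : r < β - α * (1 - (p⁻¹).toReal)) :
    ∃ c : ℝ, 0 < c ∧ ∀ C : Finset M, (C : Set M).Nontrivial → ∀ a : M → ℝ,
      Eignet.MemW μ φ ℓ p r (Eignet.eignet G C a) ∧
      ∀ g : M → ℝ, Eignet.IsPseudoDeriv μ φ ℓ r (Eignet.eignet G C a) g →
        eLpNorm g p μ ≤
          ENNReal.ofReal (c * (C : Set M).infsep ^ (-r)) * eLpNorm (Eignet.eignet G C a) p μ := by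
  have h : Eignet.IsHeatSystem μ φ ℓ α := ⟨hsys, hα, hball, hgauss, hint⟩
  obtain ⟨c, hc, hbern⟩ := Eignet.exists_bernstein h hlow hS hb hp hr hrβ
  set T : ℝ := max 2 (Metric.diam (univ : Set M)) with hT
  refine ⟨c * T ^ r, by positivity, fun C hC a => ?_⟩
  set Ψ := Eignet.eignet G C a
  have hΨi : Integrable Ψ μ := Eignet.integrable_eignet hG C a
  have hΨc := Eignet.integral_eignet_mul_phi h hG C a
  have hΨX : Eignet.MemX μ φ ℓ p Ψ := by
    obtain ⟨g, hg, hgi, hgc⟩ := Eignet.exists_memX_mask h hS hb hp (hr.trans hrβ) C a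
    refine hg.congr_ae (Eignet.ae_eq_of_coeff_eq h hΨi hgi fun k => ?_)
    rw [hΨc, hgc, Real.rpow_zero, one_mul]
  refine ⟨⟨hΨX, ?_⟩, fun g hg => ?_⟩
  · obtain ⟨g, hg, hgi, hgc⟩ := Eignet.exists_memX_mask h hS hb hp hrβ C a
    exact ⟨g, hg, hΨi, hgi, fun k => by rw [hgc, hΨc, mul_assoc]⟩
  · set q := (C : Set M).infsep with hq
    have hq0 : 0 < q := C.infsep_pos_iff_nontrivial.2 hC
    have hqT : q ≤ T := by
      obtain ⟨x, hx, y, hy, hxy⟩ := hC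
      exact ((infsep_le_dist_of_mem hx hy hxy).trans
        (Metric.dist_le_diam_of_mem isCompact_univ.isBounded trivial trivial)).trans
        (le_max_right _ _)
    obtain ⟨n₀, hn1, hn2⟩ := Eignet.exists_two_pow_near_inv hq0 (le_max_left _ _) hqT
    have hsep : ∀ y ∈ C, ∀ z ∈ C, y ≠ z → ((2 : ℝ) ^ n₀)⁻¹ ≤ dist y z := fun y hy z hz hyz =>
      hn1.trans (infsep_le_dist_of_mem hy hz hyz)
    refine (hbern n₀ C hsep a Ψ g hΨi hΨX.1.2.ne hΨc hg.2.1 hg.2.2).trans ?_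
    refine mul_le_mul_left (ENNReal.ofReal_le_ofReal ?_) _
    calc c * ((2 : ℝ) ^ n₀) ^ r ≤ c * (T / q) ^ r := by gcongr
      _ = c * T ^ r * q ^ (-r) := by
        rw [Real.div_rpow (by positivity) hq0.le, Real.rpow_neg hq0.le]
        ring
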